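/- Let $(\Omega,\mathcal F,\mathbb P)$ be a probability space carrying a Rademacher random multiplicative function $\beta$: $(\beta(p))_{p\text{ prime}}$ are i.i.d. with $\mathbb P(\beta(p)=1)=\mathbb P(\beta(p)=-1)=\tfrac12$, $\beta(n)=\prod_{p\mid n}\beta(p)$ for squarefree $n$, and $\beta(n)=0$ otherwise. Let $\theta\in(0,\tfrac12)$ and let $f\colon\mathbb N\to\mathbb R$ satisfy $f(nm)=f(n)f(m)$ for coprime $n,m$ and $f(n)=0$ for $n$ not squarefree. Suppose that $\sum_p |f(p)|^3p^{-3/2}<\infty$ and that $f^2\in\mathbf P_\theta$, i.e. $\mathcal E(t):=\sum_{p\le t}f(p)^2-\theta\frac{t}{\log t}$ satisfies $\mathcal E(t)=o(t/\log t)$ as $t\to\infty$ and $\int_2^\infty t^{-2}|\mathcal E(t)|\,dt<\infty$. For $y>0$ and $t>1$ put $$A_y(z)=\prod_{p\le y}\Bigl(1+\frac{\beta(p)f(p)}{p^{z}}\Bigr),\qquad A_\infty(z)=\lim_{N\to\infty}A_N(z),\qquad \sigma_t=\tfrac12\Bigl(1+\frac1{\log t}\Bigr),$$ $$m_{y,\infty}(ds)=\frac{|A_y(\frac12+is)|^2}{\mathbb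 E[|A_y(\frac12+is)|^2]}\,ds,\qquad m_{\infty,t}(ds)=\frac{|A_\infty(\sigma_t+is)|^2}{\mathbb E[|A_\infty(\sigma_t+is)|^2]}\,ds .$$ Then for all $t>1$ and $s\in\mathbb R$ the limit $A_\infty(\sigma_t+is)$ exists almost surely and belongs to $L^2(\mathbb P)$. Moreover, there is a random Radon measure $m_\infty$ on $\mathbb R$, almost surely nonzero, such that for every bounded interval $I\subset\mathbb R$ and every bounded continuous $h\colon I\to\mathbb R$, $$\text{(i)}\ \int_I h\,dm_{y,\infty}\to\int_I h\,dm_\infty\quad(y\to\infty),\qquad \text{(ii)}\ \int_I h\,dm_{\infty,t}\to\int_I h\,dm_\infty\quad(t\to\infty),$$ both in $L^2(\mathbb P)$, and in particular in probability. Finally, almost surely the support of $m_\infty$ is all of $\mathbb R$. -/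

import Mathlib

open MeasureTheory ProbabilityTheory Filter Topology Asymptotics
open scoped ENNReal

noncomputable section

namespace RandMult

/-- The partial sum `π_g(t) = ∑_{p ≤ t} g(p)` over primes. -/
def primeSum (g : ℕ → ℂ) (t : ℝ) : ℂ :=
  ∑ p ∈ Nat.primesLE ⌊t⌋₊, g p

/-- The error term `π_g(t) - θ t / log t`. -/
def primeSumError (θ : ℂ) (g : ℕ → ℂ) (t : ℝ) : ℂ :=
  primeSum g t - θ * ((t / Real.log t : ℝ) : ℂ)

/-- The class `P_θ`: the error term `E` of `π_g(t) = θ t / log t + E(t)` is `o(t / log t)` and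
`∫_2^∞ t⁻² |E(t)| dt < ∞`. -/
def ClassP (θ : ℂ) : Set (ℕ → ℂ) :=
  {g | (primeSumError θ g =o[atTop] fun t : ℝ => t / Real.log t) ∧
    IntegrableOn (fun t : ℝ => ‖primeSumError θ g t‖ / t ^ 2) (Set.Ioi 2) volume}

/-- Real-valued multiplicative functions on the positive integers that vanish on
non-squarefree integers (the value at `0` plays no role). -/
def MultSquarefree : Set (ℕ → ℝ) :=
  {f | (∀ m n : ℕ, 0 < m → 0 < n → Nat.Coprime m n → f (m * n) = f m * f n) ∧
    ∀ n : ℕ, 0 < n → ¬ Squarefree n → f n = 0}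

variable {Ω : Type*} [MeasurableSpace Ω]

/-- `β` is a Rademacher random multiplicative function on the probability space `(Ω, P)`. -/
structure IsRademacher (P : Measure Ω) (β : ℕ → Ω → ℝ) : Prop where
  measurable : ∀ p : ℕ, p.Prime → Measurable (β p)
  prob_one : ∀ p : ℕ, p.Prime → P {ω | β p ω = 1} = 1 / 2
  prob_neg_one : ∀ p : ℕ, p.Prime → P {ω | β p ω = -1} = 1 / 2
  indep : iIndepFun (fun p : Nat.Primes => β p) P
  squarefree : ∀ n : ℕ, Squarefree n → ∀ ω, β n ω = ∏ p ∈ n.primeFactors, β p ω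
  not_squarefree : ∀ n : ℕ, ¬ Squarefree n → ∀ ω, β n ω = 0

/-- The truncated Euler product `A_y(s) = ∏_{p ≤ y} (1 + β(p) f(p) / p^s)`. -/
def eulerProd (f : ℕ → ℝ) (β : ℕ → Ω → ℝ) (y : ℝ) (ω : Ω) (s : ℂ) : ℂ :=
  ∏ p ∈ Nat.primesLE ⌊y⌋₊, (1 + ((β p ω * f p : ℝ) : ℂ) / (p : ℂ) ^ s)

/-- The full Euler product `A_∞(s) = lim_{y → ∞} A_y(s)`, whenever the limit exists. -/
def eulerProdInf (f : ℕ → ℝ) (β : ℕ → Ω → ℝ) (ω : Ω) (s : ℂ) : ℂ :=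
  limUnder atTop fun N : ℕ => eulerProd f β N ω s

/-- `σ_t = (1 + 1 / log t) / 2`. -/
def sigma (t : ℝ) : ℝ := 1 / 2 * (1 + 1 / Real.log t)

/-- The point `σ + is`. -/
def vert (σ s : ℝ) : ℂ := (σ : ℂ) + Complex.I * (s : ℂ)

/-- For a random function `A`, the random measure
`|A(σ + is)|² / E[|A(σ + is)|²] ds` on the real line. -/
def normSqMeasure (P : Measure Ω) (A : Ω → ℂ → ℂ) (σ : ℝ) (ω : Ω) : Measure ℝ :=
  volume.withDensity fun s : ℝ =>
    ENNReal.ofReal (‖A ω (vert σ s)‖ ^ 2 / ∫ ω', ‖A ω' (vert σ s)‖ ^ 2 ∂P)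

/-- `m_{y,∞}(ds) = |A_y(1/2 + is)|² / E[|A_y(1/2 + is)|²] ds`. -/
def measY (P : Measure Ω) (f : ℕ → ℝ) (β : ℕ → Ω → ℝ) (y : ℝ) (ω : Ω) : Measure ℝ :=
  normSqMeasure P (eulerProd f β y) (1 / 2) ω

/-- `m_{∞,t}(ds) = |A_∞(σ_t + is)|² / E[|A_∞(σ_t + is)|²] ds`. -/
def measT (P : Measure Ω) (f : ℕ → ℝ) (β : ℕ → Ω → ℝ) (t : ℝ) (ω : Ω) : Measure ℝ :=
  normSqMeasure P (eulerProdInf f β) (sigma t) ω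

/-- `X_y → Y` in `L²(P)` as `y → ∞`, including membership in `L²(P)` of `Y` and of `X_y` for all
large `y`. -/
def TendstoL2 (P : Measure Ω) (X : ℝ → Ω → ℝ) (Y : Ω → ℝ) : Prop :=
  (∀ᶠ y in atTop, MemLp (X y) 2 P) ∧ MemLp Y 2 P ∧
    Tendsto (fun y => eLpNorm (X y - Y) 2 P) atTop (𝓝 0)

end RandMult

end

/-! Each squared Euler factor is affine in the sign `β p`. Put `a = f(p) p^{-(1+δ)/2}` and `c = 2a /
(1 + a²)`. On the line `Re z = (1+δ)/2` the normalised squared modulus is then `∏ (1 + c cos(s log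
p) β(p))`, a positive martingale of mean one. The case `δ = 0` gives `m_{y,∞}` and `δ = 1 / log t`
gives `m_{∞,t}`, so everything reduces to second moments estimated uniformly in `δ ∈ [0, 1]`.

The correlation of two such products at `s` and `s'` is `∏ (1 + c² cos(s log p) cos(s' log p))`.
Since `c² = 4a² + O(|a|³)` and the cubic sum converges, its logarithm is at most `2 ∑ f(p)² p^{-1-δ}
[cos((s-s') log p) + cos((s+s') log p)]` up to a constant. Abel summation against the `P_θ`
hypothesis bounds each cosine sum by `θ log max(1, 1/|u|) + O(1 + |u|)`
(`IsClassP.exists_sum_osc_le`). The kernel is therefore dominated by `|s-s'|^{-2θ} |s+s'|^{-2θ}`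
near the diagonals. In the coordinates `s ± s'` this is locally integrable exactly because `2θ < 1`.
Off the diagonals the contribution of the primes beyond `N` tends to 1. Dominated convergence makes
the kernels Cauchy in `L¹` on boxes (`IsAdmissible.exists_integral_abs_kern_sub_le`), and
orthogonality of martingale increments makes the masses `∫ g dm` Cauchy in `L²(P)`, uniformly in
`δ`, in the first prime retained, and in `g` with given bound and support
(`exists_eLpNorm_mass_sub_le`).

The limit measure is assembled from the limits of masses of intervals, via a Stieltjes function
built on the rationals (`exists_limit_measure`). All the random measures have Lebesgue mean, so `g ↦
∫ g dm` is an `L¹` contraction, and convergence on intervals extends to all integrable `g`. For `δ >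
0` the amplitudes are square summable, so the product converges by `L²` martingale convergence, and
the mass of `m_{∞,t}` is the limit of the truncated masses on its own line. The uniform rate then
permits letting `δ → 0` at fixed truncation, which gives (ii) with the same limit. For the support,
the first `N` factors are bounded below on most of a given interval, while the later factors perturb
the mass of that set only slightly in `L²`; hence an open interval has zero mass with probability at
most `2ε`, for every `ε` (`ae_integral_indicator_Ioo_ne_zero`). -/

noncomputable section

/-! ### Abel summation over primes and the oscillating main term -/

namespace RandMult

/-- The real error term `∑_{p ≤ t} g(p) - θ t / log t`. -/
def primeErr (θ : ℝ) (g : ℕ → ℝ) (t : ℝ) : ℝ :=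
  ∑ p ∈ Nat.primesLE ⌊t⌋₊, g p - θ * (t / Real.log t)

lemma norm_primeSumError (θ : ℝ) (g : ℕ → ℝ) (t : ℝ) :
    ‖primeSumError (θ : ℂ) (fun n => ((g n : ℝ) : ℂ)) t‖ = |primeErr θ g t| := by
  have : primeSumError (θ : ℂ) (fun n => ((g n : ℝ) : ℂ)) t = ((primeErr θ g t : ℝ) : ℂ) := by
    simp [primeSumError, primeSum, primeErr]
  rw [this, Complex.norm_real, Real.norm_eq_abs]

lemma sum_Icc_ite_prime (g : ℕ → ℝ) (n : ℕ) :
    ∑ k ∈ Finset.Icc 0 n, (if k.Prime then g k else 0) = ∑ p ∈ Nat.primesLE n, g p := by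
  rw [Nat.primesLE_eq_filter_Icc_zero, Finset.sum_filter]

/-- Partial summation splits the prime counting sum into its main term and the error. The boundary
errors cost `|E|/t` because `φ = O(1/t)`, and the integrated error costs `D ∫ |E|/t²`, which is
where the integrability half of `P_θ` enters. The main term is left as boundary terms minus an
integral, the form in which `osc_main_term_le` exploits its oscillation. -/
lemma abel_primes_le {θ : ℝ} {g : ℕ → ℝ} {φ φ' : ℝ → ℝ} {a b D : ℝ}
    (hE : IntegrableOn (fun t => |primeErr θ g t| / t ^ 2) (Set.Ioi 2))
    (ha : 2 ≤ a) (hab : a ≤ b)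
    (hφ : ∀ t ∈ Set.Icc a b, HasDerivAt φ (φ' t) t) (hφ' : ContinuousOn φ' (Set.Icc a b))
    (hb1 : ∀ t ∈ Set.Icc a b, |φ t| ≤ 1 / t) (hb2 : ∀ t ∈ Set.Icc a b, |φ' t| ≤ D / t ^ 2) :
    |∑ k ∈ Finset.Ioc ⌊a⌋₊ ⌊b⌋₊, φ k * (if k.Prime then g k else 0) -
      θ * (φ b * (b / Real.log b) - φ a * (a / Real.log a) -
        ∫ t in a..b, φ' t * (t / Real.log t))| ≤
      |primeErr θ g b| / b + |primeErr θ g a| / a +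
        D * ∫ t in Set.Ioi a, |primeErr θ g t| / t ^ 2 := by
  have ha0 : 0 < a := by linarith
  have hderiv : ∀ t ∈ Set.Icc a b, deriv φ t = φ' t := fun t ht => (hφ t ht).deriv
  have hint : IntegrableOn φ' (Set.Icc a b) := hφ'.integrableOn_Icc
  have hint' : IntegrableOn (deriv φ) (Set.Icc a b) :=
    hint.congr_fun (fun t ht => (hderiv t ht).symm) measurableSet_Icc
  have hsum := sum_mul_eq_sub_sub_integral_mul (fun k : ℕ => if k.Prime then g k else 0)
    ha0.le hab (fun t ht => (hφ t ht).differentiableAt) hint'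
  simp only [sum_Icc_ite_prime] at hsum
  have hI1 : IntegrableOn (fun t => φ' t * ∑ p ∈ Nat.primesLE ⌊t⌋₊, g p) (Set.Icc a b) := by
    have := integrableOn_mul_sum_Icc (fun k : ℕ => if k.Prime then g k else 0) (m := 0)
      ha0.le hint
    simpa only [sum_Icc_ite_prime] using this
  have hI2 : IntegrableOn (fun t => φ' t * (t / Real.log t)) (Set.Icc a b) := by
    apply ContinuousOn.integrableOn_Icc
    refine hφ'.mul (continuousOn_id.div (Real.continuousOn_log.mono ?_) ?_)
    · intro t ht; simp; linarith [ht.1]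
    · intro t ht; exact (Real.log_pos (by linarith [ht.1])).ne'
  have hI3 : IntegrableOn (fun t => φ' t * primeErr θ g t) (Set.Icc a b) := by
    have := hI1.sub (hI2.const_mul θ)
    refine this.congr_fun (fun t ht => ?_) measurableSet_Icc
    simp only [primeErr, Pi.sub_apply]; ring
  have e1 : ∫ t in Set.Ioc a b, deriv φ t * ∑ p ∈ Nat.primesLE ⌊t⌋₊, g p =
      (∫ t in Set.Ioc a b, φ' t * primeErr θ g t) +
        θ * ∫ t in Set.Ioc a b, φ' t * (t / Real.log t) := by
    rw [← integral_const_mul, ← integral_add (hI3.mono_set Set.Ioc_subset_Icc_self)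
      ((hI2.mono_set Set.Ioc_subset_Icc_self).const_mul θ)]
    refine setIntegral_congr_fun measurableSet_Ioc fun t ht => ?_
    simp only [hderiv t (Set.Ioc_subset_Icc_self ht), primeErr]; ring
  have e2 : ∀ t, ∑ p ∈ Nat.primesLE ⌊t⌋₊, g p = primeErr θ g t + θ * (t / Real.log t) := by
    intro t; simp [primeErr]
  have hbnd : |∫ t in Set.Ioc a b, φ' t * primeErr θ g t| ≤
      D * ∫ t in Set.Ioi a, |primeErr θ g t| / t ^ 2 := by
    have hEa : IntegrableOn (fun t => |primeErr θ g t| / t ^ 2) (Set.Ioi a) :=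
      hE.mono_set (Set.Ioi_subset_Ioi ha)
    have hD : 0 ≤ D := by
      have := (abs_nonneg _).trans (hb2 a ⟨le_rfl, hab⟩)
      by_contra h
      have : D / a ^ 2 < 0 := div_neg_of_neg_of_pos (by linarith) (by positivity)
      linarith
    rw [← integral_const_mul]
    calc |∫ t in Set.Ioc a b, φ' t * primeErr θ g t|
        ≤ ∫ t in Set.Ioc a b, D * (|primeErr θ g t| / t ^ 2) := by
          rw [← Real.norm_eq_abs]
          refine norm_integral_le_of_norm_le
            ((hEa.mono_set Set.Ioc_subset_Ioi_self).const_mul D) ?_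
          refine (ae_restrict_iff' measurableSet_Ioc).2 (ae_of_all _ fun t ht => ?_)
          rw [norm_mul, Real.norm_eq_abs, Real.norm_eq_abs]
          calc |φ' t| * |primeErr θ g t| ≤ D / t ^ 2 * |primeErr θ g t| :=
                mul_le_mul_of_nonneg_right (hb2 t (Set.Ioc_subset_Icc_self ht)) (abs_nonneg _)
            _ = _ := by ring
      _ ≤ _ := by
          refine setIntegral_mono_set (hEa.const_mul D) (ae_of_all _ fun t => ?_)
            (Set.Ioc_subset_Ioi_self).eventuallyLE
          simp only [Pi.zero_apply]; positivity
  rw [hsum, e1, e2, e2, intervalIntegral.integral_of_le hab]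
  have hfa := hb1 a ⟨le_rfl, hab⟩
  have hfb := hb1 b ⟨hab, le_rfl⟩
  have h1 : |φ b * primeErr θ g b| ≤ |primeErr θ g b| / b := by
    rw [abs_mul, div_eq_mul_one_div, mul_comm]
    exact mul_le_mul_of_nonneg_left hfb (abs_nonneg _)
  have h2 : |φ a * primeErr θ g a| ≤ |primeErr θ g a| / a := by
    rw [abs_mul, div_eq_mul_one_div, mul_comm]
    exact mul_le_mul_of_nonneg_left hfa (abs_nonneg _)
  have : φ b * (primeErr θ g b + θ * (b / Real.log b)) -
        φ a * (primeErr θ g a + θ * (a / Real.log a)) -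
        ((∫ t in Set.Ioc a b, φ' t * primeErr θ g t) +
          θ * ∫ t in Set.Ioc a b, φ' t * (t / Real.log t)) -
      θ * (φ b * (b / Real.log b) - φ a * (a / Real.log a) -
        ∫ t in Set.Ioc a b, φ' t * (t / Real.log t)) =
      φ b * primeErr θ g b - φ a * primeErr θ g a -
        ∫ t in Set.Ioc a b, φ' t * primeErr θ g t := by ring
  rw [this]
  calc _ ≤ |φ b * primeErr θ g b| + |φ a * primeErr θ g a| +
        |∫ t in Set.Ioc a b, φ' t * primeErr θ g t| := by
        refine (abs_sub _ _).trans ?_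
        gcongr; exact abs_sub _ _
    _ ≤ _ := by linarith

/-- `t^{-1-δ} cos(u log t)`. -/
def osc (δ u t : ℝ) : ℝ := Real.exp (-(1 + δ) * Real.log t) * Real.cos (u * Real.log t)

/-- The derivative of `osc δ u`. -/
def oscDeriv (δ u t : ℝ) : ℝ :=
  Real.exp (-(1 + δ) * Real.log t) * (-(1 + δ) * Real.cos (u * Real.log t) -
    u * Real.sin (u * Real.log t)) * t⁻¹

lemma hasDerivAt_osc (δ u : ℝ) {t : ℝ} (ht : 0 < t) :
    HasDerivAt (osc δ u) (oscDeriv δ u t) t := by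
  have hl := Real.hasDerivAt_log ht.ne'
  have h1 := (hl.const_mul (-(1 + δ))).exp
  have h2 := (hl.const_mul u).cos
  convert! h1.mul h2 using 1
  simp only [oscDeriv]; ring

lemma continuousOn_oscDeriv (δ u : ℝ) {a b : ℝ} (ha : 0 < a) :
    ContinuousOn (oscDeriv δ u) (Set.Icc a b) := by
  have hl : ContinuousOn Real.log (Set.Icc a b) :=
    Real.continuousOn_log.mono fun t ht => by
      simp only [Set.mem_compl_iff, Set.mem_singleton_iff]; linarith [ht.1]
  have hi : ContinuousOn (fun t : ℝ => t⁻¹) (Set.Icc a b) :=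
    continuousOn_inv₀.mono fun t ht => by
      simp only [Set.mem_compl_iff, Set.mem_singleton_iff]; linarith [ht.1]
  unfold oscDeriv
  fun_prop

lemma exp_neg_log_le {δ t : ℝ} (hδ : 0 ≤ δ) (ht : 1 ≤ t) :
    Real.exp (-(1 + δ) * Real.log t) ≤ 1 / t := by
  have : 1 / t = Real.exp (-Real.log t) := by
    rw [Real.exp_neg, Real.exp_log (by linarith), one_div]
  rw [this]
  apply Real.exp_le_exp.2
  nlinarith [Real.log_nonneg ht]

lemma abs_osc_le {δ t : ℝ} (u : ℝ) (hδ : 0 ≤ δ) (ht : 1 ≤ t) : |osc δ u t| ≤ 1 / t := by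
  rw [osc, abs_mul, abs_of_pos (Real.exp_pos _)]
  calc _ ≤ Real.exp (-(1 + δ) * Real.log t) * 1 := by gcongr; exact Real.abs_cos_le_one _
    _ ≤ _ := by rw [mul_one]; exact exp_neg_log_le hδ ht

lemma abs_oscDeriv_le {δ t : ℝ} (u : ℝ) (hδ : δ ∈ Set.Icc (0 : ℝ) 1) (ht : 1 ≤ t) :
    |oscDeriv δ u t| ≤ (2 + |u|) / t ^ 2 := by
  have ht0 : 0 < t := by linarith
  rw [oscDeriv, abs_mul, abs_mul, abs_of_pos (Real.exp_pos _), abs_of_pos (inv_pos.2 ht0)]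
  have h1 : |-(1 + δ) * Real.cos (u * Real.log t) - u * Real.sin (u * Real.log t)| ≤ 2 + |u| := by
    refine (abs_sub _ _).trans ?_
    rw [abs_mul, abs_mul, abs_neg, abs_of_nonneg (by linarith [hδ.1] : (0 : ℝ) ≤ 1 + δ)]
    have := Real.abs_cos_le_one (u * Real.log t)
    have := Real.abs_sin_le_one (u * Real.log t)
    have := abs_nonneg u
    nlinarith [hδ.1, hδ.2, abs_nonneg (Real.cos (u * Real.log t)),
      abs_nonneg (Real.sin (u * Real.log t))]
  calc _ ≤ 1 / t * (2 + |u|) * t⁻¹ := by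
        gcongr; exact exp_neg_log_le hδ.1 ht
    _ = _ := by field_simp

lemma osc_mul_div_log (δ u : ℝ) {t : ℝ} (ht : 0 < t) :
    osc δ u t * (t / Real.log t) =
      Real.exp (-δ * Real.log t) * Real.cos (u * Real.log t) / Real.log t := by
  have : Real.exp (-δ * Real.log t) = Real.exp (-(1 + δ) * Real.log t) * t := by
    nth_rewrite 3 [← Real.exp_log ht]
    rw [← Real.exp_add]; ring_nf
  rw [this, osc]; ring

lemma oscDeriv_mul_div_log (δ u : ℝ) {t : ℝ} (ht : 0 < t) :
    oscDeriv δ u t * (t / Real.log t) =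
      Real.exp (-δ * Real.log t) * (-(1 + δ) * Real.cos (u * Real.log t) -
        u * Real.sin (u * Real.log t)) / Real.log t * t⁻¹ := by
  have : Real.exp (-δ * Real.log t) = Real.exp (-(1 + δ) * Real.log t) * t := by
    nth_rewrite 3 [← Real.exp_log ht]
    rw [← Real.exp_add]; ring_nf
  rw [this, oscDeriv]; ring

/-- With `x = log t` this is an integral of `e^{-δx} cos(ux) / x` in disguise, and one more
integration by parts gains the factor `1/|u|`. The constant does not involve `δ`, which is what
later allows `δ → 0`. -/
lemma osc_main_term_le {δ u a b : ℝ} (hδ : δ ∈ Set.Icc (0 : ℝ) 1) (hu : u ≠ 0) (ha : 2 ≤ a)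
    (hab : a ≤ b) :
    |osc δ u b * (b / Real.log b) - osc δ u a * (a / Real.log a) -
        ∫ t in a..b, oscDeriv δ u t * (t / Real.log t)| ≤
      (1 + 2 / |u|) / Real.log a := by
  -- `w` is an approximate antiderivative of the integrand in the variable `x = log t`: it is the
  -- boundary function `e^{-δx} cos(ux)/x` corrected by a sine term of size `1/|u|`.
  set w : ℝ → ℝ := fun x =>
    Real.exp (-δ * x) * (Real.cos (u * x) - Real.sin (u * x) / u) / x with hw
  set w' : ℝ → ℝ := fun x =>
    ((-δ * Real.exp (-δ * x) * (Real.cos (u * x) - Real.sin (u * x) / u) +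
      Real.exp (-δ * x) * (-u * Real.sin (u * x) - Real.cos (u * x))) * x -
      Real.exp (-δ * x) * (Real.cos (u * x) - Real.sin (u * x) / u)) / x ^ 2 with hw'
  -- `B'` majorises the defect of `w'`. Bounding by an exact derivative integrates the contribution
  -- `δ e^{-δx}/x` without any loss as `δ → 0`.
  set B : ℝ → ℝ := fun x => -(Real.exp (-δ * x) / (x * |u|)) - 1 / x with hB
  set B' : ℝ → ℝ := fun x =>
    Real.exp (-δ * x) * (δ / x + 1 / x ^ 2) / |u| + 1 / x ^ 2 with hB'
  have hupos : 0 < |u| := abs_pos.2 hu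
  have hpos : ∀ t ∈ Set.Icc a b, 0 < t := fun t ht => by linarith [ht.1]
  have hlog : ∀ t ∈ Set.Icc a b, 0 < Real.log t := fun t ht => Real.log_pos (by linarith [ht.1])
  have hdw : ∀ x, 0 < x → HasDerivAt w (w' x) x := by
    intro x hx
    have h0 := hasDerivAt_id' x
    have h1 := (h0.const_mul (-δ)).exp
    have h2 := (h0.const_mul u).cos
    have h3 := ((h0.const_mul u).sin).div_const u
    convert! (h1.mul (h2.sub h3)).div h0 hx.ne' using 1
    simp only [hw', Pi.sub_apply, Pi.mul_apply]
    field_simp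
  have hdB : ∀ x, 0 < x → HasDerivAt B (B' x) x := by
    intro x hx
    have h0 := hasDerivAt_id' x
    have h1 := (h0.const_mul (-δ)).exp
    have h2 := h0.mul_const |u|
    have h3 := (hasDerivAt_const x (1 : ℝ)).div h0 hx.ne'
    convert! ((h1.div h2 (by positivity)).neg).sub h3 using 1
    simp only [hB']
    field_simp
    ring
  have hkey : ∀ x, 0 < x → |w' x - Real.exp (-δ * x) * (-(1 + δ) * Real.cos (u * x) -
        u * Real.sin (u * x)) / x| ≤ B' x := by
    intro x hx
    have e : w' x - Real.exp (-δ * x) * (-(1 + δ) * Real.cos (u * x) -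
        u * Real.sin (u * x)) / x = Real.exp (-δ * x) * (δ / x + 1 / x ^ 2) / u * Real.sin (u * x)
          - Real.exp (-δ * x) * (1 / x ^ 2) * Real.cos (u * x) := by
      simp only [hw']; field_simp; ring
    rw [e]
    refine (abs_sub _ _).trans ?_
    have hδ0 := hδ.1
    have hex : Real.exp (-δ * x) ≤ 1 := Real.exp_le_one_iff.2 (by nlinarith)
    have hq : 0 ≤ Real.exp (-δ * x) * (δ / x + 1 / x ^ 2) := by positivity
    rw [abs_mul, abs_mul, abs_div, abs_of_nonneg hq, abs_of_nonneg
      (by positivity : 0 ≤ Real.exp (-δ * x) * (1 / x ^ 2))]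
    refine add_le_add ?_ ?_
    · exact mul_le_of_le_one_right (by positivity) (Real.abs_sin_le_one _)
    · calc _ ≤ Real.exp (-δ * x) * (1 / x ^ 2) * 1 := by gcongr; exact Real.abs_cos_le_one _
        _ ≤ 1 * (1 / x ^ 2) * 1 := by gcongr
        _ = _ := by ring
  have hlc : ContinuousOn Real.log (Set.uIcc a b) := by
    rw [Set.uIcc_of_le hab]
    exact Real.continuousOn_log.mono fun t ht => by
      simpa using (hpos t ht).ne'
  have hic : ContinuousOn (fun t : ℝ => t⁻¹) (Set.uIcc a b) := by
    rw [Set.uIcc_of_le hab]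
    exact continuousOn_inv₀.mono fun t ht => by simpa using (hpos t ht).ne'
  have hl0 : ∀ t ∈ Set.uIcc a b, Real.log t ≠ 0 := by
    rw [Set.uIcc_of_le hab]; exact fun t ht => (hlog t ht).ne'
  have hl2 : ∀ t ∈ Set.uIcc a b, Real.log t ^ 2 ≠ 0 := fun t ht => pow_ne_zero _ (hl0 t ht)
  have hcw : IntervalIntegrable (fun t => w' (Real.log t) * t⁻¹) volume a b := by
    apply ContinuousOn.intervalIntegrable
    simp only [hw']
    refine ContinuousOn.mul (ContinuousOn.div ?_ (hlc.pow 2) hl2) hic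
    fun_prop
  have hcB : IntervalIntegrable (fun t => B' (Real.log t) * t⁻¹) volume a b := by
    apply ContinuousOn.intervalIntegrable
    simp only [hB']
    have h1 : ContinuousOn (fun t => δ / Real.log t) (Set.uIcc a b) :=
      continuousOn_const.div hlc hl0
    have h2 : ContinuousOn (fun t => 1 / Real.log t ^ 2) (Set.uIcc a b) :=
      continuousOn_const.div (hlc.pow 2) hl2
    fun_prop
  have hcφ : IntervalIntegrable (fun t => oscDeriv δ u t * (t / Real.log t)) volume a b := by
    apply ContinuousOn.intervalIntegrable
    have := continuousOn_oscDeriv δ u (a := a) (b := b) (by linarith)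
    rw [← Set.uIcc_of_le hab] at this
    exact this.mul (continuousOn_id.div hlc hl0)
  have hIw : ∫ t in a..b, w' (Real.log t) * t⁻¹ = w (Real.log b) - w (Real.log a) := by
    refine intervalIntegral.integral_eq_sub_of_hasDerivAt (f := fun t => w (Real.log t))
      (fun t ht => ?_) hcw
    rw [Set.uIcc_of_le hab] at ht
    exact (hdw _ (hlog t ht)).comp t (Real.hasDerivAt_log (hpos t ht).ne')
  have hIB : ∫ t in a..b, B' (Real.log t) * t⁻¹ = B (Real.log b) - B (Real.log a) := by
    refine intervalIntegral.integral_eq_sub_of_hasDerivAt (f := fun t => B (Real.log t))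
      (fun t ht => ?_) hcB
    rw [Set.uIcc_of_le hab] at ht
    exact (hdB _ (hlog t ht)).comp t (Real.hasDerivAt_log (hpos t ht).ne')
  have hdiff : |(w (Real.log b) - w (Real.log a)) -
      ∫ t in a..b, oscDeriv δ u t * (t / Real.log t)| ≤ B (Real.log b) - B (Real.log a) := by
    rw [← hIw, ← hIB, ← intervalIntegral.integral_sub hcw hcφ, ← Real.norm_eq_abs]
    refine intervalIntegral.norm_integral_le_of_norm_le hab (ae_of_all _ fun t ht => ?_) hcB
    have ht' := Set.Ioc_subset_Icc_self ht
    rw [oscDeriv_mul_div_log δ u (hpos t ht'), ← sub_mul, norm_mul, Real.norm_eq_abs,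
      Real.norm_eq_abs, abs_of_pos (inv_pos.2 (hpos t ht'))]
    exact mul_le_mul_of_nonneg_right (hkey _ (hlog t ht')) (inv_pos.2 (hpos t ht')).le
  have haI : a ∈ Set.Icc a b := ⟨le_rfl, hab⟩
  have hbI : b ∈ Set.Icc a b := ⟨hab, le_rfl⟩
  rw [osc_mul_div_log δ u (hpos a haI), osc_mul_div_log δ u (hpos b hbI)]
  have hS : ∀ x, 0 < x → |Real.exp (-δ * x) * (Real.sin (u * x) / u) / x| ≤
      Real.exp (-δ * x) / (x * |u|) := by
    intro x hx
    have : Real.exp (-δ * x) * (Real.sin (u * x) / u) / x =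
      Real.exp (-δ * x) / (x * u) * Real.sin (u * x) := by field_simp
    rw [this, abs_mul, abs_div, abs_mul, abs_of_pos hx, abs_of_pos (Real.exp_pos _)]
    exact mul_le_of_le_one_right (by positivity) (Real.abs_sin_le_one _)
  -- The `w` parts of the boundary terms cancel against the integral of `w'`. The sine remainder at
  -- `b` is absorbed by `B (log b)`, and the one at `a` adds to `-B (log a)`, whence the factor 2 in
  -- `2 / |u|`.
  have hsplit : ∀ x, 0 < x → Real.exp (-δ * x) * Real.cos (u * x) / x =
      w x + Real.exp (-δ * x) * (Real.sin (u * x) / u) / x := by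
    intro x hx; simp only [hw]; ring
  rw [hsplit _ (hlog a haI), hsplit _ (hlog b hbI)]
  have h1 := hS _ (hlog a haI)
  have h2 := hS _ (hlog b hbI)
  have hea : Real.exp (-δ * Real.log a) / (Real.log a * |u|) ≤ 1 / (Real.log a * |u|) := by
    have := hlog a haI
    gcongr
    exact Real.exp_le_one_iff.2 (by nlinarith [hδ.1])
  have hlb := hlog b hbI
  have hla := hlog a haI
  have hfin : (1 + 2 / |u|) / Real.log a =
      1 / Real.log a + 1 / (Real.log a * |u|) + 1 / (Real.log a * |u|) := by
    field_simp; ring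
  have hb1 : 0 ≤ 1 / Real.log b := by positivity
  simp only [hB] at hdiff
  rw [abs_le] at *
  rw [hfin]
  constructor <;> linarith [h1.1, h1.2, h2.1, h2.2, hdiff.1, hdiff.2]

end RandMult

/-! ### Sums of oscillating functions over primes for the class `P_θ` -/

namespace RandMult

/-- The primes in `(L, M]`. -/
def primesIoc (L M : ℕ) : Finset ℕ := (Finset.Ioc L M).filter Nat.Prime

lemma mem_primesIoc {L M p : ℕ} : p ∈ primesIoc L M ↔ (L < p ∧ p ≤ M) ∧ p.Prime := by
  simp [primesIoc]

lemma primesLE_eq_primesIoc (N : ℕ) : Nat.primesLE N = primesIoc 0 N :=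
  Nat.primesLE_eq_filter_Ioc_zero N

lemma sum_primesIoc (L M : ℕ) (F g : ℕ → ℝ) :
    ∑ p ∈ primesIoc L M, F p * g p =
      ∑ k ∈ Finset.Ioc L M, F k * (if k.Prime then g k else 0) := by
  rw [primesIoc, Finset.sum_filter]
  refine Finset.sum_congr rfl fun k _ => ?_
  split_ifs <;> simp

/-- Real-variable form of the class `P_θ`. -/
structure IsClassP (θ : ℝ) (g : ℕ → ℝ) : Prop where
  isLittleO : primeErr θ g =o[atTop] fun t : ℝ => t / Real.log t
  integrable : IntegrableOn (fun t => |primeErr θ g t| / t ^ 2) (Set.Ioi 2)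

lemma isClassP_of_mem {θ : ℝ} {g : ℕ → ℝ}
    (h : (fun n : ℕ => ((g n : ℝ) : ℂ)) ∈ ClassP (θ : ℂ)) : IsClassP θ g := by
  refine ⟨?_, ?_⟩
  · have := h.1
    rw [← isLittleO_norm_left] at this ⊢
    simpa only [norm_primeSumError, Real.norm_eq_abs] using this
  · simpa only [norm_primeSumError] using h.2

namespace IsClassP

variable {θ : ℝ} {g : ℕ → ℝ}

lemma eventually_abs_primeErr_le (h : IsClassP θ g) {ε : ℝ} (hε : 0 < ε) :
    ∀ᶠ t : ℝ in atTop, |primeErr θ g t| / t ≤ ε := by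
  filter_upwards [h.isLittleO.def hε, eventually_ge_atTop (Real.exp 1)] with t ht h3
  have ht0 : 0 < t := (Real.exp_pos 1).trans_le h3
  have hl : 1 ≤ Real.log t := by
    rw [Real.le_log_iff_exp_le ht0]; exact h3
  rw [Real.norm_eq_abs, Real.norm_eq_abs,
    abs_of_nonneg (div_nonneg ht0.le (by linarith) : 0 ≤ t / Real.log t)] at ht
  rw [div_le_iff₀ ht0]
  refine ht.trans ?_
  gcongr
  exact div_le_self ht0.le hl

/-- The little-o hypothesis settles large `t`. On the remaining range, nonnegativity of `g` bounds
the prime sum by its value at the threshold. -/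
lemma exists_abs_primeErr_le (h : IsClassP θ g) (hg : ∀ n, 0 ≤ g n) (hθ : 0 ≤ θ) :
    ∃ C, 0 ≤ C ∧ ∀ t : ℝ, 2 ≤ t → |primeErr θ g t| / t ≤ C := by
  obtain ⟨T, hT⟩ := eventually_atTop.1 (h.eventually_abs_primeErr_le one_pos)
  set C0 := ∑ p ∈ Nat.primesLE ⌊T⌋₊, g p + θ / Real.log 2
  have hl2 : 0 < Real.log 2 := Real.log_pos (by norm_num)
  have hC0 : 0 ≤ C0 := add_nonneg (Finset.sum_nonneg fun p _ => hg p) (by positivity)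
  refine ⟨max 1 C0, by positivity, fun t ht => ?_⟩
  rcases le_total T t with hTt | hTt
  · exact (hT t hTt).trans (le_max_left _ _)
  · refine le_trans ?_ (le_max_right _ _)
    have ht0 : 0 < t := by linarith
    rw [div_le_iff₀ ht0]
    have hsub : ∑ p ∈ Nat.primesLE ⌊t⌋₊, g p ≤ ∑ p ∈ Nat.primesLE ⌊T⌋₊, g p := by
      refine Finset.sum_le_sum_of_subset_of_nonneg (fun p hp => ?_) fun p _ _ => hg p
      rw [Nat.mem_primesLE] at hp ⊢
      exact ⟨hp.1.trans (Nat.floor_le_floor hTt), hp.2⟩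
    have hs0 : 0 ≤ ∑ p ∈ Nat.primesLE ⌊t⌋₊, g p := Finset.sum_nonneg fun p _ => hg p
    have hlt : Real.log 2 ≤ Real.log t := Real.log_le_log (by norm_num) ht
    have hlt0 : 0 < Real.log t := hl2.trans_le hlt
    have h2 : t / Real.log t ≤ t / Real.log 2 := by gcongr
    calc |primeErr θ g t| ≤ |∑ p ∈ Nat.primesLE ⌊t⌋₊, g p| + |θ * (t / Real.log t)| := abs_sub _ _
      _ = ∑ p ∈ Nat.primesLE ⌊t⌋₊, g p + θ * (t / Real.log t) := by
          rw [abs_of_nonneg hs0, abs_of_nonneg (by positivity)]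
      _ ≤ (∑ p ∈ Nat.primesLE ⌊T⌋₊, g p) * t + θ * (t / Real.log 2) := by
          have : 0 ≤ ∑ p ∈ Nat.primesLE ⌊T⌋₊, g p := hs0.trans hsub
          gcongr
          nlinarith
      _ = C0 * t := by simp only [C0]; ring

lemma abs_sum_osc_le (h : IsClassP θ g) (hθ : 0 ≤ θ) {δ u a b : ℝ}
    (hδ : δ ∈ Set.Icc (0 : ℝ) 1) (hu : u ≠ 0) (ha : 2 ≤ a) (hab : a ≤ b) :
    |∑ p ∈ primesIoc ⌊a⌋₊ ⌊b⌋₊, osc δ u p * g p| ≤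
      |primeErr θ g b| / b + |primeErr θ g a| / a +
        (2 + |u|) * (∫ t in Set.Ioi a, |primeErr θ g t| / t ^ 2) +
        θ * ((1 + 2 / |u|) / Real.log a) := by
  have h1 := abel_primes_le (D := 2 + |u|) (φ := osc δ u) (φ' := oscDeriv δ u) h.integrable ha hab
    (fun t ht => hasDerivAt_osc δ u (by linarith [ht.1])) (continuousOn_oscDeriv δ u (by linarith))
    (fun t ht => abs_osc_le u hδ.1 (by linarith [ht.1]))
    (fun t ht => abs_oscDeriv_le u hδ (by linarith [ht.1]))
  have h2 := osc_main_term_le hδ hu ha hab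
  rw [sum_primesIoc ⌊a⌋₊ ⌊b⌋₊ (fun k => osc δ u k) g]
  have h3 := mul_le_mul_of_nonneg_left h2 hθ
  rw [← abs_of_nonneg hθ, ← abs_mul, abs_of_nonneg hθ] at h3
  rw [abs_le] at h1 h3 ⊢
  constructor <;> linarith [h1.1, h1.2, h3.1, h3.2]

lemma exists_abs_sum_osc_le (h : IsClassP θ g) (hg : ∀ n, 0 ≤ g n) (hθ : 0 ≤ θ) :
    ∃ C, 0 ≤ C ∧ ∀ δ ∈ Set.Icc (0 : ℝ) 1, ∀ u a b : ℝ, u ≠ 0 → 2 ≤ a → a ≤ b →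
      |∑ p ∈ primesIoc ⌊a⌋₊ ⌊b⌋₊, osc δ u p * g p| ≤
        C * (4 + |u|) + θ * ((1 + 2 / |u|) / Real.log a) := by
  obtain ⟨C, hC, hC'⟩ := h.exists_abs_primeErr_le hg hθ
  have hnn : ∀ t, 0 ≤ |primeErr θ g t| / t ^ 2 := fun t => by positivity
  have hI : 0 ≤ ∫ t in Set.Ioi 2, |primeErr θ g t| / t ^ 2 := integral_nonneg hnn
  refine ⟨max C (∫ t in Set.Ioi 2, |primeErr θ g t| / t ^ 2), by positivity,
    fun δ hδ u a b hu ha hab => (h.abs_sum_osc_le hθ hδ hu ha hab).trans ?_⟩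
  have h1 := (hC' b (ha.trans hab)).trans (le_max_left C (∫ t in Set.Ioi 2, |primeErr θ g t| / t ^ 2))
  have h2 := (hC' a ha).trans (le_max_left C (∫ t in Set.Ioi 2, |primeErr θ g t| / t ^ 2))
  have h3 : ∫ t in Set.Ioi a, |primeErr θ g t| / t ^ 2 ≤
      max C (∫ t in Set.Ioi 2, |primeErr θ g t| / t ^ 2) := by
    refine le_trans ?_ (le_max_right _ _)
    exact setIntegral_mono_set h.integrable (ae_of_all _ hnn)
      (Set.Ioi_subset_Ioi ha).eventuallyLE
  have h4 := mul_le_mul_of_nonneg_left h3 (by positivity : 0 ≤ 2 + |u|)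
  nlinarith

/-- Far out, both the pointwise error and the tail of its integral are at most `ε`. What remains
decays like `1 / log a` for fixed `u ≠ 0`, uniformly in `δ` and `b`. -/
lemma exists_abs_sum_osc_tail_le (h : IsClassP θ g) (hθ : 0 ≤ θ) {ε : ℝ} (hε : 0 < ε) :
    ∃ A, 2 ≤ A ∧ ∀ δ ∈ Set.Icc (0 : ℝ) 1, ∀ u a b : ℝ, u ≠ 0 → A ≤ a → a ≤ b →
      |∑ p ∈ primesIoc ⌊a⌋₊ ⌊b⌋₊, osc δ u p * g p| ≤
        ε * (4 + |u|) + θ * ((1 + 2 / |u|) / Real.log a) := by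
  have ht : Tendsto (fun a : ℝ => ∫ t in Set.Ioi a, |primeErr θ g t| / t ^ 2) atTop (𝓝 0) :=
    tendsto_integral_Ioi_zero tendsto_id
  obtain ⟨A1, hA1⟩ := eventually_atTop.1 (h.eventually_abs_primeErr_le hε)
  obtain ⟨A2, hA2⟩ := eventually_atTop.1 (ht.eventually (ge_mem_nhds hε))
  refine ⟨max 2 (max A1 A2), le_max_left _ _, fun δ hδ u a b hu ha hab => ?_⟩
  have ha2 : 2 ≤ a := (le_max_left _ _).trans ha
  have ha1 : A1 ≤ a := (le_max_left _ _).trans ((le_max_right _ _).trans ha)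
  have ha3 : A2 ≤ a := (le_max_right _ _).trans ((le_max_right _ _).trans ha)
  refine (h.abs_sum_osc_le hθ hδ hu ha2 hab).trans ?_
  have h1 := hA1 b (ha1.trans hab)
  have h2 := hA1 a ha1
  have h4 := mul_le_mul_of_nonneg_left (hA2 a ha3) (by positivity : 0 ≤ 2 + |u|)
  nlinarith

/-- A Mertens-type bound: without oscillation the main term `∫ dt / (t log t)` integrates to `log
log`. Here `osc 0 0 p` is `1 / p`. -/
lemma exists_sum_div_le (h : IsClassP θ g) (hg : ∀ n, 0 ≤ g n) (hθ : 0 ≤ θ) :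
    ∃ C, 0 ≤ C ∧ ∀ b : ℝ, 2 ≤ b →
      ∑ p ∈ primesIoc 0 ⌊b⌋₊, osc 0 0 p * g p ≤ θ * Real.log (Real.log b) + C := by
  obtain ⟨C, hC, hC'⟩ := h.exists_abs_primeErr_le hg hθ
  set I := ∫ t in Set.Ioi 2, |primeErr θ g t| / t ^ 2
  have hI : 0 ≤ I := integral_nonneg fun t => by positivity
  set S := ∑ p ∈ primesIoc 0 2, osc 0 0 p * g p
  have hS : 0 ≤ S := Finset.sum_nonneg fun p _ => mul_nonneg (by simp [osc, Real.exp_nonneg]) (hg p)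
  have hl2 : 0 < Real.log 2 := Real.log_pos (by norm_num)
  set K := θ * (1 / Real.log 2 + |Real.log (Real.log 2)|)
  refine ⟨S + 2 * C + 2 * I + K, by positivity, fun b hb => ?_⟩
  have h1 := abel_primes_le (D := 2 + |(0 : ℝ)|) (φ := osc 0 0) (φ' := oscDeriv 0 0)
    h.integrable le_rfl hb
    (fun t ht => hasDerivAt_osc 0 0 (by linarith [ht.1])) (continuousOn_oscDeriv 0 0 (by norm_num))
    (fun t ht => abs_osc_le 0 le_rfl (by linarith [ht.1]))
    (fun t ht => abs_oscDeriv_le 0 ⟨le_rfl, zero_le_one⟩ (by linarith [ht.1]))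
  rw [← sum_primesIoc ⌊(2 : ℝ)⌋₊ ⌊b⌋₊ (fun k => osc 0 0 k) g] at h1
  have hf2 : ⌊(2 : ℝ)⌋₊ = 2 := by norm_num
  rw [hf2] at h1
  have hsplit : ∑ p ∈ primesIoc 0 ⌊b⌋₊, osc 0 0 p * g p =
      S + ∑ p ∈ primesIoc 2 ⌊b⌋₊, osc 0 0 p * g p := by
    have hfb : 2 ≤ ⌊b⌋₊ := Nat.le_floor (by exact_mod_cast hb)
    simp only [S, sum_primesIoc _ _ (fun k => osc 0 0 k)]
    exact (Finset.sum_Ioc_consecutive _ (Nat.zero_le 2) hfb).symm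
  have hlog : ∀ t ∈ Set.uIcc 2 b, 0 < Real.log t := fun t ht => by
    rw [Set.uIcc_of_le hb] at ht
    exact Real.log_pos (by linarith [ht.1])
  have hint : ∫ t in (2 : ℝ)..b, oscDeriv 0 0 t * (t / Real.log t) =
      -(Real.log (Real.log b) - Real.log (Real.log 2)) := by
    have e : ∀ t ∈ Set.uIcc 2 b, oscDeriv 0 0 t * (t / Real.log t) = -(t⁻¹ / Real.log t) := by
      intro t ht
      rw [Set.uIcc_of_le hb] at ht
      rw [oscDeriv_mul_div_log 0 0 (by linarith [ht.1])]
      simp; ring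
    rw [intervalIntegral.integral_congr e, intervalIntegral.integral_neg]
    congr 1
    refine intervalIntegral.integral_eq_sub_of_hasDerivAt (f := fun t => Real.log (Real.log t))
      (fun t ht => ?_) ?_
    · have h0 := hlog t ht
      rw [Set.uIcc_of_le hb] at ht
      exact (Real.hasDerivAt_log (by linarith [ht.1])).log h0.ne'
    · apply ContinuousOn.intervalIntegrable
      refine ContinuousOn.div ?_ ?_ fun t ht => (hlog t ht).ne'
      · refine continuousOn_inv₀.mono fun t ht => ?_
        rw [Set.uIcc_of_le hb] at ht
        simp only [Set.mem_compl_iff, Set.mem_singleton_iff]; linarith [ht.1]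
      · refine Real.continuousOn_log.mono fun t ht => ?_
        rw [Set.uIcc_of_le hb] at ht
        simp only [Set.mem_compl_iff, Set.mem_singleton_iff]; linarith [ht.1]
  rw [hint, osc_mul_div_log 0 0 (by linarith), osc_mul_div_log 0 0 (by norm_num)] at h1
  simp only [neg_zero, zero_mul, Real.exp_zero, Real.cos_zero, mul_one, abs_zero, add_zero] at h1
  have hb1 := hC' b hb
  have hb2 := hC' 2 le_rfl
  have hlb : Real.log 2 ≤ Real.log b := Real.log_le_log (by norm_num) hb
  have h5 : 1 / Real.log b ≤ 1 / Real.log 2 := by gcongr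
  have h6 := neg_abs_le (Real.log (Real.log 2))
  have h7 : θ * (1 / Real.log b - 1 / Real.log 2 -
      -(Real.log (Real.log b) - Real.log (Real.log 2))) ≤
      θ * Real.log (Real.log b) + K := by
    simp only [K]
    rw [← mul_add]
    refine mul_le_mul_of_nonneg_left ?_ hθ
    have : 0 < 1 / Real.log 2 := by positivity
    linarith
  rw [hsplit]
  rw [abs_le] at h1
  linarith [h1.2]

/-- The cosine does not oscillate until `log p` reaches about `1/|u|`. Up to that point the Mertens
bound gives `θ log (1/|u|)`; beyond it the oscillating estimate costs only a bounded amount. Only an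
upper bound is needed, because it serves to dominate the kernel. -/
lemma exists_sum_osc_le (h : IsClassP θ g) (hg : ∀ n, 0 ≤ g n) (hθ : 0 ≤ θ) :
    ∃ C, 0 ≤ C ∧ ∀ δ ∈ Set.Icc (0 : ℝ) 1, ∀ u : ℝ, u ≠ 0 → ∀ L M : ℕ,
      ∑ p ∈ primesIoc L M, osc δ u p * g p ≤
        θ * Real.log (max 1 (1 / |u|)) + C * (1 + |u|) := by
  obtain ⟨C1, hC1, h1⟩ := h.exists_abs_sum_osc_le hg hθ
  obtain ⟨C2, hC2, h2⟩ := h.exists_sum_div_le hg hθ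
  refine ⟨4 * C1 + C2 + 3 * θ, by positivity, fun δ hδ u hu L M => ?_⟩
  set x := max 1 (1 / |u|) with hx
  have hupos : 0 < |u| := abs_pos.2 hu
  have hx1 : 1 ≤ x := le_max_left _ _
  -- The cut is at `log T = max(1, 1/|u|)`, so that `log log T` is exactly the logarithm in the
  -- claim.
  set T := Real.exp x with hT
  have hT2 : 2 ≤ T := by
    have := Real.add_one_le_exp x
    linarith
  have hnn : ∀ k : ℕ, 0 ≤ (if k.Prime then g k else 0) := fun k => by
    split_ifs; exacts [hg k, le_rfl]
  have hsmall : ∀ s : Finset ℕ, s ⊆ Finset.Ioc 0 ⌊T⌋₊ →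
      ∑ k ∈ s, osc δ u k * (if k.Prime then g k else 0) ≤ θ * Real.log x + C2 := by
    intro s hs
    have := h2 T hT2
    rw [sum_primesIoc 0 _ (fun k => osc 0 0 k), hT, Real.log_exp] at this
    refine le_trans ?_ this
    have hosc : ∀ k : ℕ, 1 ≤ k → osc 0 0 k = 1 / (k : ℝ) := fun k hk => by
      simp only [osc, add_zero, neg_mul, one_mul, zero_mul, Real.cos_zero, mul_one]
      rw [Real.exp_neg, Real.exp_log (by exact_mod_cast hk), one_div]
    calc _ ≤ ∑ k ∈ s, osc 0 0 k * (if k.Prime then g k else 0) := by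
          refine Finset.sum_le_sum fun k hk => mul_le_mul_of_nonneg_right ?_ (hnn k)
          have hk1 : 1 ≤ k := (Finset.mem_Ioc.1 (hs hk)).1
          rw [hosc k hk1]
          exact (le_abs_self _).trans (abs_osc_le u hδ.1 (by exact_mod_cast hk1))
      _ ≤ _ := by
          refine Finset.sum_le_sum_of_subset_of_nonneg hs fun k _ _ => mul_nonneg ?_ (hnn k)
          simp [osc, Real.exp_nonneg]
  have hlogx : 0 ≤ θ * Real.log x := mul_nonneg hθ (Real.log_nonneg hx1)
  have hCu : C1 * |u| ≤ (4 * C1 + C2 + 3 * θ) * |u| := by gcongr; linarith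
  rcases le_or_gt M ⌊T⌋₊ with hM | hM
  · rw [sum_primesIoc L M (fun k => osc δ u k)]
    have := hsmall (Finset.Ioc L M) (Finset.Ioc_subset_Ioc (Nat.zero_le _) hM)
    nlinarith
  · rcases le_or_gt M L with hLM | hLM
    · have : primesIoc L M = ∅ := by simp [primesIoc, Finset.Ioc_eq_empty_of_le hLM]
      rw [this, Finset.sum_empty]; positivity
    set a := max T (L : ℝ) with ha
    have hTM : T < M := (Nat.floor_lt (by positivity)).1 hM
    have haM : a ≤ M := max_le hTM.le (by exact_mod_cast hLM.le)
    have hfa : L ≤ ⌊a⌋₊ := Nat.le_floor (le_max_right _ _)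
    have hfaM : ⌊a⌋₊ ≤ M := Nat.floor_le_of_le haM
    have hA := h1 δ hδ u a M hu (hT2.trans (le_max_left _ _)) haM
    rw [Nat.floor_natCast] at hA
    have hB : ∑ k ∈ Finset.Ioc L ⌊a⌋₊, osc δ u k * (if k.Prime then g k else 0) ≤
        θ * Real.log x + C2 := by
      apply hsmall
      rcases le_total T L with hTL | hTL
      · rw [ha, max_eq_right hTL, Nat.floor_natCast]; simp
      · rw [ha, max_eq_left hTL]; exact Finset.Ioc_subset_Ioc (Nat.zero_le _) le_rfl
    have hxla : x ≤ Real.log a := by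
      rw [Real.le_log_iff_exp_le (by positivity)]; exact le_max_left _ _
    -- Both `1` and `1/|u|` are at most `x ≤ log a`.
    have hfrac : (1 + 2 / |u|) / Real.log a ≤ 3 := by
      rw [div_le_iff₀ (by linarith)]
      have : 1 / |u| ≤ x := le_max_right _ _
      have e : 2 / |u| = 2 * (1 / |u|) := by ring
      rw [e]; linarith
    have := mul_le_mul_of_nonneg_left hfrac hθ
    rw [sum_primesIoc L M (fun k => osc δ u k), ← Finset.sum_Ioc_consecutive _ hfa hfaM]
    rw [sum_primesIoc _ M (fun k => osc δ u k)] at hA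
    have := (le_abs_self _).trans hA
    nlinarith

/-- Boundedness of `E(t)/t` makes the partial sums of `g` over primes `O(n)`, so the Dirichlet
series with these nonnegative coefficients converges at `1 + δ`. -/
lemma summable_exp_mul (h : IsClassP θ g) (hg : ∀ n, 0 ≤ g n) (hθ : 0 ≤ θ) {δ : ℝ} (hδ : 0 < δ) :
    Summable fun n : ℕ => Real.exp (-(1 + δ) * Real.log n) * (if n.Prime then g n else 0) := by
  obtain ⟨C, hC, hC'⟩ := h.exists_abs_primeErr_le hg hθ
  set c : ℕ → ℝ := fun n => if n.Prime then g n else 0 with hc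
  have hnn : ∀ n, 0 ≤ c n := fun n => by
    simp only [hc]; split_ifs; exacts [hg n, le_rfl]
  have hO : (fun n => ∑ k ∈ Finset.Icc 1 n, c k) =O[atTop] fun n : ℕ => (n : ℝ) ^ (1 : ℝ) := by
    refine IsBigO.of_bound (C + θ / Real.log 2) ?_
    filter_upwards [eventually_ge_atTop 2] with n hn
    have hn' : (2 : ℝ) ≤ n := by exact_mod_cast hn
    have hl2 : 0 < Real.log 2 := Real.log_pos (by norm_num)
    have hl : Real.log 2 ≤ Real.log n := Real.log_le_log (by norm_num) hn'
    have e : ∑ k ∈ Finset.Icc 1 n, c k = primeErr θ g n + θ * (n / Real.log n) := by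
      simp only [primeErr, Nat.floor_natCast, hc]
      rw [Nat.primesLE_eq_filter_Icc_one, Finset.sum_filter]; ring
    rw [Real.rpow_one, Real.norm_eq_abs, Real.norm_eq_abs, abs_of_nonneg
      (Finset.sum_nonneg fun k _ => hnn k), abs_of_nonneg (by positivity : (0 : ℝ) ≤ n), e]
    have h1 := hC' n hn'
    rw [div_le_iff₀ (by positivity)] at h1
    have h2 : (n : ℝ) / Real.log n ≤ n / Real.log 2 := by gcongr
    have h3 := mul_le_mul_of_nonneg_left h2 hθ
    have h4 := le_abs_self (primeErr θ g n)
    calc _ ≤ C * n + θ * (n / Real.log 2) := by linarith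
      _ = _ := by ring
  have := LSeriesSummable_of_sum_norm_bigO_and_nonneg (s := ((1 + δ : ℝ) : ℂ)) hO hnn zero_le_one
    (by simpa using hδ)
  refine this.norm.congr fun n => ?_
  rcases Nat.eq_zero_or_pos n with rfl | hn
  · simp [hc, Nat.not_prime_zero]
  rw [LSeries.norm_term_eq, if_neg hn.ne', Complex.ofReal_re, Complex.norm_real, Real.norm_eq_abs,
    abs_of_nonneg (hnn n), Real.rpow_def_of_pos (by exact_mod_cast hn), neg_mul, Real.exp_neg,
    mul_comm (1 + δ), div_eq_mul_inv, mul_comm]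

end IsClassP

end RandMult

/-! ### The covariance kernel: domination near the diagonals, convergence off them -/

namespace RandMult

/-- The amplitude `f(p) p^{-(1+δ)/2}` of the prime `p` on the line `Re z = (1+δ)/2`. -/
def amp (f : ℕ → ℝ) (δ : ℝ) (p : ℕ) : ℝ := f p * Real.exp (-((1 + δ) / 2) * Real.log p)

/-- The coefficient of the normalised Euler factor at `p`. -/
def coef (f : ℕ → ℝ) (δ : ℝ) (p : ℕ) : ℝ := 2 * amp f δ p / (1 + amp f δ p ^ 2)

/-- The covariance kernel of the normalised Euler products over `S`. -/
def kern (c : ℕ → ℝ) (S : Finset ℕ) (s s' : ℝ) : ℝ :=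
  ∏ p ∈ S, (1 + c p ^ 2 * (Real.cos (s * Real.log p) * Real.cos (s' * Real.log p)))

lemma amp_sq (f : ℕ → ℝ) (δ : ℝ) (p : ℕ) :
    amp f δ p ^ 2 = f p ^ 2 * Real.exp (-(1 + δ) * Real.log p) := by
  rw [amp, mul_pow, ← Real.exp_nat_mul]; congr 2; push_cast; ring

lemma abs_coef_le_one (f : ℕ → ℝ) (δ : ℝ) (p : ℕ) : |coef f δ p| ≤ 1 := by
  rw [coef, abs_div, abs_of_pos (by positivity : 0 < 1 + amp f δ p ^ 2),
    div_le_one (by positivity), abs_le]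
  constructor <;> nlinarith [sq_nonneg (amp f δ p + 1), sq_nonneg (amp f δ p - 1)]

lemma coef_sq_le_one (f : ℕ → ℝ) (δ : ℝ) (p : ℕ) : coef f δ p ^ 2 ≤ 1 :=
  (sq_le_one_iff_abs_le_one _).2 (abs_coef_le_one f δ p)

lemma coef_sq_le (f : ℕ → ℝ) (δ : ℝ) (p : ℕ) : coef f δ p ^ 2 ≤ 4 * amp f δ p ^ 2 := by
  rw [coef, div_pow, div_le_iff₀ (by positivity)]
  have := sq_nonneg (amp f δ p)
  have h1 : 1 ≤ (1 + amp f δ p ^ 2) ^ 2 := by nlinarith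
  nlinarith

/-- For `|a| ≤ 1` the expansion `4a² / (1 + a²)² = 4a² + O(a⁴)` applies and `a⁴ ≤ |a|³`; for `|a| >
1` the claim is crude because `a² ≤ |a|³`. A cubic error is what the summability hypothesis on `f`
can absorb. -/
lemma abs_coef_sq_sub_le (f : ℕ → ℝ) (δ : ℝ) (p : ℕ) :
    |coef f δ p ^ 2 - 4 * amp f δ p ^ 2| ≤ 8 * |amp f δ p| ^ 3 := by
  have h0 := coef_sq_le f δ p
  rw [abs_of_nonpos (by linarith)]
  set x := |amp f δ p| with hx
  have hx0 : 0 ≤ x := abs_nonneg _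
  have h2 : amp f δ p ^ 2 = x ^ 2 := (sq_abs _).symm
  rcases le_or_gt x 1 with h1 | h1
  · have e : coef f δ p ^ 2 = 4 * x ^ 2 / (1 + x ^ 2) ^ 2 := by
      rw [coef, div_pow, mul_pow, h2]; norm_num
    have : 4 * x ^ 2 - 8 * x ^ 4 ≤ coef f δ p ^ 2 := by
      rw [e, le_div_iff₀ (by positivity)]
      have : 0 ≤ x ^ 6 * (12 + 8 * x ^ 2) := by positivity
      nlinarith
    have : x ^ 4 ≤ x ^ 3 := pow_le_pow_of_le_one hx0 h1 (by norm_num)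
    rw [h2]; linarith
  · have : x ^ 2 ≤ x ^ 3 := pow_le_pow_right₀ h1.le (by norm_num)
    rw [h2]
    nlinarith [sq_nonneg (coef f δ p)]

lemma abs_amp_le (f : ℕ → ℝ) {δ : ℝ} (hδ : 0 ≤ δ) (p : ℕ) : |amp f δ p| ≤ |amp f 0 p| := by
  rw [amp, amp, abs_mul, abs_mul, abs_of_pos (Real.exp_pos _), abs_of_pos (Real.exp_pos _)]
  gcongr

/-- The hypotheses on `f` used in the kernel estimates. -/
structure IsAdmissible (θ : ℝ) (f : ℕ → ℝ) : Prop where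
  pos : 0 ≤ θ
  lt_half : θ < 1 / 2
  classP : IsClassP θ fun n => f n ^ 2
  summable : Summable fun n : ℕ => if n.Prime then |amp f 0 n| ^ 3 else 0

lemma isAdmissible_of {θ : ℝ} (hθ : θ ∈ Set.Ioo (0 : ℝ) (1 / 2)) {f : ℕ → ℝ}
    (hP : (fun n : ℕ => ((f n ^ 2 : ℝ) : ℂ)) ∈ ClassP (θ : ℂ))
    (hsum : Summable fun p : Nat.Primes => |f p| ^ 3 / (p : ℝ) ^ (3 / 2 : ℝ)) :
    IsAdmissible θ f := by
  refine ⟨hθ.1.le, hθ.2, isClassP_of_mem hP, ?_⟩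
  have h1 : Summable fun p : {n : ℕ // n.Prime} => |amp f 0 p| ^ 3 := by
    refine hsum.congr fun p => ?_
    have hp : (0 : ℝ) < (p : ℕ) := by exact_mod_cast p.2.pos
    rw [amp, abs_mul, mul_pow, abs_of_pos (Real.exp_pos _), ← Real.exp_nat_mul,
      Real.rpow_def_of_pos hp, div_eq_mul_inv, ← Real.exp_neg]
    congr 2; push_cast; ring
  have h2 := (summable_subtype_iff_indicator (f := fun n : ℕ => |amp f 0 n| ^ 3)
    (s := {n : ℕ | n.Prime})).1 h1
  exact h2.congr fun n => by simp [Set.indicator_apply]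

/-- Covariance exponent at the prime `p`. -/
def covTerm (c : ℕ → ℝ) (s s' : ℝ) (p : ℕ) : ℝ :=
  c p ^ 2 * (Real.cos (s * Real.log p) * Real.cos (s' * Real.log p))

lemma abs_covTerm_le (c : ℕ → ℝ) (s s' : ℝ) (p : ℕ) : |covTerm c s s' p| ≤ c p ^ 2 := by
  rw [covTerm, abs_mul, abs_of_nonneg (sq_nonneg _), abs_mul]
  refine mul_le_of_le_one_right (sq_nonneg _) ?_
  exact mul_le_one₀ (Real.abs_cos_le_one _) (abs_nonneg _) (Real.abs_cos_le_one _)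

lemma kern_eq (c : ℕ → ℝ) (S : Finset ℕ) (s s' : ℝ) :
    kern c S s s' = ∏ p ∈ S, (1 + covTerm c s s' p) := rfl

lemma kern_nonneg {c : ℕ → ℝ} (hc : ∀ p, c p ^ 2 ≤ 1) (S : Finset ℕ) (s s' : ℝ) :
    0 ≤ kern c S s s' := by
  rw [kern_eq]
  refine Finset.prod_nonneg fun p _ => ?_
  have := (abs_le.1 ((abs_covTerm_le c s s' p).trans (hc p))).1
  linarith

lemma kern_le_exp {c : ℕ → ℝ} (hc : ∀ p, c p ^ 2 ≤ 1) (S : Finset ℕ) (s s' : ℝ) :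
    kern c S s s' ≤ Real.exp (∑ p ∈ S, covTerm c s s' p) := by
  rw [kern_eq, Real.exp_sum]
  refine Finset.prod_le_prod (fun p _ => ?_) fun p _ => ?_
  · have := (abs_le.1 ((abs_covTerm_le c s s' p).trans (hc p))).1
    linarith
  · rw [add_comm]; exact Real.add_one_le_exp _

/-- From `log (1 + d) ≥ d / (1 + d)`, which is at least `d - 2d²` as long as `|d| ≤ 1/2`. -/
lemma exp_le_kern {c : ℕ → ℝ} (S : Finset ℕ) (hc : ∀ p ∈ S, c p ^ 2 ≤ 1 / 2) (s s' : ℝ) :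
    Real.exp (∑ p ∈ S, (covTerm c s s' p - 2 * covTerm c s s' p ^ 2)) ≤ kern c S s s' := by
  rw [kern_eq, Real.exp_sum]
  refine Finset.prod_le_prod (fun p _ => (Real.exp_pos _).le) fun p hp => ?_
  have h := abs_le.1 ((abs_covTerm_le c s s' p).trans (hc p hp))
  set d := covTerm c s s' p
  have hd : 0 < 1 + d := by linarith [h.1]
  rw [← Real.le_log_iff_exp_le hd]
  refine le_trans ?_ (Real.one_sub_inv_le_log_of_pos hd)
  have : 1 - (1 + d)⁻¹ - (d - 2 * d ^ 2) = d ^ 2 * (1 + 2 * d) / (1 + d) := by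
    field_simp; ring
  have h2 : 0 ≤ d ^ 2 * (1 + 2 * d) / (1 + d) :=
    div_nonneg (mul_nonneg (sq_nonneg _) (by linarith [h.1])) hd.le
  linarith

/-- The product-to-sum formula turns the two cosines into frequencies `s - s'` and `s + s'`. The
error is stated at `δ = 0`, where amplitudes are largest, so that it is uniform in `δ`. -/
lemma abs_covTerm_sub_le (f : ℕ → ℝ) {δ : ℝ} (hδ : 0 ≤ δ) (s s' : ℝ) (p : ℕ) :
    |covTerm (coef f δ) s s' p -
      2 * (osc δ (s - s') p * f p ^ 2 + osc δ (s + s') p * f p ^ 2)| ≤ 8 * |amp f 0 p| ^ 3 := by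
  have e : 2 * (osc δ (s - s') p * f p ^ 2 + osc δ (s + s') p * f p ^ 2) =
      4 * amp f δ p ^ 2 * (Real.cos (s * Real.log p) * Real.cos (s' * Real.log p)) := by
    rw [amp_sq, osc, osc, sub_mul, add_mul, Real.cos_sub, Real.cos_add]; ring
  rw [e, covTerm, ← sub_mul, abs_mul]
  calc _ ≤ 8 * |amp f δ p| ^ 3 * 1 := by
        gcongr
        · exact abs_coef_sq_sub_le f δ p
        · rw [abs_mul]
          exact mul_le_one₀ (Real.abs_cos_le_one _) (abs_nonneg _) (Real.abs_cos_le_one _)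
    _ ≤ _ := by
        rw [mul_one]
        exact mul_le_mul_of_nonneg_left
          (pow_le_pow_left₀ (abs_nonneg _) (abs_amp_le f hδ p) 3) (by norm_num)

lemma abs_sum_covTerm_sub_le (f : ℕ → ℝ) {δ : ℝ} (hδ : 0 ≤ δ) (s s' : ℝ) (S : Finset ℕ) :
    |∑ p ∈ S, covTerm (coef f δ) s s' p -
      2 * (∑ p ∈ S, osc δ (s - s') p * f p ^ 2 + ∑ p ∈ S, osc δ (s + s') p * f p ^ 2)| ≤
      8 * ∑ p ∈ S, |amp f 0 p| ^ 3 := by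
  rw [← Finset.sum_add_distrib, Finset.mul_sum, Finset.mul_sum, ← Finset.sum_sub_distrib]
  exact (Finset.abs_sum_le_sum_abs _ _).trans
    (Finset.sum_le_sum fun p _ => abs_covTerm_sub_le f hδ s s' p)

/-- The singularity `max(1, 1/|u|)^{2θ}` of the limiting kernel. -/
def sing (θ u : ℝ) : ℝ := max 1 (1 / |u|) ^ (2 * θ)

lemma sing_nonneg (θ u : ℝ) : 0 ≤ sing θ u := Real.rpow_nonneg (by positivity) _

lemma measurable_sing (θ : ℝ) : Measurable (sing θ) := by
  unfold sing
  fun_prop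

namespace IsAdmissible

variable {θ : ℝ} {f : ℕ → ℝ}

lemma sum_amp_le (h : IsAdmissible θ f) (L M : ℕ) :
    ∑ p ∈ primesIoc L M, |amp f 0 p| ^ 3 ≤ ∑' n : ℕ, if n.Prime then |amp f 0 n| ^ 3 else 0 := by
  rw [primesIoc, Finset.sum_filter]
  refine h.summable.sum_le_tsum _ fun n _ => ?_
  positivity

lemma eventually_sum_amp_le (h : IsAdmissible θ f) {ε : ℝ} (hε : 0 < ε) :
    ∀ᶠ N in atTop, ∀ M, ∑ p ∈ primesIoc N M, |amp f 0 p| ^ 3 ≤ ε := by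
  obtain ⟨s, hs⟩ := summable_iff_vanishing_norm.1 h.summable ε hε
  filter_upwards [eventually_ge_atTop (s.sup id)] with N hN M
  have := hs (Finset.Ioc N M) ?_
  · rw [primesIoc, Finset.sum_filter]
    exact (Real.le_norm_self _).trans this.le
  · rw [Finset.disjoint_left]
    intro a ha has
    have h1 := (Finset.mem_Ioc.1 ha).1
    have h2 : a ≤ s.sup id := Finset.le_sup (f := id) has
    omega

/-- The exponent is twice the two cosine sums plus a bounded cubic error, and each sum contributes
`θ log max(1, 1/|u|)`, hence the power `2θ`. The diagonals must be excluded: since `1 / 0 = 0`,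
`sing θ 0` takes the value `1` rather than infinity. The range `(L, M]` and `δ` are arbitrary so
that the same majorant serves every truncation and every line. -/
lemma exists_kern_le (h : IsAdmissible θ f) (R : ℝ) :
    ∃ K, 0 ≤ K ∧ ∀ δ ∈ Set.Icc (0 : ℝ) 1, ∀ L M : ℕ, ∀ s ∈ Set.Icc (-R) R, ∀ s' ∈ Set.Icc (-R) R,
      s - s' ≠ 0 → s + s' ≠ 0 →
      kern (coef f δ) (primesIoc L M) s s' ≤ K * (sing θ (s - s') * sing θ (s + s')) := by
  obtain ⟨C, hC, hC'⟩ := h.classP.exists_sum_osc_le (fun n => sq_nonneg (f n)) h.pos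
  set A := ∑' n : ℕ, if n.Prime then |amp f 0 n| ^ 3 else 0
  refine ⟨Real.exp (4 * (C * (1 + 2 * R)) + 8 * A), (Real.exp_pos _).le,
    fun δ hδ L M s hs s' hs' hu hv => ?_⟩
  refine (kern_le_exp (coef_sq_le_one f δ) _ s s').trans ?_
  have hexp : ∀ u : ℝ, sing θ u = Real.exp (2 * (θ * Real.log (max 1 (1 / |u|)))) := by
    intro u
    rw [sing, Real.rpow_def_of_pos (by positivity)]; ring_nf
  rw [hexp, hexp, ← Real.exp_add, ← Real.exp_add]
  apply Real.exp_le_exp.2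
  have h1 := (abs_le.1 (abs_sum_covTerm_sub_le f hδ.1 s s' (primesIoc L M))).2
  have h2 := h.sum_amp_le L M
  have h3 := hC' δ hδ _ hu L M
  have h4 := hC' δ hδ _ hv L M
  have hu' : |s - s'| ≤ 2 * R := by
    rw [abs_le]; constructor <;> linarith [hs.1, hs.2, hs'.1, hs'.2]
  have hv' : |s + s'| ≤ 2 * R := by
    rw [abs_le]; constructor <;> linarith [hs.1, hs.2, hs'.1, hs'.2]
  have h5 : C * (1 + |s - s'|) ≤ C * (1 + 2 * R) := by gcongr
  have h6 : C * (1 + |s + s'|) ≤ C * (1 + 2 * R) := by gcongr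
  linarith

lemma eventually_abs_sum_osc_le (h : IsAdmissible θ f) {u : ℝ} (hu : u ≠ 0) {ε : ℝ}
    (hε : 0 < ε) :
    ∀ᶠ N : ℕ in atTop, ∀ M, N ≤ M → ∀ δ ∈ Set.Icc (0 : ℝ) 1,
      |∑ p ∈ primesIoc N M, osc δ u p * f p ^ 2| ≤ ε := by
  have hpos : 0 < 4 + |u| := by positivity
  obtain ⟨A, hA2, hA⟩ := h.classP.exists_abs_sum_osc_tail_le h.pos
    (div_pos (half_pos hε) hpos)
  have hlim : Tendsto (fun N : ℕ => θ * ((1 + 2 / |u|) / Real.log (N : ℝ))) atTop (𝓝 (θ * 0)) :=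
    (tendsto_const_nhds.div_atTop
      (Real.tendsto_log_atTop.comp tendsto_natCast_atTop_atTop)).const_mul θ
  rw [mul_zero] at hlim
  filter_upwards [hlim.eventually (ge_mem_nhds (half_pos hε)), eventually_ge_atTop ⌈A⌉₊]
    with N hN hNA M hM δ hδ
  have := hA δ hδ u N M hu ((Nat.le_ceil A).trans (by exact_mod_cast hNA)) (by exact_mod_cast hM)
  rw [Nat.floor_natCast, Nat.floor_natCast, div_mul_cancel₀ _ hpos.ne'] at this
  linarith

/-- Off the diagonals the two cosine sums over `(N, M]` and the cubic tail are all small, and `exp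
(D - 2Q) ≤ kern ≤ exp D` with `D` the sum of the exponents and `Q` the sum of their squares. -/
lemma eventually_abs_kern_sub_one_le (h : IsAdmissible θ f) {s s' : ℝ} (hu : s - s' ≠ 0)
    (hv : s + s' ≠ 0) {ε : ℝ} (hε : 0 < ε) :
    ∀ᶠ N : ℕ in atTop, ∀ M, N ≤ M → ∀ δ ∈ Set.Icc (0 : ℝ) 1,
      |kern (coef f δ) (primesIoc N M) s s' - 1| ≤ ε := by
  -- `1/64 = (1/4)³` forces every amplitude below `1/4`. Then `Q ≤ 16η`, `|D| ≤ 12η` and `|D - 2Q| ≤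
  -- 44η < 1`, so `|exp x - 1| ≤ 2|x|` yields at most `88η ≤ ε`.
  set η := min (1 / 64) (ε / 256) with hη
  have hη0 : 0 < η := by positivity
  have hη1 : η ≤ 1 / 64 := min_le_left _ _
  have hη2 : η ≤ ε / 256 := min_le_right _ _
  filter_upwards [h.eventually_sum_amp_le hη0, h.eventually_abs_sum_osc_le hu hη0,
    h.eventually_abs_sum_osc_le hv hη0] with N h1 h2 h3 M hM δ hδ
  set c := coef f δ
  set S := primesIoc N M
  have ha : ∀ p ∈ S, |amp f δ p| ^ 3 ≤ |amp f 0 p| ^ 3 := fun p _ =>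
    pow_le_pow_left₀ (abs_nonneg _) (abs_amp_le f hδ.1 p) 3
  have hsmall : ∀ p ∈ S, |amp f δ p| ≤ 1 / 4 := by
    intro p hp
    have h4 : |amp f 0 p| ^ 3 ≤ η :=
      (Finset.single_le_sum (f := fun p => |amp f 0 p| ^ 3) (fun q _ => by positivity) hp).trans
        (h1 M)
    by_contra! hlt
    have : (1 / 4 : ℝ) ^ 3 < |amp f δ p| ^ 3 := by gcongr
    have := ha p hp
    norm_num at *
    linarith
  have hc4 : ∀ p ∈ S, c p ^ 2 ≤ 1 / 4 := fun p hp => by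
    refine (coef_sq_le f δ p).trans ?_
    have := hsmall p hp
    rw [← sq_abs]
    nlinarith [abs_nonneg (amp f δ p)]
  have hd2 : ∑ p ∈ S, covTerm c s s' p ^ 2 ≤ 16 * η := by
    calc ∑ p ∈ S, covTerm c s s' p ^ 2 ≤ ∑ p ∈ S, 16 * |amp f 0 p| ^ 3 := by
          refine Finset.sum_le_sum fun p hp => ?_
          have e1 : |covTerm c s s' p| ≤ 4 * |amp f δ p| ^ 2 := by
            rw [sq_abs]
            exact (abs_covTerm_le c s s' p).trans (coef_sq_le f δ p)
          have e2 : covTerm c s s' p ^ 2 ≤ (4 * |amp f δ p| ^ 2) ^ 2 := by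
            rw [← sq_abs]; gcongr
          have e3 : |amp f δ p| ^ 4 ≤ |amp f δ p| ^ 3 :=
            pow_le_pow_of_le_one (abs_nonneg _) ((hsmall p hp).trans (by norm_num)) (by norm_num)
          have := ha p hp
          nlinarith
      _ ≤ 16 * η := by rw [← Finset.mul_sum]; linarith [h1 M]
  have hd := abs_le.1 (abs_sum_covTerm_sub_le f hδ.1 s s' S)
  have h2' := abs_le.1 (h2 M hM δ hδ)
  have h3' := abs_le.1 (h3 M hM δ hδ)
  have h1' := h1 M
  have hup := kern_le_exp (coef_sq_le_one f δ) S s s'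
  have hlow := exp_le_kern S (fun p hp => (hc4 p hp).trans (by norm_num)) s s'
  rw [Finset.sum_sub_distrib, ← Finset.mul_sum] at hlow
  set D := ∑ p ∈ S, covTerm c s s' p
  have b1 : |D| ≤ 1 := by rw [abs_le]; constructor <;> linarith [hd.1, hd.2, h2'.1, h2'.2, h3'.1, h3'.2]
  have hq0 : 0 ≤ ∑ p ∈ S, covTerm c s s' p ^ 2 := Finset.sum_nonneg fun p _ => sq_nonneg _
  set Q := ∑ p ∈ S, covTerm c s s' p ^ 2
  have b2 : |D - 2 * Q| ≤ 1 := by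
    rw [abs_le]; constructor <;> linarith [hd.1, hd.2, h2'.1, h2'.2, h3'.1, h3'.2]
  have b3 := abs_le.1 (Real.abs_exp_sub_one_le b1)
  have b4 := abs_le.1 (Real.abs_exp_sub_one_le b2)
  have b5 : |D| ≤ 12 * η := by
    rw [abs_le]; constructor <;> linarith [hd.1, hd.2, h2'.1, h2'.2, h3'.1, h3'.2]
  have b6 : |D - 2 * Q| ≤ 44 * η := by
    rw [abs_le]; constructor <;> linarith [hd.1, hd.2, h2'.1, h2'.2, h3'.1, h3'.2]
  rw [abs_le]
  constructor <;> linarith [b3.1, b3.2, b4.1, b4.2]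

end IsAdmissible

lemma kern_primesIoc_mul (c : ℕ → ℝ) {L N M : ℕ} (h1 : L ≤ N) (h2 : N ≤ M) (s s' : ℝ) :
    kern c (primesIoc L M) s s' = kern c (primesIoc L N) s s' * kern c (primesIoc N M) s s' := by
  simp only [kern, primesIoc, Finset.prod_filter]
  exact (Finset.prod_Ioc_consecutive _ h1 h2).symm

/-- Substituting `u = s - s'` turns `s + s'` into `2s - u`, after which the two integrals separate;
the scaling by 2 contributes a Jacobian `1/2 ≤ 1`. -/
lemma lintegral_sub_mul_add {W : ℝ → ℝ≥0∞} (hW : Measurable W) :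
    ∫⁻ s, ∫⁻ s', W (s - s') * W (s + s') ≤ (∫⁻ u, W u) * ∫⁻ u, W u := by
  have e1 : ∀ s : ℝ, ∫⁻ s', W (s - s') * W (s + s') = ∫⁻ u, W u * W (2 * s - u) := by
    intro s
    rw [← lintegral_sub_left_eq_self (fun u => W u * W (2 * s - u)) s]
    refine lintegral_congr fun x => ?_
    congr 2; ring
  simp_rw [e1]
  rw [lintegral_lintegral_swap (by fun_prop)]
  have e2 : ∀ u : ℝ, ∫⁻ s, W (2 * s - u) ≤ ∫⁻ v, W v := by
    intro u
    have : ∫⁻ s, W (2 * s - u) = ∫⁻ x, W (x - u) ∂(Measure.map (fun s => 2 * s) volume) :=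
      (lintegral_map (f := fun x => W (x - u)) (g := fun s : ℝ => 2 * s)
        (by fun_prop) (by fun_prop)).symm
    rw [this, Real.map_volume_mul_left two_ne_zero, lintegral_smul_measure,
      lintegral_sub_right_eq_self W u]
    refine mul_le_of_le_one_left zero_le ?_
    rw [ENNReal.ofReal_le_one]
    norm_num
  calc ∫⁻ u, ∫⁻ s, W u * W (2 * s - u) = ∫⁻ u, W u * ∫⁻ s, W (2 * s - u) := by
        refine lintegral_congr fun u => lintegral_const_mul _ (by fun_prop)
    _ ≤ ∫⁻ u, W u * ∫⁻ v, W v := lintegral_mono fun u => mul_le_mul_right (e2 u) (W u)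
    _ = _ := lintegral_mul_const _ hW

lemma integrableOn_sing {θ : ℝ} (hθ : θ < 1 / 2) (R : ℝ) :
    IntegrableOn (sing θ) (Set.Icc (-R) R) := by
  have hpos : ∀ T : ℝ, 0 ≤ T → IntervalIntegrable (sing θ) volume 0 T := by
    intro T hT
    have h1 : IntervalIntegrable (fun x : ℝ => 1 + x ^ (-(2 * θ))) volume 0 T :=
      intervalIntegrable_const.add (intervalIntegral.intervalIntegrable_rpow' (by linarith))
    refine h1.mono_fun (measurable_sing θ).aestronglyMeasurable ?_
    rw [Set.uIoc_of_le hT]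
    refine (ae_restrict_iff' measurableSet_Ioc).2 (ae_of_all _ fun x hx => ?_)
    have hx0 : 0 < x := hx.1
    beta_reduce
    rw [Real.norm_eq_abs, Real.norm_eq_abs, abs_of_nonneg (sing_nonneg _ _),
      abs_of_nonneg (by positivity), sing, abs_of_pos hx0]
    rcases le_total 1 (1 / x) with h | h
    · rw [max_eq_right h, one_div, Real.inv_rpow hx0.le, Real.rpow_neg hx0.le]
      linarith
    · rw [max_eq_left h, Real.one_rpow]
      linarith [Real.rpow_nonneg hx0.le (-(2 * θ))]
  rcases lt_or_ge R 0 with hR | hR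
  · rw [Set.Icc_eq_empty (by linarith)]; exact integrableOn_empty
  have h1 := hpos R hR
  have h2 : IntervalIntegrable (sing θ) volume (-R) 0 := by
    rw [IntervalIntegrable.iff_comp_neg]
    simp only [neg_neg, neg_zero]
    refine (h1.symm).congr (fun x _ => ?_)
    simp [sing]
  exact (intervalIntegrable_iff_integrableOn_Icc_of_le (by linarith)).1 (h2.trans h1)

/-- On the box both `s - s'` and `s + s'` stay in `[-2R, 2R]`, so truncating `sing` there reduces
the double integral to the square of a single one, finite for `2θ < 1`. -/
lemma integrable_sing_mul_sing {θ : ℝ} (hθ : θ < 1 / 2) (R : ℝ) :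
    Integrable (fun z : ℝ × ℝ => sing θ (z.1 - z.2) * sing θ (z.1 + z.2))
      ((volume.restrict (Set.Icc (-R) R)).prod (volume.restrict (Set.Icc (-R) R))) := by
  have hm := measurable_sing θ
  refine ⟨by fun_prop, ?_⟩
  rw [hasFiniteIntegral_iff_ofReal (ae_of_all _ fun z =>
    mul_nonneg (sing_nonneg _ _) (sing_nonneg _ _)), lintegral_prod _ (by fun_prop)]
  set W : ℝ → ℝ≥0∞ := (Set.Icc (-(2 * R)) (2 * R)).indicator fun u => ENNReal.ofReal (sing θ u)
    with hW
  have hWm : Measurable W := (by fun_prop : Measurable fun u => ENNReal.ofReal (sing θ u)).indicator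
    measurableSet_Icc
  have hfin : ∫⁻ u, W u < ∞ := by
    rw [hW, lintegral_indicator measurableSet_Icc]
    exact (integrableOn_sing hθ (2 * R)).lintegral_lt_top
  refine lt_of_le_of_lt ?_ (lt_of_le_of_lt (lintegral_sub_mul_add hWm) (ENNReal.mul_lt_top hfin hfin))
  rw [← lintegral_indicator measurableSet_Icc]
  refine lintegral_mono fun s => ?_
  by_cases hs : s ∈ Set.Icc (-R) R
  · rw [Set.indicator_of_mem hs, ← lintegral_indicator measurableSet_Icc]
    refine lintegral_mono fun s' => ?_
    by_cases hs' : s' ∈ Set.Icc (-R) R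
    · have h1 : s - s' ∈ Set.Icc (-(2 * R)) (2 * R) := by
        constructor <;> linarith [hs.1, hs.2, hs'.1, hs'.2]
      have h2 : s + s' ∈ Set.Icc (-(2 * R)) (2 * R) := by
        constructor <;> linarith [hs.1, hs.2, hs'.1, hs'.2]
      simp only [hW, Set.indicator_of_mem hs', Set.indicator_of_mem h1, Set.indicator_of_mem h2]
      rw [ENNReal.ofReal_mul (sing_nonneg _ _)]
    · simp [Set.indicator_of_notMem hs']
  · simp [Set.indicator_of_notMem hs]

lemma measurable_kern (c : ℕ → ℝ) (S : Finset ℕ) :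
    Measurable fun z : ℝ × ℝ => kern c S z.1 z.2 := by
  unfold kern
  fun_prop

lemma ae_sub_ne_zero_and_add_ne_zero (R : ℝ) :
    ∀ᵐ z : ℝ × ℝ ∂((volume.restrict (Set.Icc (-R) R)).prod (volume.restrict (Set.Icc (-R) R))),
      z.1 ∈ Set.Icc (-R) R ∧ z.2 ∈ Set.Icc (-R) R ∧ z.1 - z.2 ≠ 0 ∧ z.1 + z.2 ≠ 0 := by
  have hm : MeasurableSet {z : ℝ × ℝ | z.1 ∈ Set.Icc (-R) R ∧ z.2 ∈ Set.Icc (-R) R ∧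
      z.1 - z.2 ≠ 0 ∧ z.1 + z.2 ≠ 0} := by
    refine (measurable_fst measurableSet_Icc).inter ((measurable_snd measurableSet_Icc).inter
      (MeasurableSet.inter ?_ ?_))
    · exact (measurable_fst.sub measurable_snd) (measurableSet_singleton 0).compl
    · exact (measurable_fst.add measurable_snd) (measurableSet_singleton 0).compl
  rw [Measure.ae_prod_iff_ae_ae hm]
  filter_upwards [ae_restrict_mem measurableSet_Icc] with x hx
  have h1 : ∀ᵐ y : ℝ ∂volume.restrict (Set.Icc (-R) R), y ≠ x :=
    ae_restrict_of_ae (Measure.ae_ne volume x)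
  have h2 : ∀ᵐ y : ℝ ∂volume.restrict (Set.Icc (-R) R), y ≠ -x :=
    ae_restrict_of_ae (Measure.ae_ne volume (-x))
  filter_upwards [ae_restrict_mem measurableSet_Icc, h1, h2] with y hy hy1 hy2
  refine ⟨hx, hy, fun h => hy1 (by linarith), fun h => hy2 (by linarith)⟩

/-- The kernel over `(L, M]` factors as the kernel over `(L, N]` times the one over `(N, M]`. The
first factor is dominated by the integrable singularity and the second tends to 1 off the diagonals.
-/
theorem IsAdmissible.exists_integral_abs_kern_sub_le {θ : ℝ} {f : ℕ → ℝ} (h : IsAdmissible θ f)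
    (R : ℝ) {ε : ℝ} (hε : 0 < ε) :
    ∃ N0 : ℕ, ∀ δ ∈ Set.Icc (0 : ℝ) 1, ∀ L N M : ℕ, L ≤ N → N0 ≤ N → N ≤ M →
      ∫ z : ℝ × ℝ, |kern (coef f δ) (primesIoc L M) z.1 z.2 -
        kern (coef f δ) (primesIoc L N) z.1 z.2|
        ∂((volume.restrict (Set.Icc (-R) R)).prod (volume.restrict (Set.Icc (-R) R))) ≤ ε := by
  by_contra! hcon
  -- Uniformity in `δ, L, N, M` comes from contradiction: a failure yields one sequence of
  -- parameters, to which dominated convergence applies.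
  choose δ hδ L N M hLN hN hNM hgt using hcon
  obtain ⟨K, hK, hK'⟩ := h.exists_kern_le R
  have hlim : Tendsto (fun n : ℕ => ∫ z : ℝ × ℝ,
      |kern (coef f (δ n)) (primesIoc (L n) (M n)) z.1 z.2 -
        kern (coef f (δ n)) (primesIoc (L n) (N n)) z.1 z.2|
        ∂((volume.restrict (Set.Icc (-R) R)).prod (volume.restrict (Set.Icc (-R) R)))) atTop
      (𝓝 (∫ z : ℝ × ℝ, (0 : ℝ)
        ∂((volume.restrict (Set.Icc (-R) R)).prod (volume.restrict (Set.Icc (-R) R))))) := by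
    refine tendsto_integral_of_dominated_convergence
      (fun z => 2 * (K * (sing θ (z.1 - z.2) * sing θ (z.1 + z.2)))) (fun n => ?_)
      (((integrable_sing_mul_sing h.lt_half R).const_mul K).const_mul 2) (fun n => ?_) ?_
    · exact ((measurable_kern _ _).sub (measurable_kern _ _)).abs.aestronglyMeasurable
    · filter_upwards [ae_sub_ne_zero_and_add_ne_zero R] with z ⟨h1, h2, h3, h4⟩
      rw [Real.norm_eq_abs, abs_abs]
      have e1 := hK' (δ n) (hδ n) (L n) (M n) _ h1 _ h2 h3 h4
      have e2 := hK' (δ n) (hδ n) (L n) (N n) _ h1 _ h2 h3 h4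
      have e3 := kern_nonneg (coef_sq_le_one f (δ n)) (primesIoc (L n) (M n)) z.1 z.2
      have e4 := kern_nonneg (coef_sq_le_one f (δ n)) (primesIoc (L n) (N n)) z.1 z.2
      rw [abs_le]; constructor <;> linarith
    · filter_upwards [ae_sub_ne_zero_and_add_ne_zero R] with z ⟨h1, h2, h3, h4⟩
      set B := K * (sing θ (z.1 - z.2) * sing θ (z.1 + z.2))
      have hB : 0 ≤ B := mul_nonneg hK (mul_nonneg (sing_nonneg _ _) (sing_nonneg _ _))
      rw [Metric.tendsto_atTop']
      intro η hη
      obtain ⟨n0, hn0⟩ := eventually_atTop.1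
        (h.eventually_abs_kern_sub_one_le h3 h4 (by positivity : 0 < η / (2 * (B + 1))))
      refine ⟨n0, fun n hn => ?_⟩
      have e1 := hn0 (N n) (hn.le.trans (hN n)) (M n) (hNM n) (δ n) (hδ n)
      have e2 := hK' (δ n) (hδ n) (L n) (N n) _ h1 _ h2 h3 h4
      have e4 := kern_nonneg (coef_sq_le_one f (δ n)) (primesIoc (L n) (N n)) z.1 z.2
      rw [Real.dist_eq, sub_zero, abs_abs, kern_primesIoc_mul _ (hLN n) (hNM n),
        ← mul_sub_one, abs_mul, abs_of_nonneg e4]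
      calc _ ≤ B * (η / (2 * (B + 1))) := by gcongr
        _ ≤ (B + 1) * (η / (2 * (B + 1))) := by gcongr; linarith
        _ = η / 2 := by field_simp
        _ < η := by linarith
  rw [integral_zero] at hlim
  obtain ⟨n, hn⟩ := (hlim.eventually (gt_mem_nhds hε)).exists
  exact absurd (hgt n) (not_lt.2 hn.le)

end RandMult

/-! ### Second moments of the normalised products -/

namespace RandMult

variable {Ω : Type*} [MeasurableSpace Ω]

/-- A family of random signs, independent and symmetric along the primes. -/
structure SignFamily (P : Measure Ω) (e : ℕ → Ω → ℝ) : Prop where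
  measurable : ∀ n, Measurable (e n)
  values : ∀ n ω, e n ω = 1 ∨ e n ω = -1
  mean_zero : ∀ p : ℕ, p.Prime → ∫ ω, e p ω ∂P = 0
  indep : iIndepFun (fun p : Nat.Primes => e p) P

/-- The sign version of a Rademacher function. -/
def signs (β : ℕ → Ω → ℝ) (n : ℕ) (ω : Ω) : ℝ :=
  if n.Prime then (if β n ω = 1 then 1 else -1) else 1

lemma IsRademacher.ae_eq_signs {P : Measure Ω} [IsProbabilityMeasure P] {β : ℕ → Ω → ℝ}
    (hβ : IsRademacher P β) : ∀ᵐ ω ∂P, ∀ p : ℕ, p.Prime → β p ω = signs β p ω := by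
  rw [ae_all_iff]
  intro p
  by_cases hp : p.Prime
  · have hm := hβ.measurable p hp
    have hm1 : MeasurableSet {ω | β p ω = 1} := hm (measurableSet_singleton 1)
    have hm2 : MeasurableSet {ω | β p ω = -1} := hm (measurableSet_singleton (-1))
    have hd : Disjoint {ω | β p ω = 1} {ω | β p ω = -1} := by
      rw [Set.disjoint_left]
      intro ω h1 h2
      simp only [Set.mem_ofPred_eq] at h1 h2
      linarith
    have h1 : P ({ω | β p ω = 1} ∪ {ω | β p ω = -1}) = 1 := by
      rw [measure_union hd hm2, hβ.prob_one p hp, hβ.prob_neg_one p hp]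
      exact ENNReal.add_halves 1
    have := (prob_compl_eq_zero_iff (hm1.union hm2)).2 h1
    filter_upwards [measure_eq_zero_iff_ae_notMem.1 this] with ω hω _
    simp only [Set.mem_compl_iff, not_not, Set.mem_union, Set.mem_ofPred_eq] at hω
    rcases hω with h | h
    · simp [signs, hp, h]
    · simp only [signs, hp, h, if_true]; norm_num
  · exact ae_of_all _ fun ω h => absurd h hp

lemma IsRademacher.signFamily {P : Measure Ω} [IsProbabilityMeasure P] {β : ℕ → Ω → ℝ}
    (hβ : IsRademacher P β) : SignFamily P (signs β) := by
  have hmeas : ∀ n, Measurable (signs β n) := by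
    intro n
    by_cases hn : n.Prime
    · have : signs β n = fun ω => if β n ω = 1 then 1 else -1 := by
        funext ω; simp [signs, hn]
      rw [this]
      exact Measurable.ite (hβ.measurable n hn (measurableSet_singleton 1)) measurable_const
        measurable_const
    · have : signs β n = fun _ => 1 := by funext ω; simp [signs, hn]
      rw [this]; exact measurable_const
  refine ⟨hmeas, ?_, ?_, ?_⟩
  · intro n ω
    simp only [signs]; split_ifs <;> simp
  · intro p hp
    have hm1 : MeasurableSet {ω | β p ω = 1} := hβ.measurable p hp (measurableSet_singleton 1)
    have e : ∀ ω, signs β p ω = 2 * {ω | β p ω = 1}.indicator (fun _ => (1 : ℝ)) ω - 1 := by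
      intro ω
      by_cases h : β p ω = 1
      · simp [signs, hp, h]; norm_num
      · simp [signs, hp, h]
    simp_rw [e]
    rw [integral_sub _ (integrable_const _), integral_const_mul, integral_indicator_const _ hm1]
    · simp [Measure.real, hβ.prob_one p hp]
    · exact ((integrable_const (1 : ℝ)).indicator hm1).const_mul 2
  · have hg : ∀ p : Nat.Primes, Measurable fun x : ℝ => if x = 1 then (1 : ℝ) else -1 :=
      fun _ => Measurable.ite (measurableSet_singleton 1) measurable_const measurable_const
    have := hβ.indep.comp _ hg
    convert! this using 2 with p
    funext ω
    simp [signs, p.2]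

namespace SignFamily

variable {P : Measure Ω} {e : ℕ → Ω → ℝ}

lemma abs_eq_one (he : SignFamily P e) (n : ℕ) (ω : Ω) : |e n ω| = 1 := by
  rcases he.values n ω with h | h <;> simp [h]

lemma integral_prod [IsProbabilityMeasure P] (he : SignFamily P e) (S : Finset ℕ) (hS : ∀ p ∈ S, p.Prime)
    (F : ℕ → ℝ → ℝ) :
    ∫ ω, ∏ p ∈ S, F p (e p ω) ∂P = ∏ p ∈ S, (F p 1 + F p (-1)) / 2 := by
  -- On `{1, -1}` every function agrees with an affine one. This makes measurability of `F`
  -- unnecessary and reduces each mean to `mean_zero`.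
  set G : ℕ → ℝ → ℝ := fun p x => (F p 1 + F p (-1)) / 2 + (F p 1 - F p (-1)) / 2 * x with hG
  have hFG : ∀ p ω, F p (e p ω) = G p (e p ω) := by
    intro p ω
    rcases he.values p ω with h | h <;> simp only [hG, h] <;> ring
  simp_rw [hFG]
  have hGm : ∀ p, Measurable (G p) := fun p => by simp only [hG]; fun_prop
  let ι : S → Nat.Primes := fun p => ⟨p, hS p p.2⟩
  have hι : Function.Injective ι := fun a b h => Subtype.ext (congrArg (fun q : Nat.Primes => (q : ℕ)) h)
  have h1 : iIndepFun (fun p : S => e (ι p)) P := he.indep.precomp hι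
  have h2 : iIndepFun (fun (p : S) ω => G p (e p ω)) P := h1.comp (fun p => G p) fun p => hGm p
  have h3 := h2.integral_fun_prod_eq_prod_integral
    fun p => ((hGm p).comp (he.measurable p)).aestronglyMeasurable
  have e1 : ∀ ω, ∏ p ∈ S, G p (e p ω) = ∏ p : S, G p (e p ω) := fun ω =>
    (Finset.prod_coe_sort S fun p => G p (e p ω)).symm
  simp_rw [e1]
  rw [h3, ← Finset.prod_coe_sort S]
  refine Finset.prod_congr rfl fun p _ => ?_
  have hi : Integrable (e p) P := Integrable.of_bound (he.measurable p).aestronglyMeasurable 1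
    (ae_of_all _ fun ω => by rw [Real.norm_eq_abs, he.abs_eq_one])
  simp only [hG]
  rw [integral_add (integrable_const _) (hi.const_mul _), integral_const_mul,
    he.mean_zero p (hS p p.2)]
  simp

end SignFamily

/-- The normalised squared modulus of the Euler product over `S`. -/
def dens (c : ℕ → ℝ) (e : ℕ → Ω → ℝ) (S : Finset ℕ) (s : ℝ) (ω : Ω) : ℝ :=
  ∏ p ∈ S, (1 + c p * Real.cos (s * Real.log p) * e p ω)

lemma abs_coef_mul_cos_le {c : ℕ → ℝ} (hc : ∀ p, |c p| ≤ 1) (p : ℕ) (x : ℝ) :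
    |c p * Real.cos x| ≤ 1 := by
  rw [abs_mul]; exact mul_le_one₀ (hc p) (abs_nonneg _) (Real.abs_cos_le_one _)

section dens

variable {P : Measure Ω} {e : ℕ → Ω → ℝ} {c : ℕ → ℝ}

lemma abs_dens_factor (he : SignFamily P e) (hc : ∀ p, |c p| ≤ 1) (p : ℕ) (s : ℝ) (ω : Ω) :
    |c p * Real.cos (s * Real.log p) * e p ω| ≤ 1 := by
  rw [abs_mul, he.abs_eq_one, mul_one]; exact abs_coef_mul_cos_le hc p _

lemma dens_nonneg (he : SignFamily P e) (hc : ∀ p, |c p| ≤ 1) (S : Finset ℕ) (s : ℝ) (ω : Ω) :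
    0 ≤ dens c e S s ω :=
  Finset.prod_nonneg fun p _ => by linarith [(abs_le.1 (abs_dens_factor he hc p s ω)).1]

lemma dens_le (he : SignFamily P e) (hc : ∀ p, |c p| ≤ 1) (S : Finset ℕ) (s : ℝ) (ω : Ω) :
    dens c e S s ω ≤ 2 ^ S.card := by
  rw [← Finset.prod_const]
  refine Finset.prod_le_prod ?_ ?_ <;> intro p _ <;>
    linarith [(abs_le.1 (abs_dens_factor he hc p s ω)).1,
      (abs_le.1 (abs_dens_factor he hc p s ω)).2]

lemma measurable_dens (he : SignFamily P e) (c : ℕ → ℝ) (S : Finset ℕ) :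
    Measurable fun z : ℝ × Ω => dens c e S z.1 z.2 := by
  unfold dens
  have := fun p => he.measurable p
  fun_prop

variable [IsProbabilityMeasure P]

lemma integral_dens (he : SignFamily P e) (c : ℕ → ℝ) {S : Finset ℕ} (hS : ∀ p ∈ S, p.Prime)
    (s : ℝ) : ∫ ω, dens c e S s ω ∂P = 1 := by
  have := he.integral_prod S hS fun p x => 1 + c p * Real.cos (s * Real.log p) * x
  simp only [dens, this]
  exact Finset.prod_eq_one fun p _ => by ring

/-- Martingale property in covariance form: the factors at primes in `S'` outside `S` occur once and
have mean one, so only the smaller set `S` survives. -/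
lemma integral_dens_mul_dens (he : SignFamily P e) (c : ℕ → ℝ) {S S' : Finset ℕ}
    (hS : ∀ p ∈ S', p.Prime) (hSS : S ⊆ S') (s s' : ℝ) :
    ∫ ω, dens c e S s ω * dens c e S' s' ω ∂P = kern c S s s' := by
  have h1 := he.integral_prod S' hS fun p x =>
    (if p ∈ S then 1 + c p * Real.cos (s * Real.log p) * x else 1) *
      (1 + c p * Real.cos (s' * Real.log p) * x)
  have e1 : ∀ ω, dens c e S s ω * dens c e S' s' ω = ∏ p ∈ S',
      (if p ∈ S then 1 + c p * Real.cos (s * Real.log p) * e p ω else 1) *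
      (1 + c p * Real.cos (s' * Real.log p) * e p ω) := by
    intro ω
    rw [Finset.prod_mul_distrib, Finset.prod_ite_mem, Finset.inter_eq_right.2 hSS]
    rfl
  simp_rw [e1]
  rw [h1]
  have e2 : kern c S s s' = ∏ p ∈ S', if p ∈ S then
      1 + c p ^ 2 * (Real.cos (s * Real.log p) * Real.cos (s' * Real.log p)) else 1 := by
    rw [Finset.prod_ite_mem, Finset.inter_eq_right.2 hSS]; rfl
  rw [e2]
  refine Finset.prod_congr rfl fun p _ => ?_
  split_ifs <;> ring

/-- Orthogonality of martingale increments: each mixed term equals the kernel over the smaller set.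
-/
lemma integral_dens_sub_mul_dens_sub (he : SignFamily P e) (hc : ∀ p, |c p| ≤ 1)
    {S S' : Finset ℕ} (hS : ∀ p ∈ S', p.Prime) (hSS : S ⊆ S') (s s' : ℝ) :
    ∫ ω, (dens c e S' s ω - dens c e S s ω) * (dens c e S' s' ω - dens c e S s' ω) ∂P =
      kern c S' s s' - kern c S s s' := by
  have hint : ∀ (A B : Finset ℕ) (a b : ℝ),
      Integrable (fun ω => dens c e A a ω * dens c e B b ω) P := by
    intro A B a b
    have hA := (measurable_dens he c A).comp (measurable_prodMk_left (x := a))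
    have hB := (measurable_dens he c B).comp (measurable_prodMk_left (x := b))
    refine Integrable.of_bound (hA.mul hB).aestronglyMeasurable (2 ^ A.card * 2 ^ B.card)
      (ae_of_all _ fun ω => ?_)
    have h1 := dens_nonneg he hc A a ω
    have h2 := dens_nonneg he hc B b ω
    rw [Real.norm_eq_abs, abs_of_nonneg (mul_nonneg h1 h2)]
    exact mul_le_mul (dens_le he hc A a ω) (dens_le he hc B b ω) h2 (by positivity)
  have e1 : ∀ ω, (dens c e S' s ω - dens c e S s ω) * (dens c e S' s' ω - dens c e S s' ω) =
      dens c e S' s ω * dens c e S' s' ω - dens c e S s' ω * dens c e S' s ω -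
      dens c e S s ω * dens c e S' s' ω + dens c e S s ω * dens c e S s' ω := fun ω => by ring
  simp_rw [e1]
  have i1 := hint S' S' s s'
  have i2 := hint S S' s' s
  have i3 := hint S S' s s'
  have i4 := hint S S s s'
  have i12 : Integrable (fun ω => dens c e S' s ω * dens c e S' s' ω -
    dens c e S s' ω * dens c e S' s ω) P := i1.sub i2
  have i123 : Integrable (fun ω => dens c e S' s ω * dens c e S' s' ω -
    dens c e S s' ω * dens c e S' s ω - dens c e S s ω * dens c e S' s' ω) P := i12.sub i3
  rw [integral_add i123 i4, integral_sub i12 i3, integral_sub i1 i2,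
    integral_dens_mul_dens he c hS subset_rfl, integral_dens_mul_dens he c hS hSS,
    integral_dens_mul_dens he c hS hSS,
    integral_dens_mul_dens he c (fun p hp => hS p (hSS hp)) subset_rfl]
  have : kern c S s' s = kern c S s s' := by
    simp only [kern]; exact Finset.prod_congr rfl fun p _ => by ring
  rw [this]; ring

end dens

/-- Bounded measurable functions supported in `[-R, R]`. -/
structure TestFun (R B : ℝ) (g : ℝ → ℝ) : Prop where
  measurable : Measurable g
  bound : ∀ s, |g s| ≤ B
  support : ∀ s, s ∉ Set.Icc (-R) R → g s = 0

/-- The mass `∫ g(s) dens(s) ds`. -/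
def mass (c : ℕ → ℝ) (e : ℕ → Ω → ℝ) (S : Finset ℕ) (g : ℝ → ℝ) (ω : Ω) : ℝ :=
  ∫ s, g s * dens c e S s ω

lemma TestFun.nonneg {R B : ℝ} {g : ℝ → ℝ} (hg : TestFun R B g) : 0 ≤ B :=
  (abs_nonneg _).trans (hg.bound 0)

lemma TestFun.integrable {R B : ℝ} {g : ℝ → ℝ} (hg : TestFun R B g) : Integrable g := by
  have h1 : IntegrableOn g (Set.Icc (-R) R) :=
    Measure.integrableOn_of_bounded (by simp) hg.measurable.aestronglyMeasurable
      (ae_of_all _ fun s => by rw [Real.norm_eq_abs]; exact hg.bound s)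
  exact (integrableOn_iff_integrable_of_support_subset fun s hs => by
    by_contra h; exact hs (hg.support s h)).1 h1

lemma eLpNorm_two_le {P : Measure Ω} {Y : Ω → ℝ} {η : ℝ} (hη : 0 ≤ η)
    (hY : MemLp Y 2 P) (h : ∫ ω, Y ω ^ 2 ∂P ≤ η ^ 2) : eLpNorm Y 2 P ≤ ENNReal.ofReal η := by
  rw [hY.eLpNorm_eq_integral_rpow_norm (by norm_num) (by norm_num)]
  apply ENNReal.ofReal_le_ofReal
  simp only [ENNReal.toReal_ofNat, Real.rpow_ofNat, Real.norm_eq_abs, sq_abs]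
  calc _ ≤ (η ^ 2) ^ (2 : ℝ)⁻¹ :=
        Real.rpow_le_rpow (integral_nonneg fun ω => sq_nonneg _) h (by norm_num)
    _ = η := by
        rw [← Real.rpow_natCast, ← Real.rpow_mul hη]; norm_num

section mass

variable {P : Measure Ω} {e : ℕ → Ω → ℝ} {c : ℕ → ℝ} {R B : ℝ}
  {g : ℝ → ℝ}

lemma integrable_mul_dens (he : SignFamily P e) (hc : ∀ p, |c p| ≤ 1) (S : Finset ℕ)
    (hg : Integrable g) (ω : Ω) : Integrable fun s => g s * dens c e S s ω := by
  refine hg.mul_bdd (c := 2 ^ S.card)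
    ((measurable_dens he c S).comp measurable_prodMk_right).aestronglyMeasurable
    (ae_of_all _ fun s => ?_)
  rw [Real.norm_eq_abs, abs_of_nonneg (dens_nonneg he hc S s ω)]
  exact dens_le he hc S s ω

lemma measurable_mass (he : SignFamily P e) (c : ℕ → ℝ) (S : Finset ℕ)
    (hg : Measurable g) : Measurable (mass c e S g) := by
  have h1 : Measurable fun z : Ω × ℝ => dens c e S z.2 z.1 := by
    unfold dens
    have := fun p => he.measurable p
    fun_prop
  have h : Measurable fun z : Ω × ℝ => g z.2 * dens c e S z.2 z.1 :=
    Measurable.mul (hg.comp measurable_snd) h1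
  exact (h.stronglyMeasurable.integral_prod_right' (ν := volume)).measurable

lemma abs_mass_le (he : SignFamily P e) (hc : ∀ p, |c p| ≤ 1) (S : Finset ℕ)
    (hg : Integrable g) (ω : Ω) : |mass c e S g ω| ≤ 2 ^ S.card * ∫ s, |g s| := by
  rw [mass, ← integral_const_mul, ← Real.norm_eq_abs]
  refine norm_integral_le_of_norm_le (hg.abs.const_mul _) (ae_of_all _ fun s => ?_)
  rw [norm_mul, Real.norm_eq_abs, Real.norm_eq_abs, abs_of_nonneg (dens_nonneg he hc S s ω),
    mul_comm]
  exact mul_le_mul_of_nonneg_right (dens_le he hc S s ω) (abs_nonneg _)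

variable [IsProbabilityMeasure P]

lemma memLp_mass (he : SignFamily P e) (hc : ∀ p, |c p| ≤ 1) (S : Finset ℕ)
    (hg : TestFun R B g) : MemLp (mass c e S g) 2 P :=
  MemLp.of_bound (measurable_mass he c S hg.measurable).aestronglyMeasurable
    (2 ^ S.card * ∫ s, |g s|)
    (ae_of_all _ fun ω => by
      rw [Real.norm_eq_abs]; exact abs_mass_le he hc S hg.integrable ω)

/-- Squaring the integral and exchanging it with the expectation leaves the double integral of the
correlation `k` against `g ⊗ g`. -/
lemma integral_sq_integral_mul_le {D : ℝ → Ω → ℝ} {k : ℝ → ℝ → ℝ} {b : ℝ} (hg : TestFun R B g)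
    (hDm : Measurable fun z : ℝ × Ω => D z.1 z.2) (hDb : ∀ s ω, |D s ω| ≤ b)
    (hk : ∀ s s', ∫ ω, D s ω * D s' ω ∂P = k s s')
    (hki : Integrable (fun z : ℝ × ℝ => |k z.1 z.2|)
      ((volume.restrict (Set.Icc (-R) R)).prod (volume.restrict (Set.Icc (-R) R)))) :
    ∫ ω, (∫ s, g s * D s ω) ^ 2 ∂P ≤
      B ^ 2 * ∫ z : ℝ × ℝ, |k z.1 z.2|
        ∂((volume.restrict (Set.Icc (-R) R)).prod (volume.restrict (Set.Icc (-R) R))) := by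
  obtain ⟨ν, hν⟩ : ∃ ν : Measure ℝ, ν = volume.restrict (Set.Icc (-R) R) := ⟨_, rfl⟩
  have : IsFiniteMeasure ν := by rw [hν]; infer_instance
  rw [← hν] at hki ⊢
  have hB := hg.nonneg
  have hb : 0 ≤ b := (abs_nonneg _).trans (hDb 0 (Classical.choice P.nonempty_of_neZero))
  have e2 : ∀ ω, (∫ s, g s * D s ω) ^ 2 =
      ∫ z : ℝ × ℝ, (g z.1 * D z.1 ω) * (g z.2 * D z.2 ω) ∂(ν.prod ν) := by
    intro ω
    have e1 : ∫ s, g s * D s ω = ∫ s, g s * D s ω ∂ν := by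
      rw [hν, setIntegral_eq_integral_of_forall_compl_eq_zero]
      intro s hs; rw [hg.support s hs, zero_mul]
    rw [e1, sq, integral_prod_mul (fun s => g s * D s ω) (fun s => g s * D s ω)]
  simp_rw [e2]
  have hm1 : Measurable fun q : Ω × (ℝ × ℝ) => D q.2.1 q.1 :=
    hDm.comp ((measurable_fst.comp measurable_snd).prodMk measurable_fst)
  have hm2 : Measurable fun q : Ω × (ℝ × ℝ) => D q.2.2 q.1 :=
    hDm.comp ((measurable_snd.comp measurable_snd).prodMk measurable_fst)
  have hg1 : Measurable fun q : Ω × (ℝ × ℝ) => g q.2.1 :=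
    hg.measurable.comp (measurable_fst.comp measurable_snd)
  have hg2 : Measurable fun q : Ω × (ℝ × ℝ) => g q.2.2 :=
    hg.measurable.comp (measurable_snd.comp measurable_snd)
  have hm : Measurable fun q : Ω × (ℝ × ℝ) => (g q.2.1 * D q.2.1 q.1) * (g q.2.2 * D q.2.2 q.1) :=
    (hg1.mul hm1).mul (hg2.mul hm2)
  have hint : Integrable (fun q : Ω × (ℝ × ℝ) => (g q.2.1 * D q.2.1 q.1) * (g q.2.2 * D q.2.2 q.1))
      (P.prod (ν.prod ν)) := by
    refine Integrable.of_bound hm.aestronglyMeasurable ((B * b) * (B * b))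
      (ae_of_all _ fun q => ?_)
    rw [Real.norm_eq_abs, abs_mul, abs_mul, abs_mul]
    have h1 := hg.bound q.2.1
    have h2 := hg.bound q.2.2
    have h3 := hDb q.2.1 q.1
    have h4 := hDb q.2.2 q.1
    gcongr
  rw [integral_integral_swap hint]
  have e3 : ∀ z : ℝ × ℝ, ∫ ω, (g z.1 * D z.1 ω) * (g z.2 * D z.2 ω) ∂P =
      (g z.1 * g z.2) * k z.1 z.2 := by
    intro z
    rw [← hk, ← integral_const_mul]
    exact integral_congr_ae (ae_of_all _ fun ω => by ring)
  simp_rw [e3]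
  rw [← integral_const_mul]
  refine (le_abs_self _).trans ?_
  rw [← Real.norm_eq_abs]
  refine norm_integral_le_of_norm_le (hki.const_mul _) (ae_of_all _ fun z => ?_)
  rw [norm_mul, norm_mul, Real.norm_eq_abs, Real.norm_eq_abs, Real.norm_eq_abs, sq]
  have h1 := hg.bound z.1
  have h2 := hg.bound z.2
  gcongr

lemma abs_kern_le (hc : ∀ p, |c p| ≤ 1) (A : Finset ℕ) (s s' : ℝ) :
    |kern c A s s'| ≤ 2 ^ A.card := by
  have hc2 : ∀ p, c p ^ 2 ≤ 1 := fun p => (sq_le_one_iff_abs_le_one _).2 (hc p)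
  rw [abs_of_nonneg (kern_nonneg hc2 A _ _), kern_eq, ← Finset.prod_const]
  refine Finset.prod_le_prod ?_ ?_ <;> intro p _ <;>
    linarith [(abs_le.1 ((abs_covTerm_le c s s' p).trans (hc2 p))).1,
      (abs_le.1 ((abs_covTerm_le c s s' p).trans (hc2 p))).2]

lemma integral_mass_sub_sq_le (he : SignFamily P e) (hc : ∀ p, |c p| ≤ 1)
    (hg : TestFun R B g) {S S' : Finset ℕ} (hS : ∀ p ∈ S', p.Prime) (hSS : S ⊆ S') :
    ∫ ω, (mass c e S' g ω - mass c e S g ω) ^ 2 ∂P ≤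
      B ^ 2 * ∫ z : ℝ × ℝ, |kern c S' z.1 z.2 - kern c S z.1 z.2|
        ∂((volume.restrict (Set.Icc (-R) R)).prod (volume.restrict (Set.Icc (-R) R))) := by
  have e1 : ∀ ω, mass c e S' g ω - mass c e S g ω =
      ∫ s, g s * (dens c e S' s ω - dens c e S s ω) := by
    intro ω
    rw [mass, mass, ← integral_sub (integrable_mul_dens he hc S' hg.integrable ω)
      (integrable_mul_dens he hc S hg.integrable ω)]
    simp only [mul_sub]
  simp_rw [e1]
  have hkm : Measurable fun z : ℝ × ℝ => |kern c S' z.1 z.2 - kern c S z.1 z.2| :=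
    ((measurable_kern c S').sub (measurable_kern c S)).abs
  refine integral_sq_integral_mul_le (D := fun s ω => dens c e S' s ω - dens c e S s ω)
    (k := fun s s' => kern c S' s s' - kern c S s s') (b := 2 ^ S'.card + 2 ^ S.card) hg
    ((measurable_dens he c S').sub (measurable_dens he c S)) (fun s ω => ?_)
    (fun s s' => integral_dens_sub_mul_dens_sub he hc hS hSS s s') ?_
  · refine (abs_sub _ _).trans ?_
    rw [abs_of_nonneg (dens_nonneg he hc S s ω), abs_of_nonneg (dens_nonneg he hc S' s ω)]
    exact add_le_add (dens_le he hc _ _ _) (dens_le he hc _ _ _)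
  · refine Integrable.of_bound hkm.aestronglyMeasurable (2 ^ S'.card + 2 ^ S.card)
      (ae_of_all _ fun z => ?_)
    rw [Real.norm_eq_abs, abs_abs]
    exact (abs_sub _ _).trans (add_le_add (abs_kern_le hc _ _ _) (abs_kern_le hc _ _ _))

lemma primesIoc_subset {L N M : ℕ} (h : N ≤ M) : primesIoc L N ⊆ primesIoc L M := by
  intro p hp
  rw [mem_primesIoc] at hp ⊢
  exact ⟨⟨hp.1.1, hp.1.2.trans h⟩, hp.2⟩

lemma prime_of_mem_primesIoc {L M : ℕ} : ∀ p ∈ primesIoc L M, p.Prime :=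
  fun _ hp => (mem_primesIoc.1 hp).2

/-- The central estimate. Its threshold depends only on `R`, `B` and `η`. Uniformity in `δ` permits
the exchange of limits in (ii), while uniformity in `g` and `L` permits the support argument to
choose a test function after `N`. -/
theorem exists_eLpNorm_mass_sub_le (he : SignFamily P e) {θ : ℝ} {f : ℕ → ℝ}
    (h : IsAdmissible θ f) (R B : ℝ) {η : ℝ} (hη : 0 < η) :
    ∃ N0 : ℕ, ∀ g, TestFun R B g → ∀ δ ∈ Set.Icc (0 : ℝ) 1, ∀ L N M : ℕ,
      L ≤ N → N0 ≤ N → N ≤ M →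
      eLpNorm (mass (coef f δ) e (primesIoc L M) g - mass (coef f δ) e (primesIoc L N) g) 2 P ≤
        ENNReal.ofReal η := by
  -- The denominator is `B² + 1` rather than `B²` because `B` may vanish.
  obtain ⟨N0, hN0⟩ := h.exists_integral_abs_kern_sub_le R
    (by positivity : 0 < η ^ 2 / (B ^ 2 + 1))
  refine ⟨N0, fun g hg δ hδ L N M hLN hN hNM => ?_⟩
  have hc := abs_coef_le_one f δ
  refine eLpNorm_two_le hη.le ((memLp_mass he hc _ hg).sub (memLp_mass he hc _ hg)) ?_
  refine (integral_mass_sub_sq_le he hc hg prime_of_mem_primesIoc (primesIoc_subset hNM)).trans ?_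
  calc _ ≤ B ^ 2 * (η ^ 2 / (B ^ 2 + 1)) := by
        gcongr; exact hN0 δ hδ L N M hLN hN hNM
    _ ≤ (B ^ 2 + 1) * (η ^ 2 / (B ^ 2 + 1)) := by gcongr; linarith
    _ = η ^ 2 := by field_simp

end mass

end RandMult

/-! ### Random measures with Lebesgue intensity and extension from intervals to integrable functions
-/

namespace RandMult

variable {Ω : Type*} [MeasurableSpace Ω]

/-- A random measure on the line whose intensity is Lebesgue measure. -/
structure LebesgueIntensity (P : Measure Ω) (m : Ω → Measure ℝ) : Prop where
  measurable : Measurable m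
  bind_eq : P.bind m = volume

namespace LebesgueIntensity

variable {P : Measure Ω} {m : Ω → Measure ℝ} {g g' : ℝ → ℝ}

lemma lintegral_lintegral (h : LebesgueIntensity P m) {φ : ℝ → ℝ≥0∞} (hφ : AEMeasurable φ) :
    ∫⁻ ω, ∫⁻ s, φ s ∂(m ω) ∂P = ∫⁻ s, φ s := by
  have := Measure.lintegral_bind (m := P) (μ := m) (f := φ) h.measurable.aemeasurable
    (by rwa [h.bind_eq])
  rw [← this, h.bind_eq]

/-- A Lebesgue-null set has expected mass zero, hence is `m ω`-null almost surely. This lets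
integrals against `m ω` be taken of functions defined only almost everywhere. -/
lemma ae_ae (h : LebesgueIntensity P m) {p : ℝ → Prop} (hp : ∀ᵐ s, p s) :
    ∀ᵐ ω ∂P, ∀ᵐ s ∂(m ω), p s :=
  Measure.ae_ae_of_ae_bind h.measurable.aemeasurable (by rwa [h.bind_eq])

lemma ae_integrable (h : LebesgueIntensity P m) (hg : Integrable g) :
    ∀ᵐ ω ∂P, Integrable g (m ω) := by
  have h1 : ∀ᵐ ω ∂P, ∀ᵐ s ∂(m ω), g s = hg.1.mk g s := h.ae_ae hg.1.ae_eq_mk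
  have hm : AEMeasurable (fun s => ‖g s‖ₑ) := hg.1.enorm
  have h2 : ∀ᵐ ω ∂P, ∫⁻ s, ‖hg.1.mk g s‖ₑ ∂(m ω) < ∞ := by
    have hmk : Measurable fun s => ‖hg.1.mk g s‖ₑ := hg.1.stronglyMeasurable_mk.enorm
    refine ae_lt_top ((Measure.measurable_lintegral hmk).comp h.measurable) ?_
    have e := h.lintegral_lintegral hmk.aemeasurable
    change ∫⁻ ω, ∫⁻ s, ‖hg.1.mk g s‖ₑ ∂(m ω) ∂P ≠ ∞
    rw [e]
    have : ∫⁻ s, ‖hg.1.mk g s‖ₑ = ∫⁻ s, ‖g s‖ₑ :=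
      lintegral_congr_ae (hg.1.ae_eq_mk.mono fun s hs => by simp only [hs])
    rw [this]
    exact hg.2.ne
  filter_upwards [h1, h2] with ω h1 h2
  refine Integrable.congr (f := hg.1.mk g) ⟨hg.1.stronglyMeasurable_mk.aestronglyMeasurable, h2⟩ ?_
  exact h1.mono fun s hs => hs.symm

lemma aestronglyMeasurable_integral (h : LebesgueIntensity P m) (hg : Integrable g) :
    AEStronglyMeasurable (fun ω => ∫ s, g s ∂(m ω)) P := by
  set k := hg.1.mk g with hk
  have hkm : Measurable k := hg.1.stronglyMeasurable_mk.measurable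
  have h1 : ∀ᵐ ω ∂P, ∀ᵐ s ∂(m ω), g s = k s := h.ae_ae hg.1.ae_eq_mk
  refine AEMeasurable.aestronglyMeasurable
    ⟨fun ω => (∫⁻ s, ENNReal.ofReal (k s) ∂(m ω)).toReal -
      (∫⁻ s, ENNReal.ofReal (-k s) ∂(m ω)).toReal, ?_, ?_⟩
  · exact (((Measure.measurable_lintegral hkm.ennreal_ofReal).comp h.measurable).ennreal_toReal).sub
      (((Measure.measurable_lintegral hkm.neg.ennreal_ofReal).comp h.measurable).ennreal_toReal)
  · filter_upwards [h1, h.ae_integrable hg] with ω h1 h2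
    rw [← integral_eq_lintegral_pos_part_sub_lintegral_neg_part (h2.congr h1)]
    exact integral_congr_ae h1

/-- Integration against the random measure is a contraction from `L¹(ℝ)` to `L¹(P)`, because the
expectation of `∫ |g - g'| dm` is its Lebesgue integral. -/
lemma eLpNorm_integral_sub_le (h : LebesgueIntensity P m) (hg : Integrable g)
    (hg' : Integrable g') :
    eLpNorm (fun ω => ∫ s, g s ∂(m ω) - ∫ s, g' s ∂(m ω)) 1 P ≤ ∫⁻ s, ‖g s - g' s‖ₑ := by
  have hm : AEMeasurable (fun s => ‖g s - g' s‖ₑ) := (hg.1.sub hg'.1).enorm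
  rw [eLpNorm_one_eq_lintegral_enorm, ← h.lintegral_lintegral hm]
  refine lintegral_mono_ae ?_
  filter_upwards [h.ae_integrable hg, h.ae_integrable hg'] with ω h1 h2
  rw [← integral_sub h1 h2]
  exact enorm_integral_le_lintegral_enorm _

end LebesgueIntensity

/-- The masses `∫ g dmₙ` converge to `∫ g dm` in `L¹(P)`. -/
def MassTendsto (P : Measure Ω) (mN : ℕ → Ω → Measure ℝ) (m : Ω → Measure ℝ) (g : ℝ → ℝ) : Prop :=
  Tendsto (fun N => eLpNorm (fun ω => ∫ s, g s ∂(mN N ω) - ∫ s, g s ∂(m ω)) 1 P) atTop (𝓝 0)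

section MassTendsto

variable {P : Measure Ω} {mN : ℕ → Ω → Measure ℝ} {m : Ω → Measure ℝ}

/-- The contraction property holds for every `mN N` with the same constant, so the functions along
which masses converge form a closed set in `L¹(ℝ)`; this is a three-epsilon argument. -/
lemma MassTendsto.of_approx (hN : ∀ N, LebesgueIntensity P (mN N)) (hm : LebesgueIntensity P m)
    {g : ℝ → ℝ} (hg : Integrable g)
    (happ : ∀ ε : ℝ≥0∞, 0 < ε → ∃ g', Integrable g' ∧ MassTendsto P mN m g' ∧
      ∫⁻ s, ‖g s - g' s‖ₑ ≤ ε) : MassTendsto P mN m g := by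
  rw [MassTendsto, ENNReal.tendsto_atTop_zero]
  intro ε hε
  have hε3 : 0 < ε / 3 := ENNReal.div_pos hε.ne' (by norm_num)
  obtain ⟨g', hg', hT, hle⟩ := happ (ε / 3) hε3
  obtain ⟨N0, hN0⟩ := ENNReal.tendsto_atTop_zero.1 hT (ε / 3) hε3
  refine ⟨N0, fun N hNN => ?_⟩
  have e : (fun ω => ∫ s, g s ∂(mN N ω) - ∫ s, g s ∂(m ω)) =
      (fun ω => ∫ s, g s ∂(mN N ω) - ∫ s, g' s ∂(mN N ω)) +
      ((fun ω => ∫ s, g' s ∂(mN N ω) - ∫ s, g' s ∂(m ω)) +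
      fun ω => ∫ s, g' s ∂(m ω) - ∫ s, g s ∂(m ω)) := by
    funext ω; simp only [Pi.add_apply]; ring
  have a1 := (hN N).aestronglyMeasurable_integral hg
  have a2 := (hN N).aestronglyMeasurable_integral hg'
  have a3 := hm.aestronglyMeasurable_integral hg
  have a4 := hm.aestronglyMeasurable_integral hg'
  have hle' : ∫⁻ s, ‖g' s - g s‖ₑ ≤ ε / 3 := by
    simpa only [← enorm_neg (g _ - g' _), neg_sub] using hle
  rw [e]
  refine (eLpNorm_add_le (a1.sub a2) ((a2.sub a4).add (a4.sub a3)) le_rfl).trans ?_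
  calc _ ≤ ε / 3 + (ε / 3 + ε / 3) := by
        refine add_le_add (((hN N).eLpNorm_integral_sub_le hg hg').trans hle)
          ((eLpNorm_add_le (a2.sub a4) (a4.sub a3) le_rfl).trans (add_le_add (hN0 N hNN)
            ((hm.eLpNorm_integral_sub_le hg' hg).trans hle')))
    _ = ε := by rw [← add_assoc]; exact ENNReal.add_thirds ε

lemma MassTendsto.add (hN : ∀ N, LebesgueIntensity P (mN N)) (hm : LebesgueIntensity P m)
    {g g' : ℝ → ℝ} (hg : Integrable g) (hg' : Integrable g')
    (h : MassTendsto P mN m g) (h' : MassTendsto P mN m g') :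
    MassTendsto P mN m (fun s => g s + g' s) := by
  have hsum := Tendsto.add h h'
  rw [add_zero] at hsum
  refine tendsto_of_tendsto_of_tendsto_of_le_of_le tendsto_const_nhds hsum
    (fun N => zero_le) fun N => ?_
  have a1 := (hN N).aestronglyMeasurable_integral hg
  have a2 := (hN N).aestronglyMeasurable_integral hg'
  have a3 := hm.aestronglyMeasurable_integral hg
  have a4 := hm.aestronglyMeasurable_integral hg'
  refine le_trans (eLpNorm_congr_ae ?_).le (eLpNorm_add_le (a1.sub a3) (a2.sub a4) le_rfl)
  filter_upwards [(hN N).ae_integrable hg, (hN N).ae_integrable hg', hm.ae_integrable hg,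
    hm.ae_integrable hg'] with ω h1 h2 h3 h4
  simp only [Pi.add_apply]
  rw [integral_add h1 h2, integral_add h3 h4]
  ring

lemma MassTendsto.const_mul {g : ℝ → ℝ} (c : ℝ) (h : MassTendsto P mN m g) :
    MassTendsto P mN m (fun s => c * g s) := by
  have h1 := ENNReal.Tendsto.const_mul h (Or.inr (enorm_ne_top (x := c)))
  rw [mul_zero] at h1
  refine h1.congr fun N => ?_
  simp only [integral_const_mul, ← mul_sub]
  exact (eLpNorm_const_smul c _ 1 P).symm

lemma MassTendsto.zero : MassTendsto P mN m fun _ => 0 := by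
  simp [MassTendsto]

lemma integrable_indicator_one {s : Set ℝ} (hs : MeasurableSet s) (hfin : volume s < ∞) :
    Integrable (s.indicator fun _ => (1 : ℝ)) :=
  (integrable_indicator_iff hs).2 (integrableOn_const hfin.ne)

/-- Induction from the π-system of half-open intervals. Intersecting with `(-n, n]` keeps
complements and countable unions of finite measure, so that their indicators stay integrable. -/
lemma massTendsto_indicator_inter_Ioc (hN : ∀ N, LebesgueIntensity P (mN N))
    (hm : LebesgueIntensity P m)
    (hI : ∀ a b : ℝ, a < b → MassTendsto P mN m ((Set.Ioc a b).indicator fun _ => 1))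
    (n : ℕ) {B : Set ℝ} (hB : MeasurableSet B) :
    MassTendsto P mN m ((B ∩ Set.Ioc (-(n : ℝ)) n).indicator fun _ => 1) := by
  set T := Set.Ioc (-(n : ℝ)) n with hT
  have hTm : MeasurableSet T := measurableSet_Ioc
  have hTf : volume T < ∞ := by simp [hT]
  have hsub : ∀ A : Set ℝ, volume (A ∩ T) < ∞ := fun A =>
    (measure_mono Set.inter_subset_right).trans_lt hTf
  have hI' : ∀ a b : ℝ, MassTendsto P mN m ((Set.Ioc a b).indicator fun _ => 1) := by
    intro a b
    rcases lt_or_ge a b with h | h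
    · exact hI a b h
    · rw [Set.Ioc_eq_empty (not_lt.2 h), Set.indicator_empty']; exact MassTendsto.zero
  induction B, hB using MeasurableSpace.induction_on_inter
    ((BorelSpace.measurable_eq (α := ℝ)).trans (borel_eq_generateFrom_Ioc ℝ))
    (isPiSystem_Ioc id id) with
  | empty => simpa using MassTendsto.zero
  | basic t ht =>
    obtain ⟨a, b, _, rfl⟩ := ht
    rw [hT]
    simp only [Set.Ioc_inter_Ioc]
    exact hI' _ _
  | compl t ht ih =>
    have e : ((tᶜ ∩ T).indicator fun _ => (1 : ℝ)) =
        fun s => T.indicator (fun _ => 1) s + (-1) * (t ∩ T).indicator (fun _ => 1) s := by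
      funext s
      by_cases h1 : s ∈ t <;> by_cases h2 : s ∈ T <;> simp [h1, h2]
    rw [e]
    exact MassTendsto.add hN hm (integrable_indicator_one hTm hTf)
      ((integrable_indicator_one (ht.inter hTm) (hsub t)).const_mul _) (hI' _ _)
      (ih.const_mul _)
  | iUnion F hd hF ih =>
    have hfin : ∀ k : Finset ℕ, MassTendsto P mN m
        (((⋃ i ∈ k, F i) ∩ T).indicator fun _ => 1) := by
      intro k
      induction k using Finset.induction_on with
      | empty => simpa using MassTendsto.zero
      | insert a k hak ihk =>
        have e : (((⋃ i ∈ insert a k, F i) ∩ T).indicator fun _ => (1 : ℝ)) =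
            fun s => (F a ∩ T).indicator (fun _ => 1) s +
              ((⋃ i ∈ k, F i) ∩ T).indicator (fun _ => 1) s := by
          have hdis : Disjoint (F a ∩ T) ((⋃ i ∈ k, F i) ∩ T) := by
            refine Disjoint.mono Set.inter_subset_left Set.inter_subset_left ?_
            rw [Set.disjoint_iUnion₂_right]
            intro i hi
            exact hd (fun h => hak (h ▸ hi))
          rw [Finset.set_biUnion_insert, Set.union_inter_distrib_right,
            Set.indicator_union_of_disjoint hdis]
        rw [e]
        exact MassTendsto.add hN hm (integrable_indicator_one ((hF a).inter hTm) (hsub _))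
          (integrable_indicator_one ((Finset.measurableSet_biUnion _ fun i _ => hF i).inter hTm)
            (hsub _)) (ih a) ihk
    refine MassTendsto.of_approx hN hm
      (integrable_indicator_one ((MeasurableSet.iUnion hF).inter hTm) (hsub _)) fun ε hε => ?_
    have hlim : Tendsto (fun k : ℕ => ∫⁻ s,
        ENNReal.ofReal ‖((⋃ i ∈ Finset.range k, F i) ∩ T).indicator (fun _ => (1 : ℝ)) s -
          ((⋃ i, F i) ∩ T).indicator (fun _ => 1) s‖) atTop (𝓝 0) := by
      refine tendsto_lintegral_norm_of_dominated_convergence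
        (bound := T.indicator fun _ => 1) (fun k => ?_)
        (integrable_indicator_one hTm hTf).2 (fun k => ?_) ?_
      · exact (integrable_indicator_one ((Finset.measurableSet_biUnion _ fun i _ => hF i).inter hTm)
          (hsub _)).1
      · refine ae_of_all _ fun s => ?_
        by_cases h1 : s ∈ (⋃ i ∈ Finset.range k, F i) ∩ T
        · rw [Set.indicator_of_mem h1, Set.indicator_of_mem h1.2, norm_one]
        · rw [Set.indicator_of_notMem h1, norm_zero]
          exact Set.indicator_nonneg (fun _ _ => zero_le_one) _
      · refine ae_of_all _ fun s => ?_
        have := tendsto_indicator_biUnion_finset (fun i => F i ∩ T) (fun _ : ℝ => (1 : ℝ)) s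
        simp only [← Set.iUnion_inter] at this
        exact (this.mono_right (pure_le_nhds _)).comp tendsto_finset_range
    obtain ⟨k, hk⟩ := (hlim.eventually (ge_mem_nhds hε)).exists
    refine ⟨_, integrable_indicator_one
      ((Finset.measurableSet_biUnion (Finset.range k) fun i _ => hF i).inter hTm) (hsub _),
      hfin _, ?_⟩
    refine le_trans (lintegral_mono fun s => ?_) hk
    rw [ofReal_norm, ← enorm_neg, neg_sub]

theorem massTendsto_of_Ioc (hN : ∀ N, LebesgueIntensity P (mN N)) (hm : LebesgueIntensity P m)
    (hI : ∀ a b : ℝ, a < b → MassTendsto P mN m ((Set.Ioc a b).indicator fun _ => 1))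
    {g : ℝ → ℝ} (hg : Integrable g) : MassTendsto P mN m g := by
  refine Integrable.induction (fun g => MassTendsto P mN m g) ?_ ?_ ?_ ?_ hg
  · intro c s hs hfin
    have e : (s.indicator fun _ => c) = fun x => c * s.indicator (fun _ => 1) x := by
      funext x; by_cases h : x ∈ s <;> simp [h]
    rw [e]
    refine MassTendsto.const_mul c (MassTendsto.of_approx hN hm
      (integrable_indicator_one hs hfin) fun ε hε => ?_)
    have hlim : Tendsto (fun n : ℕ => ∫⁻ x,
        ENNReal.ofReal ‖(s ∩ Set.Ioc (-(n : ℝ)) n).indicator (fun _ => (1 : ℝ)) x -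
          s.indicator (fun _ => 1) x‖) atTop (𝓝 0) := by
      refine tendsto_lintegral_norm_of_dominated_convergence
        (bound := s.indicator fun _ => 1) (fun k => ?_)
        (integrable_indicator_one hs hfin).2 (fun k => ?_) ?_
      · exact (integrable_indicator_one (hs.inter measurableSet_Ioc)
          ((measure_mono Set.inter_subset_left).trans_lt hfin)).1
      · refine ae_of_all _ fun x => ?_
        by_cases h1 : x ∈ s ∩ Set.Ioc (-(k : ℝ)) k
        · rw [Set.indicator_of_mem h1, Set.indicator_of_mem h1.1]; simp
        · rw [Set.indicator_of_notMem h1, norm_zero]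
          exact Set.indicator_nonneg (fun _ _ => zero_le_one) _
      · refine ae_of_all _ fun x => ?_
        refine tendsto_const_nhds.congr' ?_
        filter_upwards [eventually_gt_atTop ⌈|x|⌉₊] with n hn
        have h1 : |x| < n := (Nat.le_ceil _).trans_lt (by exact_mod_cast hn)
        have h2 : x ∈ Set.Ioc (-(n : ℝ)) n := ⟨(abs_lt.1 h1).1, (abs_lt.1 h1).2.le⟩
        by_cases h : x ∈ s
        · rw [Set.indicator_of_mem h, Set.indicator_of_mem (Set.mem_inter h h2)]
        · rw [Set.indicator_of_notMem h, Set.indicator_of_notMem fun h' => h h'.1]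
    obtain ⟨n, hn⟩ := (hlim.eventually (ge_mem_nhds hε)).exists
    refine ⟨_, integrable_indicator_one (hs.inter measurableSet_Ioc)
      ((measure_mono Set.inter_subset_left).trans_lt hfin),
      massTendsto_indicator_inter_Ioc hN hm hI n hs, ?_⟩
    refine le_trans (lintegral_mono fun x => ?_) hn
    rw [ofReal_norm, ← enorm_neg, neg_sub]
  · intro f g _ hf hg h1 h2
    exact MassTendsto.add hN hm hf hg h1 h2
  -- Closedness in `L¹` is again the approximation lemma, applied along a convergent sequence.
  · rw [← isSeqClosed_iff_isClosed]
    intro u v hu huv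
    refine MassTendsto.of_approx hN hm (L1.integrable_coeFn v) fun ε hε => ?_
    have h1 : Tendsto (fun n => edist (u n) v) atTop (𝓝 0) := tendsto_iff_edist_tendsto_0.1 huv
    obtain ⟨n, hn⟩ := (h1.eventually (ge_mem_nhds hε)).exists
    refine ⟨u n, L1.integrable_coeFn _, hu n, ?_⟩
    rw [edist_comm, L1.edist_def] at hn
    simpa only [edist_eq_enorm_sub] using hn
  · intro f g hfg hf h1
    refine MassTendsto.of_approx hN hm (hf.congr hfg) fun ε hε => ⟨f, hf, h1, ?_⟩
    have : ∫⁻ s, ‖g s - f s‖ₑ = ∫⁻ _ : ℝ, (0 : ℝ≥0∞) :=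
      lintegral_congr_ae (hfg.mono fun s hs => by simp [hs])
    rw [this]; simp

end MassTendsto

end RandMult

/-! ### Construction of the limiting random measure from its distribution function -/

namespace RandMult

variable {Ω : Type*} [MeasurableSpace Ω]

/-- The right-continuous extension of a monotone function on the rationals. -/
def ratStieltjes (Y : ℚ → ℝ) (hY : Monotone Y) : StieltjesFunction ℝ where
  toFun x := ⨅ q : {q : ℚ // x < q}, Y q
  mono' := by
    intro x y hxy
    have : Nonempty {q : ℚ // y < q} := by
      obtain ⟨q, hq⟩ := exists_rat_gt y
      exact ⟨⟨q, hq⟩⟩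
    obtain ⟨r, hr⟩ := exists_rat_lt x
    refine le_ciInf fun q => ?_
    refine ciInf_le (f := fun q : {q : ℚ // x < q} => Y q) ⟨Y r, ?_⟩ ⟨q, hxy.trans_lt q.2⟩
    rintro _ ⟨q', rfl⟩
    exact hY (by exact_mod_cast (hr.trans q'.2).le)
  right_continuous' := by
    intro x
    have hbdd : ∀ x : ℝ, BddBelow (Set.range fun q : {q : ℚ // x < q} => Y q) := by
      intro x
      obtain ⟨r, hr⟩ := exists_rat_lt x
      refine ⟨Y r, ?_⟩
      rintro _ ⟨q', rfl⟩
      exact hY (by exact_mod_cast (hr.trans q'.2).le)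
    have hne : ∀ y : ℝ, Nonempty {q : ℚ // y < q} := by
      intro y
      obtain ⟨q, hq⟩ := exists_rat_gt y
      exact ⟨⟨q, hq⟩⟩
    rw [Metric.continuousWithinAt_iff]
    intro ε hε
    obtain ⟨q, hq⟩ := exists_lt_of_ciInf_lt
      (show (⨅ q : {q : ℚ // x < q}, Y q) < (⨅ q : {q : ℚ // x < q}, Y q) + ε by linarith)
    refine ⟨q - x, sub_pos.2 q.2, fun {y} hy hd => ?_⟩
    have hy' : x ≤ y := hy
    have hyq : y < q := by
      rw [Real.dist_eq, abs_of_nonneg (by linarith)] at hd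
      linarith
    have h1 : (⨅ q : {q : ℚ // y < q}, Y q) ≤ Y q :=
      ciInf_le (f := fun q : {q : ℚ // y < q} => Y q) (hbdd y) ⟨q, hyq⟩
    have h2 : (⨅ q : {q : ℚ // x < q}, Y q) ≤ ⨅ q : {q : ℚ // y < q}, Y q :=
      le_ciInf fun q' => ciInf_le (f := fun q : {q : ℚ // x < q} => Y q) (hbdd x)
        ⟨q', hy'.trans_lt q'.2⟩
    rw [Real.dist_eq, abs_of_nonneg (by linarith)]
    linarith

lemma ratStieltjes_apply (Y : ℚ → ℝ) (hY : Monotone Y) (x : ℝ) :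
    ratStieltjes Y hY x = ⨅ q : {q : ℚ // x < q}, Y q := rfl

lemma ratStieltjes_le (Y : ℚ → ℝ) (hY : Monotone Y) {x : ℝ} {q : ℚ} (hq : x < q) :
    ratStieltjes Y hY x ≤ Y q := by
  obtain ⟨r, hr⟩ := exists_rat_lt x
  refine ciInf_le (f := fun q : {q : ℚ // x < q} => Y q) ⟨Y r, ?_⟩ ⟨q, hq⟩
  rintro _ ⟨q', rfl⟩
  exact hY (by exact_mod_cast (hr.trans q'.2).le)

lemma le_ratStieltjes (Y : ℚ → ℝ) (hY : Monotone Y) {x a : ℝ} (h : ∀ q : ℚ, x < q → a ≤ Y q) :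
    a ≤ ratStieltjes Y hY x := by
  have : Nonempty {q : ℚ // x < q} := by
    obtain ⟨q, hq⟩ := exists_rat_gt x
    exact ⟨⟨q, hq⟩⟩
  exact le_ciInf fun q => h q q.2

/-- The π-system criterion for measurability of a random measure concerns finite measures, so it is
applied on bounded windows and the windows are then exhausted. -/
lemma measurable_stieltjes_measure {F : Ω → StieltjesFunction ℝ}
    (hF : ∀ x, Measurable fun ω => F ω x) : Measurable fun ω => (F ω).measure := by
  have hIoc : ∀ a b : ℝ, Measurable fun ω => (F ω).measure (Set.Ioc a b) := by
    intro a b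
    simp only [StieltjesFunction.measure_Ioc]
    exact ((hF b).sub (hF a)).ennreal_ofReal
  have hr : ∀ n : ℕ, Measurable fun ω => (F ω).measure.restrict (Set.Ioc (-(n : ℝ)) n) := by
    intro n
    have : ∀ ω, IsFiniteMeasure ((F ω).measure.restrict (Set.Ioc (-(n : ℝ)) n)) := fun ω =>
      ⟨by rw [Measure.restrict_apply_univ, StieltjesFunction.measure_Ioc]; exact ENNReal.ofReal_lt_top⟩
    refine Measurable.measure_of_isPiSystem
      ((BorelSpace.measurable_eq (α := ℝ)).trans (borel_eq_generateFrom_Ioc ℝ))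
      (isPiSystem_Ioc id id) ?_ ?_
    · rintro _ ⟨a, b, _, rfl⟩
      simp only [Measure.restrict_apply measurableSet_Ioc, Set.Ioc_inter_Ioc]
      exact hIoc _ _
    · simp only [Measure.restrict_apply_univ]
      exact hIoc _ _
  refine Measure.measurable_of_measurable_coe _ fun s hs => ?_
  have e : ∀ ω, (F ω).measure s = ⨆ n : ℕ, (F ω).measure.restrict (Set.Ioc (-(n : ℝ)) n) s := by
    intro ω
    have hU : s = ⋃ n : ℕ, s ∩ Set.Ioc (-(n : ℝ)) n := by
      rw [← Set.inter_iUnion]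
      refine (Set.inter_eq_left.2 fun x _ => ?_).symm
      obtain ⟨n, hn⟩ := exists_nat_gt |x|
      exact Set.mem_iUnion.2 ⟨n, (abs_lt.1 hn).1, (abs_lt.1 hn).2.le⟩
    have hmono : Monotone fun n : ℕ => s ∩ Set.Ioc (-(n : ℝ)) n := by
      intro a b hab
      have : (a : ℝ) ≤ b := by exact_mod_cast hab
      exact Set.inter_subset_inter_right _ (Set.Ioc_subset_Ioc (by linarith) this)
    conv_lhs => rw [hU]
    rw [hmono.measure_iUnion]
    simp only [Measure.restrict_apply hs]
  simp_rw [e]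
  exact Measurable.iSup fun n => (Measure.measurable_coe hs).comp (hr n)

/-- The function `1_{(0,x]} - 1_{(x,0]}`. -/
def signedStep (x s : ℝ) : ℝ :=
  (Set.Ioc 0 x).indicator (fun _ => 1) s - (Set.Ioc x 0).indicator (fun _ => 1) s

lemma signedStep_sub {a b : ℝ} (h : a ≤ b) (s : ℝ) :
    signedStep b s - signedStep a s = (Set.Ioc a b).indicator (fun _ => 1) s := by
  simp only [signedStep, Set.indicator_apply, Set.mem_Ioc]
  split_ifs <;> first | (exfalso; grind) | norm_num

lemma integrable_signedStep (x : ℝ) : Integrable (signedStep x) :=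
  (integrable_indicator_one measurableSet_Ioc (by simp)).sub
    (integrable_indicator_one measurableSet_Ioc (by simp))

section limit

variable {P : Measure Ω} {mN : ℕ → Ω → Measure ℝ}

lemma LebesgueIntensity.ae_integral_signedStep_sub {m : Ω → Measure ℝ}
    (h : LebesgueIntensity P m) {a b : ℝ} (hab : a ≤ b) :
    ∀ᵐ ω ∂P, ∫ s, signedStep b s ∂(m ω) - ∫ s, signedStep a s ∂(m ω) =
      ∫ s, (Set.Ioc a b).indicator (fun _ => (1 : ℝ)) s ∂(m ω) := by
  filter_upwards [h.ae_integrable (integrable_signedStep a),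
    h.ae_integrable (integrable_signedStep b)] with ω h1 h2
  rw [← integral_sub h2 h1]
  exact integral_congr_ae (ae_of_all _ fun s => signedStep_sub hab s)

lemma LebesgueIntensity.integrable_integral {m : Ω → Measure ℝ}
    (h : LebesgueIntensity P m) {g : ℝ → ℝ} (hg : Integrable g) :
    Integrable (fun ω => ∫ s, g s ∂(m ω)) P := by
  refine ⟨h.aestronglyMeasurable_integral hg, ?_⟩
  have := h.eLpNorm_integral_sub_le hg (integrable_zero ℝ ℝ volume)
  simp only [Pi.zero_apply, integral_zero, sub_zero, eLpNorm_one_eq_lintegral_enorm] at this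
  exact this.trans_lt hg.2

lemma LebesgueIntensity.integral_integral_Ioc {m : Ω → Measure ℝ}
    (h : LebesgueIntensity P m) {a b : ℝ} (hab : a ≤ b) :
    ∫ ω, ∫ s, (Set.Ioc a b).indicator (fun _ => (1 : ℝ)) s ∂(m ω) ∂P = b - a := by
  have hi := h.integrable_integral
    (integrable_indicator_one (measurableSet_Ioc (a := a) (b := b)) (by simp))
  have hnn : ∀ s, 0 ≤ (Set.Ioc a b).indicator (fun _ => (1 : ℝ)) s :=
    fun s => Set.indicator_nonneg (fun _ _ => zero_le_one) s
  have hm : Measurable ((Set.Ioc a b).indicator fun _ => (1 : ℝ)) :=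
    measurable_const.indicator measurableSet_Ioc
  rw [integral_eq_lintegral_of_nonneg_ae (ae_of_all _ fun ω => integral_nonneg hnn) hi.1]
  have e : ∫⁻ ω, ENNReal.ofReal (∫ s, (Set.Ioc a b).indicator (fun _ => (1 : ℝ)) s ∂(m ω)) ∂P =
      ∫⁻ ω, ∫⁻ s, ENNReal.ofReal ((Set.Ioc a b).indicator (fun _ => (1 : ℝ)) s) ∂(m ω) ∂P := by
    refine lintegral_congr_ae ?_
    filter_upwards [h.ae_integrable
      (integrable_indicator_one (measurableSet_Ioc (a := a) (b := b)) (by simp))] with ω hω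
    exact ofReal_integral_eq_lintegral_ofReal hω (ae_of_all _ hnn)
  rw [e, h.lintegral_lintegral hm.ennreal_ofReal.aemeasurable,
    ← ofReal_integral_eq_lintegral_ofReal (integrable_indicator_one measurableSet_Ioc (by simp))
      (ae_of_all _ hnn), integral_indicator_const _ measurableSet_Ioc]
  simp [hab]

lemma ae_nonneg_of_tendsto_eLpNorm_one {u : ℕ → Ω → ℝ} {Z : Ω → ℝ}
    (hu : ∀ n, AEStronglyMeasurable (u n) P) (hZ : AEStronglyMeasurable Z P)
    (h0 : ∀ n, ∀ᵐ ω ∂P, 0 ≤ u n ω)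
    (h : Tendsto (fun n => eLpNorm (u n - Z) 1 P) atTop (𝓝 0)) : ∀ᵐ ω ∂P, 0 ≤ Z ω := by
  obtain ⟨ns, -, hns⟩ :=
    (tendstoInMeasure_of_tendsto_eLpNorm one_ne_zero hu hZ h).exists_seq_tendsto_ae
  filter_upwards [hns, ae_all_iff.2 h0] with ω h1 h2
  exact ge_of_tendsto' h1 fun n => h2 _

/-- The limits `Y x` of the signed masses from `0` to `x` are defined only up to null sets for each
`x`. They are almost surely monotone along the rationals, which is enough to build a
right-continuous distribution function. Since mean increments are `b - a`, this regularisation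
agrees almost surely with `Y x` at every fixed `x`. -/
theorem exists_limit_measure (hN : ∀ N, LebesgueIntensity P (mN N))
    (hlim : ∀ x : ℝ, ∃ Z : Ω → ℝ, Measurable Z ∧ Integrable Z P ∧
      Tendsto (fun N => eLpNorm ((fun ω => ∫ s, signedStep x s ∂(mN N ω)) - Z) 1 P)
        atTop (𝓝 0)) :
    ∃ m : Ω → Measure ℝ, LebesgueIntensity P m ∧ (∀ ω, IsLocallyFiniteMeasure (m ω)) ∧
      ∀ g : ℝ → ℝ, Integrable g → MassTendsto P mN m g := by
  choose Y hYm hYi hYlim using hlim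
  set V : ℝ → ℕ → Ω → ℝ := fun x N ω => ∫ s, signedStep x s ∂(mN N ω) with hV
  have hVi : ∀ x N, Integrable (V x N) P := fun x N =>
    (hN N).integrable_integral (integrable_signedStep x)
  have hdiff : ∀ a b : ℝ, Tendsto (fun N => eLpNorm ((V b N - V a N) - (Y b - Y a)) 1 P) atTop
      (𝓝 0) := by
    intro a b
    have hs := (hYlim b).add (hYlim a)
    rw [add_zero] at hs
    refine tendsto_of_tendsto_of_tendsto_of_le_of_le tendsto_const_nhds hs
      (fun N => zero_le) fun N => ?_
    have e : (V b N - V a N) - (Y b - Y a) = (V b N - Y b) - (V a N - Y a) := by abel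
    rw [e]
    exact eLpNorm_sub_le ((hVi b N).1.sub (hYi b).1) ((hVi a N).1.sub (hYi a).1) le_rfl
  have hmono : ∀ a b : ℝ, a ≤ b → ∀ᵐ ω ∂P, Y a ω ≤ Y b ω := by
    intro a b hab
    have := ae_nonneg_of_tendsto_eLpNorm_one (u := fun N => V b N - V a N) (Z := Y b - Y a)
      (fun N => (hVi b N).1.sub (hVi a N).1) ((hYi b).1.sub (hYi a).1) (fun N => ?_) (hdiff a b)
    · filter_upwards [this] with ω hω
      simpa using hω
    · filter_upwards [(hN N).ae_integral_signedStep_sub hab] with ω hω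
      simp only [Pi.sub_apply, hV]
      rw [hω]
      exact integral_nonneg fun s => Set.indicator_nonneg (fun _ _ => zero_le_one) s
  have hmean : ∀ a b : ℝ, a ≤ b → ∫ ω, (Y b ω - Y a ω) ∂P = b - a := by
    intro a b hab
    have h1 := tendsto_integral_of_L1' (Y b - Y a) ((hYi b).sub (hYi a)).1
      (Eventually.of_forall fun N => (hVi b N).sub (hVi a N)) (hdiff a b)
    have h2 : ∀ N, ∫ ω, (V b N - V a N) ω ∂P = b - a := fun N => by
      rw [← (hN N).integral_integral_Ioc hab]
      exact integral_congr_ae ((hN N).ae_integral_signedStep_sub hab)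
    simp only [h2] at h1
    exact tendsto_nhds_unique h1 tendsto_const_nhds
  classical
  set good : Set Ω := {ω | ∀ q r : ℚ, q ≤ r → Y q ω ≤ Y r ω} with hgood
  have hgm : MeasurableSet good := by
    have : good = ⋂ (q : ℚ) (r : ℚ) (_ : q ≤ r), {ω | Y q ω ≤ Y r ω} := by
      ext ω; simp [hgood]
    rw [this]
    exact MeasurableSet.iInter fun q => MeasurableSet.iInter fun r => MeasurableSet.iInter fun _ =>
      measurableSet_le (hYm q) (hYm r)
  have hgae : ∀ᵐ ω ∂P, ω ∈ good := by
    have : ∀ᵐ ω ∂P, ∀ q r : ℚ, q ≤ r → Y q ω ≤ Y r ω := by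
      rw [ae_all_iff]; intro q
      rw [ae_all_iff]; intro r
      by_cases hqr : q ≤ r
      · filter_upwards [hmono q r (by exact_mod_cast hqr)] with ω hω _ using hω
      · exact ae_of_all _ fun ω h => absurd h hqr
    exact this
  -- On the exceptional null set the identity is used instead, so that the measure is Lebesgue there
  -- and locally finite for every `ω`.
  set Y' : Ω → ℚ → ℝ := fun ω q => if ω ∈ good then Y q ω else q with hY'
  have hY'm : ∀ q, Measurable fun ω => Y' ω q := fun q =>
    Measurable.ite hgm (hYm q) measurable_const
  have hY'mono : ∀ ω, Monotone (Y' ω) := by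
    intro ω q r hqr
    simp only [hY']
    split_ifs with h
    · exact h q r hqr
    · exact_mod_cast hqr
  set F : Ω → StieltjesFunction ℝ := fun ω => ratStieltjes (Y' ω) (hY'mono ω) with hF
  have hFm : ∀ x, Measurable fun ω => F ω x := by
    intro x
    simp only [hF, ratStieltjes_apply]
    exact Measurable.iInf fun q => hY'm q
  -- `F x` lies between `Y x` and `Y q` for rational `q > x`, and the mean of `Y q - Y x` is `q -
  -- x`. The nonnegative variable `F x - Y x` thus has mean zero.
  have hFY : ∀ x, ∀ᵐ ω ∂P, F ω x = Y x ω := by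
    intro x
    have hge : ∀ᵐ ω ∂P, Y x ω ≤ F ω x := by
      have : ∀ᵐ ω ∂P, ∀ q : ℚ, x < q → Y x ω ≤ Y q ω := by
        rw [ae_all_iff]; intro q
        by_cases hq : x < q
        · filter_upwards [hmono x q hq.le] with ω hω _ using hω
        · exact ae_of_all _ fun ω h => absurd h hq
      filter_upwards [this, hgae] with ω h1 h2
      refine le_ratStieltjes _ _ fun q hq => ?_
      simp only [hY', if_pos h2]
      exact h1 q hq
    have hle : ∀ q : ℚ, x < q → ∀ᵐ ω ∂P, F ω x ≤ Y q ω := by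
      intro q hq
      filter_upwards [hgae] with ω h2
      have := ratStieltjes_le (Y' ω) (hY'mono ω) hq
      have e : Y' ω q = Y q ω := if_pos h2
      rwa [e] at this
    obtain ⟨q0, hq0⟩ := exists_rat_gt x
    have hFi : Integrable (fun ω => F ω x - Y x ω) P := by
      refine Integrable.mono' ((hYi q0).sub (hYi x))
        ((hFm x).sub (hYm x)).aestronglyMeasurable ?_
      filter_upwards [hge, hle q0 hq0] with ω h1 h2
      rw [Real.norm_eq_abs, abs_of_nonneg (by linarith)]
      simp only [Pi.sub_apply]; linarith
    have h0 : ∫ ω, (F ω x - Y x ω) ∂P = 0 := by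
      refine le_antisymm ?_ (integral_nonneg_of_ae ?_)
      · refine le_of_forall_gt_imp_ge_of_dense fun ε hε => ?_
        obtain ⟨q, hq1, hq2⟩ := exists_rat_btwn (show x < x + ε by linarith)
        calc ∫ ω, (F ω x - Y x ω) ∂P ≤ ∫ ω, (Y q ω - Y x ω) ∂P := by
              refine integral_mono_ae hFi ((hYi q).sub (hYi x)) ?_
              filter_upwards [hle q hq1] with ω h
              linarith
          _ = q - x := hmean x q hq1.le
          _ ≤ ε := by linarith
      · filter_upwards [hge] with ω h
        simp only [Pi.zero_apply]; linarith
    have := (integral_eq_zero_iff_of_nonneg_ae (by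
      filter_upwards [hge] with ω h
      simp only [Pi.zero_apply]; linarith) hFi).1 h0
    filter_upwards [this] with ω h
    simp only [Pi.zero_apply] at h
    linarith
  have hFi : ∀ x, Integrable (fun ω => F ω x) P := fun x =>
    (hYi x).congr ((hFY x).mono fun ω h => h.symm)
  have hm : LebesgueIntensity P fun ω => (F ω).measure := by
    have hmm := measurable_stieltjes_measure hFm
    refine ⟨hmm, (Measure.ext_of_Ioc volume _ fun a b hab => ?_).symm⟩
    rw [Measure.bind_apply measurableSet_Ioc hmm.aemeasurable, Real.volume_Ioc]
    simp only [StieltjesFunction.measure_Ioc]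
    have hi : Integrable (fun ω => F ω b - F ω a) P := (hFi b).sub (hFi a)
    rw [← ofReal_integral_eq_lintegral_ofReal hi
      (ae_of_all _ fun ω => sub_nonneg.2 ((F ω).mono hab.le)), ← hmean a b hab.le]
    congr 1
    refine integral_congr_ae ?_
    filter_upwards [hFY a, hFY b] with ω h1 h2
    rw [h1, h2]
  refine ⟨fun ω => (F ω).measure, hm, fun ω => inferInstance, fun g hg =>
    massTendsto_of_Ioc hN hm (fun a b hab => ?_) hg⟩
  refine (hdiff a b).congr fun N => eLpNorm_congr_ae ?_
  filter_upwards [(hN N).ae_integral_signedStep_sub hab.le, hFY a, hFY b] with ω h1 h2 h3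
  simp only [Pi.sub_apply, hV]
  rw [h1, integral_indicator_const (μ := (F ω).measure) _ measurableSet_Ioc, Measure.real,
    StieltjesFunction.measure_Ioc, ENNReal.toReal_ofReal (sub_nonneg.2 ((F ω).mono hab.le)), h2, h3]
  simp

end limit

end RandMult

/-! ### Convergence of the truncated measures at `δ = 0` and the `L²` rate -/

namespace RandMult

variable {Ω : Type*} [MeasurableSpace Ω]

lemma lebesgueIntensity_withDensity {P : Measure Ω} [IsProbabilityMeasure P] {D : ℝ → Ω → ℝ}
    (hDm : Measurable fun z : ℝ × Ω => D z.1 z.2) (hD0 : ∀ s ω, 0 ≤ D s ω)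
    (hDi : ∀ s, Integrable (D s) P) (hD1 : ∀ s, ∫ ω, D s ω ∂P = 1) :
    LebesgueIntensity P fun ω => volume.withDensity fun s => ENNReal.ofReal (D s ω) := by
  have hDm' : Measurable fun z : Ω × ℝ => ENNReal.ofReal (D z.2 z.1) :=
    (Measurable.comp (g := fun z : ℝ × Ω => D z.1 z.2) hDm measurable_swap).ennreal_ofReal
  have hm : Measurable fun ω => volume.withDensity fun s => ENNReal.ofReal (D s ω) := by
    refine Measure.measurable_of_measurable_coe _ fun B hB => ?_
    simp_rw [withDensity_apply _ hB]
    exact hDm'.lintegral_prod_right'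
  refine ⟨hm, ?_⟩
  ext B hB
  rw [Measure.bind_apply hB hm.aemeasurable]
  simp_rw [withDensity_apply _ hB]
  rw [lintegral_lintegral_swap hDm'.aemeasurable]
  have : ∀ s, ∫⁻ ω, ENNReal.ofReal (D s ω) ∂P = 1 := fun s => by
    rw [← ofReal_integral_eq_lintegral_ofReal (hDi s) (ae_of_all _ (hD0 s)), hD1,
      ENNReal.ofReal_one]
  simp_rw [this]
  simp

lemma integral_withDensity_ofReal {D : ℝ → ℝ} (hDm : Measurable D) (hD0 : ∀ s, 0 ≤ D s)
    (g : ℝ → ℝ) :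
    ∫ s, g s ∂(volume.withDensity fun s => ENNReal.ofReal (D s)) = ∫ s, g s * D s := by
  rw [integral_withDensity_eq_integral_toReal_smul hDm.ennreal_ofReal
    (ae_of_all _ fun s => ENNReal.ofReal_lt_top)]
  refine integral_congr_ae (ae_of_all _ fun s => ?_)
  simp only [ENNReal.toReal_ofReal (hD0 s), smul_eq_mul, mul_comm]

/-- The random measure with density `dens`. -/
def densMeasure (c : ℕ → ℝ) (e : ℕ → Ω → ℝ) (S : Finset ℕ) (ω : Ω) : Measure ℝ :=
  volume.withDensity fun s => ENNReal.ofReal (dens c e S s ω)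

section

variable {P : Measure Ω} [IsProbabilityMeasure P] {e : ℕ → Ω → ℝ} {c : ℕ → ℝ} {R B : ℝ}
  {g : ℝ → ℝ}

omit [MeasurableSpace Ω] in
lemma measurable_dens_left (c : ℕ → ℝ) (e : ℕ → Ω → ℝ) (S : Finset ℕ) (ω : Ω) :
    Measurable fun s => dens c e S s ω := by
  unfold dens; fun_prop

omit [IsProbabilityMeasure P] in
lemma measurable_dens_right (he : SignFamily P e) (c : ℕ → ℝ) (S : Finset ℕ) (s : ℝ) :
    Measurable (dens c e S s) := by
  have := fun p => he.measurable p
  unfold dens; fun_prop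

lemma memLp_dens (he : SignFamily P e) (hc : ∀ p, |c p| ≤ 1) (S : Finset ℕ) (s : ℝ)
    (q : ℝ≥0∞) : MemLp (dens c e S s) q P :=
  MemLp.of_bound (measurable_dens_right he c S s).aestronglyMeasurable (2 ^ S.card)
    (ae_of_all _ fun ω => by
      rw [Real.norm_eq_abs, abs_of_nonneg (dens_nonneg he hc S s ω)]
      exact dens_le he hc S s ω)

lemma lebesgueIntensity_densMeasure (he : SignFamily P e) (hc : ∀ p, |c p| ≤ 1) {S : Finset ℕ}
    (hS : ∀ p ∈ S, p.Prime) : LebesgueIntensity P (densMeasure c e S) :=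
  lebesgueIntensity_withDensity (measurable_dens he c S) (dens_nonneg he hc S)
    (fun s => memLp_one_iff_integrable.1 (memLp_dens he hc S s 1)) (integral_dens he c hS)

omit [IsProbabilityMeasure P] in
lemma integral_densMeasure (he : SignFamily P e) (hc : ∀ p, |c p| ≤ 1) (S : Finset ℕ)
    (g : ℝ → ℝ) (ω : Ω) : ∫ s, g s ∂(densMeasure c e S ω) = mass c e S g ω :=
  integral_withDensity_ofReal (measurable_dens_left c e S ω) (fun s => dens_nonneg he hc S s ω) g

omit [IsProbabilityMeasure P] in
lemma exists_limit_of_eLpNorm_two_cauchy {u : ℕ → Ω → ℝ} (hu : ∀ n, MemLp (u n) 2 P)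
    (hcau : ∀ η : ℝ, 0 < η → ∃ N0, ∀ N M, N0 ≤ N → N ≤ M →
      eLpNorm (u M - u N) 2 P ≤ ENNReal.ofReal η) :
    ∃ Z : Ω → ℝ, Measurable Z ∧ MemLp Z 2 P ∧
      Tendsto (fun n => eLpNorm (u n - Z) 2 P) atTop (𝓝 0) := by
  have hC : CauchySeq fun n => (hu n).toLp (u n) := by
    rw [Metric.cauchySeq_iff']
    intro ε hε
    obtain ⟨N0, hN0⟩ := hcau (ε / 2) (half_pos hε)
    refine ⟨N0, fun n hn => ?_⟩
    rw [dist_eq_norm, ← MemLp.toLp_sub, Lp.norm_toLp]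
    have := ENNReal.toReal_mono ENNReal.ofReal_ne_top (hN0 N0 n le_rfl hn)
    rw [ENNReal.toReal_ofReal (half_pos hε).le] at this
    linarith
  obtain ⟨z, hz⟩ := cauchySeq_tendsto_of_complete hC
  have hzm := Lp.aestronglyMeasurable z
  have hZ : MemLp (hzm.mk z) 2 P := (memLp_congr_ae hzm.ae_eq_mk).1 (Lp.memLp z)
  refine ⟨hzm.mk z, hzm.stronglyMeasurable_mk.measurable, hZ, ?_⟩
  refine (Lp.tendsto_Lp_iff_tendsto_eLpNorm'' u hu (hzm.mk z) hZ).1 ?_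
  convert! hz using 2
  exact ((MemLp.toLp_eq_toLp_iff hZ (Lp.memLp z)).2 hzm.ae_eq_mk.symm).trans
    (Lp.toLp_coeFn z (Lp.memLp z))

lemma tendsto_eLpNorm_one_of_two {u : ℕ → Ω → ℝ} {Z : Ω → ℝ}
    (hu : ∀ n, AEStronglyMeasurable (u n) P) (hZ : AEStronglyMeasurable Z P)
    (h : Tendsto (fun n => eLpNorm (u n - Z) 2 P) atTop (𝓝 0)) :
    Tendsto (fun n => eLpNorm (u n - Z) 1 P) atTop (𝓝 0) :=
  tendsto_of_tendsto_of_tendsto_of_le_of_le tendsto_const_nhds h (fun n => zero_le) fun n =>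
    eLpNorm_le_eLpNorm_of_exponent_le (by norm_num) ((hu n).sub hZ)

omit [IsProbabilityMeasure P] in
-- An almost surely convergent subsequence and Fatou carry `L²` bounds over to an `L¹` limit. This
-- upgrades `MassTendsto`, which is only an `L¹` statement, to the rate in `L²`.
lemma eLpNorm_two_sub_le_of_tendsto_one {u : ℕ → Ω → ℝ} {Z : Ω → ℝ}
    (hu : ∀ n, AEStronglyMeasurable (u n) P) (hZ : AEStronglyMeasurable Z P)
    (h : Tendsto (fun n => eLpNorm (u n - Z) 1 P) atTop (𝓝 0)) {N : ℕ} {C : ℝ≥0∞}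
    (hC : ∀ M, N ≤ M → eLpNorm (u M - u N) 2 P ≤ C) : eLpNorm (Z - u N) 2 P ≤ C := by
  obtain ⟨ns, hns, hae⟩ :=
    (tendstoInMeasure_of_tendsto_eLpNorm one_ne_zero hu hZ h).exists_seq_tendsto_ae
  refine Lp.eLpNorm_le_of_ae_tendsto (u := atTop) (f := fun k => u (ns k) - u N) ?_
    (fun k => (hu _).sub (hu _)) ?_
  · filter_upwards [hns.tendsto_atTop.eventually_ge_atTop N] with k hk using hC _ hk
  · filter_upwards [hae] with ω hω
    exact hω.sub_const _

lemma testFun_signedStep (x : ℝ) : TestFun |x| 1 (signedStep x) := by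
  refine ⟨?_, fun s => ?_, fun s hs => ?_⟩
  · exact (measurable_const.indicator measurableSet_Ioc).sub
      (measurable_const.indicator measurableSet_Ioc)
  · simp only [signedStep, Set.indicator_apply]
    split_ifs <;> norm_num
  · have h1 : s ∉ Set.Ioc 0 x := fun h => hs ⟨by linarith [h.1, abs_nonneg x], h.2.trans (le_abs_self x)⟩
    have h2 : s ∉ Set.Ioc x 0 := fun h => hs ⟨by linarith [h.1, neg_abs_le x], by linarith [h.2, abs_nonneg x]⟩
    simp [signedStep, h1, h2]

theorem exists_limit_densMeasure (he : SignFamily P e) {θ : ℝ} {f : ℕ → ℝ}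
    (h : IsAdmissible θ f) :
    ∃ m : Ω → Measure ℝ, LebesgueIntensity P m ∧ (∀ ω, IsLocallyFiniteMeasure (m ω)) ∧
      ∀ g : ℝ → ℝ, Integrable g →
        MassTendsto P (fun N => densMeasure (coef f 0) e (primesIoc 0 N)) m g := by
  have hc := abs_coef_le_one f 0
  refine exists_limit_measure
    (fun N => lebesgueIntensity_densMeasure he hc prime_of_mem_primesIoc) fun x => ?_
  have hg := testFun_signedStep x
  have hu : ∀ N, MemLp (mass (coef f 0) e (primesIoc 0 N) (signedStep x)) 2 P := fun N =>
    memLp_mass he hc _ hg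
  obtain ⟨Z, hZm, hZ, hlim⟩ := exists_limit_of_eLpNorm_two_cauchy hu fun η hη => by
    obtain ⟨N0, hN0⟩ := exists_eLpNorm_mass_sub_le he h |x| 1 hη
    exact ⟨N0, fun N M h1 h2 => hN0 _ hg 0 ⟨le_rfl, zero_le_one⟩ 0 N M (Nat.zero_le _) h1 h2⟩
  refine ⟨Z, hZm, hZ.integrable (by norm_num), ?_⟩
  simp_rw [integral_densMeasure he hc]
  exact tendsto_eLpNorm_one_of_two (fun N => (hu N).1) hZ.1 hlim

/-- The `L²` rate of convergence of masses to a limiting random measure. -/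
lemma eLpNorm_integral_sub_mass_le (he : SignFamily P e) {θ : ℝ} {f : ℕ → ℝ}
    (h : IsAdmissible θ f) (R B : ℝ) {η : ℝ} (hη : 0 < η) :
    ∃ N0 : ℕ, ∀ g, TestFun R B g → ∀ δ ∈ Set.Icc (0 : ℝ) 1, ∀ m : Ω → Measure ℝ,
      LebesgueIntensity P m →
      MassTendsto P (fun N => densMeasure (coef f δ) e (primesIoc 0 N)) m g → ∀ N, N0 ≤ N →
      eLpNorm ((fun ω => ∫ s, g s ∂(m ω)) - mass (coef f δ) e (primesIoc 0 N) g) 2 P ≤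
        ENNReal.ofReal η := by
  obtain ⟨N0, hN0⟩ := exists_eLpNorm_mass_sub_le he h R B hη
  refine ⟨N0, fun g hg δ hδ m hm hmt N hN => ?_⟩
  have hc := abs_coef_le_one f δ
  have hmt' := hmt
  simp only [MassTendsto, integral_densMeasure he hc] at hmt'
  exact eLpNorm_two_sub_le_of_tendsto_one
    (u := fun N => mass (coef f δ) e (primesIoc 0 N) g)
    (fun N => (memLp_mass he hc _ hg).1) (hm.aestronglyMeasurable_integral hg.integrable) hmt'
    fun M hM => hN0 g hg δ hδ 0 N M (Nat.zero_le _) hN hM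

omit [IsProbabilityMeasure P] in
lemma memLp_of_eLpNorm_sub_lt_top {X Y : Ω → ℝ} (hX : MemLp X 2 P)
    (hY : AEStronglyMeasurable Y P) (h : eLpNorm (Y - X) 2 P < ∞) : MemLp Y 2 P := by
  have : MemLp (Y - X) 2 P := ⟨hY.sub hX.1, h⟩
  simpa using this.add hX

omit [IsProbabilityMeasure P] in
lemma measure_abs_ge_le {Y : Ω → ℝ} (hY : AEStronglyMeasurable Y P) {r : ℝ} (hr : 0 < r) :
    P {ω | r ≤ |Y ω|} ≤ eLpNorm Y 1 P / ENNReal.ofReal r := by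
  rw [eLpNorm_one_eq_lintegral_enorm]
  refine le_trans (measure_mono fun ω hω => ?_)
    (meas_ge_le_lintegral_div hY.enorm (ENNReal.ofReal_pos.2 hr).ne' ENNReal.ofReal_ne_top)
  have h1 : r ≤ |Y ω| := hω
  change ENNReal.ofReal r ≤ ‖Y ω‖ₑ
  rw [← ofReal_norm, Real.norm_eq_abs]
  exact ENNReal.ofReal_le_ofReal h1

/-! ### Full support of the limiting measure -/

/-- Deterministic lower bound for `dens`. -/
def densLower (c : ℕ → ℝ) (S : Finset ℕ) (s : ℝ) : ℝ :=
  ∏ p ∈ S, (1 - |c p * Real.cos (s * Real.log p)|)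

omit [IsProbabilityMeasure P] in
lemma densLower_le (he : SignFamily P e) (hc : ∀ p, |c p| ≤ 1) (S : Finset ℕ) (s : ℝ) (ω : Ω) :
    densLower c S s ≤ dens c e S s ω := by
  refine Finset.prod_le_prod (fun p _ => ?_) fun p _ => ?_
  · linarith [abs_coef_mul_cos_le hc p (s * Real.log p)]
  · have h1 : |c p * Real.cos (s * Real.log p) * e p ω| = |c p * Real.cos (s * Real.log p)| := by
      rw [abs_mul, he.abs_eq_one, mul_one]
    linarith [neg_abs_le (c p * Real.cos (s * Real.log p) * e p ω)]

lemma measurable_densLower (c : ℕ → ℝ) (S : Finset ℕ) : Measurable (densLower c S) := by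
  unfold densLower
  refine Finset.measurable_fun_prod _ fun p _ => ?_
  exact measurable_const.sub (Measurable.abs (by fun_prop))

/-- Since `|c p| = 1` is possible, a factor can vanish where `|cos (s log p)| = 1`; this happens
only on a countable set of `s`. -/
lemma ae_densLower_pos (hc : ∀ p, |c p| ≤ 1) {S : Finset ℕ} (hS : ∀ p ∈ S, p.Prime) :
    ∀ᵐ s, 0 < densLower c S s := by
  have h1 : ∀ p ∈ S, ∀ᵐ s : ℝ, |Real.cos (s * Real.log p)| < 1 := by
    intro p hp
    have hl : Real.log p ≠ 0 := (Real.log_pos (by exact_mod_cast (hS p hp).one_lt)).ne'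
    have hcount : (Set.range fun n : ℤ => (n : ℝ) * Real.pi / Real.log p).Countable :=
      Set.countable_range _
    filter_upwards [hcount.ae_notMem volume] with s hs
    refine (sq_lt_one_iff_abs_lt_one _).1 ?_
    have hsin : Real.sin (s * Real.log p) ≠ 0 := by
      intro h0
      obtain ⟨n, hn⟩ := Real.sin_eq_zero_iff.1 h0
      exact hs ⟨n, by simp only; rw [hn]; field_simp⟩
    have := Real.sin_sq_add_cos_sq (s * Real.log p)
    have := pow_pos (abs_pos.2 hsin) 2
    rw [sq_abs] at this
    nlinarith
  have h2 : ∀ᵐ s : ℝ, ∀ p ∈ S, |Real.cos (s * Real.log p)| < 1 :=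
    (ae_ball_iff S.countable_toSet).2 h1
  filter_upwards [h2] with s hs
  refine Finset.prod_pos fun p hp => ?_
  rw [abs_mul]
  have := hs p hp
  nlinarith [hc p, abs_nonneg (c p), abs_nonneg (Real.cos (s * Real.log p))]

omit [MeasurableSpace Ω] in
lemma dens_primesIoc_mul (c : ℕ → ℝ) (e : ℕ → Ω → ℝ) {L N M : ℕ} (h1 : L ≤ N) (h2 : N ≤ M)
    (s : ℝ) (ω : Ω) : dens c e (primesIoc L M) s ω =
      dens c e (primesIoc L N) s ω * dens c e (primesIoc N M) s ω := by
  simp only [dens, primesIoc, Finset.prod_filter]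
  exact (Finset.prod_Ioc_consecutive _ h1 h2).symm

lemma exists_densLower_ge (hc : ∀ p, |c p| ≤ 1) {S : Finset ℕ} (hS : ∀ p ∈ S, p.Prime)
    {a b : ℝ} (hab : a < b) :
    ∃ κ : ℝ, 0 < κ ∧ (b - a) / 2 ≤ volume.real (Set.Ioo a b ∩ {s | κ ≤ densLower c S s}) := by
  set T : ℕ → Set ℝ := fun n => Set.Ioo a b ∩ {s | 1 / ((n : ℝ) + 1) ≤ densLower c S s} with hT
  have hmono : Monotone T := by
    intro i j hij s hs
    have h1 : 1 / ((j : ℝ) + 1) ≤ 1 / ((i : ℝ) + 1) :=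
      one_div_le_one_div_of_le (by positivity) (by gcongr)
    have h2 : 1 / ((i : ℝ) + 1) ≤ densLower c S s := hs.2
    exact Set.mem_inter hs.1 (h1.trans h2)
  have hU : volume (⋃ n, T n) = volume (Set.Ioo a b) := by
    refine measure_congr ?_
    filter_upwards [ae_densLower_pos hc hS] with s hs
    refine propext ⟨fun h => ?_, fun h => ?_⟩
    · obtain ⟨n, hn⟩ := Set.mem_iUnion.1 h
      exact hn.1
    · obtain ⟨n, hn⟩ := exists_nat_one_div_lt hs
      exact Set.mem_iUnion.2 ⟨n, Set.mem_inter h hn.le⟩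
  have hlim := tendsto_measure_iUnion_atTop (μ := volume) hmono
  rw [hU, Real.volume_Ioo] at hlim
  have hlt : ENNReal.ofReal ((b - a) / 2) < ENNReal.ofReal (b - a) :=
    (ENNReal.ofReal_lt_ofReal_iff (by linarith)).2 (by linarith)
  obtain ⟨n, hn⟩ := (hlim.eventually (lt_mem_nhds hlt)).exists
  refine ⟨1 / ((n : ℝ) + 1), by positivity, ?_⟩
  have hfin : volume (T n) ≠ ∞ :=
    ((measure_mono Set.inter_subset_left).trans_lt (by simp : volume (Set.Ioo a b) < ∞)).ne
  have := ENNReal.toReal_mono hfin hn.le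
  rwa [ENNReal.toReal_ofReal (by linarith)] at this

/-- The product up to `N` is at least `κ` on a set `A` of at least half the length of the interval,
whatever the signs. The product over `(N, M]` has on `A` a mass close to `|A|` in `L²`. So the mass
of the interval stays above `κ |A| / 2` outside an event of probability `ε`, uniformly in `M`, and
letting `M` grow transfers this to the limit. -/
lemma ae_integral_indicator_Ioo_ne_zero (he : SignFamily P e) {θ : ℝ} {f : ℕ → ℝ}
    (h : IsAdmissible θ f) {m : Ω → Measure ℝ} (hm : LebesgueIntensity P m)
    (hlim : ∀ g : ℝ → ℝ, Integrable g →
        MassTendsto P (fun N => densMeasure (coef f 0) e (primesIoc 0 N)) m g)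
    {a b : ℝ} (hab : a < b) :
    ∀ᵐ ω ∂P, ∫ s, (Set.Ioo a b).indicator (fun _ => (1 : ℝ)) s ∂(m ω) ≠ 0 := by
  have hc := abs_coef_le_one f 0
  set g := (Set.Ioo a b).indicator fun _ => (1 : ℝ) with hg
  have hgi : Integrable g := integrable_indicator_one measurableSet_Ioo (by simp)
  have hl := hlim g hgi
  simp only [MassTendsto, integral_densMeasure he hc] at hl
  set W : Ω → ℝ := fun ω => ∫ s, g s ∂(m ω) with hW
  have hWm : AEStronglyMeasurable W P := hm.aestronglyMeasurable_integral hgi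
  have hba : 0 < b - a := sub_pos.2 hab
  have key : ∀ ε : ℝ, 0 < ε → P {ω | W ω = 0} ≤ ENNReal.ofReal (2 * ε) := by
    intro ε hε
    -- `N` is fixed before `κ` and `A`, which depend on it; the estimate is uniform over all test
    -- functions with this support and bound. The factor `(b - a)/4` is a lower bound for `v/2`, so
    -- Markov's inequality leaves `ε`.
    obtain ⟨N, hN⟩ := exists_eLpNorm_mass_sub_le he h (|a| + |b|) 1
      (by positivity : 0 < ε * ((b - a) / 4))
    obtain ⟨κ, hκ, hκ'⟩ := exists_densLower_ge hc (S := primesIoc 0 N) prime_of_mem_primesIoc hab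
    set A := Set.Ioo a b ∩ {s | κ ≤ densLower (coef f 0) (primesIoc 0 N) s} with hA
    have hAm : MeasurableSet A :=
      measurableSet_Ioo.inter (measurableSet_le measurable_const (measurable_densLower _ _))
    set k := A.indicator fun _ => (1 : ℝ) with hk
    have hkT : TestFun (|a| + |b|) 1 k := by
      refine ⟨measurable_const.indicator hAm, fun s => ?_, fun s hs => ?_⟩
      · by_cases h : s ∈ A <;> simp [hk, h]
      · refine Set.indicator_of_notMem (fun h => hs ?_) _
        constructor <;>
          linarith [h.1.1, h.1.2, neg_abs_le a, le_abs_self b, abs_nonneg a, abs_nonneg b]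
    set v := volume.real A with hv
    have hv0 : (b - a) / 2 ≤ v := hκ'
    have hU : ∀ M, N ≤ M → P {ω | mass (coef f 0) e (primesIoc N M) k ω < v / 2} ≤
        ENNReal.ofReal ε := by
      intro M hM
      -- Taking `L = N` compares with the empty product, whose mass is the deterministic number `v`.
      have h1 := hN k hkT 0 ⟨le_rfl, zero_le_one⟩ N N M le_rfl le_rfl hM
      have h2 : mass (coef f 0) e (primesIoc N N) k = fun _ => v := by
        funext ω
        have : primesIoc N N = ∅ := by simp [primesIoc]
        simp only [mass, dens, this, Finset.prod_empty, mul_one, hk, hv]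
        rw [integral_indicator_const _ hAm]; simp
      rw [h2] at h1
      have h3 : MemLp (mass (coef f 0) e (primesIoc N M) k - fun _ => v) 2 P :=
        (memLp_mass he hc _ hkT).sub (memLp_const v)
      have h4 := measure_abs_ge_le h3.1 (by linarith : 0 < v / 2)
      refine le_trans (measure_mono fun ω hω => ?_) (h4.trans ?_)
      · have hω' : mass (coef f 0) e (primesIoc N M) k ω < v / 2 := hω
        change v / 2 ≤ |mass (coef f 0) e (primesIoc N M) k ω - v|
        rw [abs_of_nonpos (by linarith)]
        linarith
      · rw [ENNReal.div_le_iff (ENNReal.ofReal_pos.2 (by linarith)).ne' ENNReal.ofReal_ne_top,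
          ← ENNReal.ofReal_mul hε.le]
        refine (eLpNorm_le_eLpNorm_of_exponent_le (by norm_num) h3.1).trans (h1.trans ?_)
        apply ENNReal.ofReal_le_ofReal
        exact mul_le_mul_of_nonneg_left (by linarith) hε.le
    have hcomp : ∀ M, N ≤ M → ∀ ω, κ * mass (coef f 0) e (primesIoc N M) k ω ≤
        mass (coef f 0) e (primesIoc 0 M) g ω := by
      intro M hM ω
      rw [mass, ← integral_const_mul]
      refine integral_mono ((integrable_mul_dens he hc _ hkT.integrable ω).const_mul κ)
        (integrable_mul_dens he hc _ hgi ω) fun s => ?_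
      have d1 := dens_nonneg he hc (primesIoc N M) s ω
      have d2 := dens_nonneg he hc (primesIoc 0 M) s ω
      by_cases hs : s ∈ A
      · have e1 : k s = 1 := Set.indicator_of_mem hs _
        have e2 : g s = 1 := Set.indicator_of_mem hs.1 _
        simp only [e1, e2, one_mul]
        rw [dens_primesIoc_mul _ _ (Nat.zero_le N) hM]
        exact mul_le_mul_of_nonneg_right (hs.2.trans (densLower_le he hc _ s ω)) d1
      · have e1 : k s = 0 := Set.indicator_of_notMem hs _
        have e2 : 0 ≤ g s := Set.indicator_nonneg (fun _ _ => zero_le_one) s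
        simp only [e1, zero_mul, mul_zero]
        exact mul_nonneg e2 d2
    have hr : 0 < κ * (v / 2) := mul_pos hκ (by linarith)
    -- If the limiting mass vanishes although the truncated one is at least `κ v / 2`, the two
    -- differ by that amount; Markov's inequality makes this event cost at most `ε`.
    have hsmall : ∀ᶠ M in atTop, eLpNorm (fun ω => mass (coef f 0) e (primesIoc 0 M) g ω - W ω) 1 P ≤
        ENNReal.ofReal (ε * (κ * (v / 2))) :=
      hl.eventually (ge_mem_nhds (ENNReal.ofReal_pos.2 (mul_pos hε hr)))
    obtain ⟨M, hM1, hM2⟩ := (hsmall.and (eventually_ge_atTop N)).exists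
    have hXm : AEStronglyMeasurable (fun ω => mass (coef f 0) e (primesIoc 0 M) g ω - W ω) P :=
      ((measurable_mass he _ _
        (measurable_const.indicator measurableSet_Ioo)).aestronglyMeasurable).sub hWm
    have h5 := measure_abs_ge_le hXm hr
    calc P {ω | W ω = 0} ≤ P ({ω | mass (coef f 0) e (primesIoc N M) k ω < v / 2} ∪
          {ω | κ * (v / 2) ≤ |mass (coef f 0) e (primesIoc 0 M) g ω - W ω|}) := by
          refine measure_mono fun ω hω => ?_
          have hω' : W ω = 0 := hω
          by_cases h6 : mass (coef f 0) e (primesIoc N M) k ω < v / 2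
          · exact Or.inl h6
          · refine Or.inr ?_
            change κ * (v / 2) ≤ |mass (coef f 0) e (primesIoc 0 M) g ω - W ω|
            rw [hω', sub_zero]
            refine le_trans ?_ ((hcomp M hM2 ω).trans (le_abs_self _))
            exact mul_le_mul_of_nonneg_left (not_lt.1 h6) hκ.le
      _ ≤ ENNReal.ofReal ε + ENNReal.ofReal ε := by
          refine (measure_union_le _ _).trans (add_le_add (hU M hM2) (h5.trans ?_))
          rw [ENNReal.div_le_iff (ENNReal.ofReal_pos.2 hr).ne' ENNReal.ofReal_ne_top,
            ← ENNReal.ofReal_mul hε.le]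
          exact hM1
      _ = ENNReal.ofReal (2 * ε) := by
          rw [← ENNReal.ofReal_add hε.le hε.le]; ring_nf
  have hzero : P {ω | W ω = 0} = 0 := by
    refine le_antisymm (ENNReal.le_of_forall_pos_le_add fun ε hε _ => ?_) zero_le
    have hε' : (0 : ℝ) < ε := by exact_mod_cast hε
    have := key (ε / 2) (half_pos hε')
    rw [mul_div_cancel₀ _ two_ne_zero, ENNReal.ofReal_coe_nnreal] at this
    simpa using this
  exact measure_eq_zero_iff_ae_notMem.1 hzero

theorem ae_support_eq_univ (he : SignFamily P e) {θ : ℝ} {f : ℕ → ℝ}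
    (h : IsAdmissible θ f) {m : Ω → Measure ℝ} (hm : LebesgueIntensity P m)
    (hlim : ∀ g : ℝ → ℝ, Integrable g →
        MassTendsto P (fun N => densMeasure (coef f 0) e (primesIoc 0 N)) m g) :
    ∀ᵐ ω ∂P, (m ω).support = Set.univ := by
  have hall : ∀ᵐ ω ∂P, ∀ a b : ℚ, a < b →
      ∫ s, (Set.Ioo (a : ℝ) b).indicator (fun _ => (1 : ℝ)) s ∂(m ω) ≠ 0 := by
    rw [ae_all_iff]; intro a
    rw [ae_all_iff]; intro b
    by_cases hab : a < b
    · filter_upwards [ae_integral_indicator_Ioo_ne_zero he h hm hlim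
        (show (a : ℝ) < b by exact_mod_cast hab)] with ω hω _ using hω
    · exact ae_of_all _ fun ω h => absurd h hab
  filter_upwards [hall] with ω hω
  rw [Set.eq_univ_iff_forall]
  intro x
  rw [Measure.mem_support_iff_forall]
  intro U hU
  obtain ⟨l, u, hx, hlu⟩ := mem_nhds_iff_exists_Ioo_subset.1 hU
  obtain ⟨a, ha1, ha2⟩ := exists_rat_btwn hx.1
  obtain ⟨b, hb1, hb2⟩ := exists_rat_btwn hx.2
  have hne := hω a b (by exact_mod_cast ha2.trans hb1)
  have hsub : Set.Ioo (a : ℝ) b ⊆ U := (Set.Ioo_subset_Ioo ha1.le hb2.le).trans hlu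
  refine lt_of_lt_of_le ?_ (measure_mono hsub)
  rw [pos_iff_ne_zero]
  intro h0
  apply hne
  rw [integral_indicator_const _ measurableSet_Ioo, Measure.real, h0]
  simp

end

end RandMult

/-! ### Martingale convergence for transforms of the signs -/

namespace RandMult

variable {Ω : Type*} [MeasurableSpace Ω] {P : Measure Ω} {e : ℕ → Ω → ℝ}

/-- The filtration generated by the signs at the primes up to `N`. -/
def SignFamily.filtration (he : SignFamily P e) : Filtration ℕ (‹MeasurableSpace Ω›) where
  seq N := ⨆ p ∈ {p : Nat.Primes | (p : ℕ) ≤ N}, MeasurableSpace.comap (e p) inferInstance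
  mono' _ _ h := biSup_mono fun _ hp => le_trans hp h
  le' _ := iSup₂_le fun p _ => (he.measurable p).comap_le

lemma SignFamily.measurable_filtration (he : SignFamily P e) {p N : ℕ} (hp : p.Prime)
    (h : p ≤ N) : Measurable[he.filtration N] (e p) := by
  have h1 : MeasurableSpace.comap (e p) inferInstance ≤ he.filtration N :=
    le_iSup₂_of_le (f := fun (p : Nat.Primes) (_ : p ∈ {p : Nat.Primes | (p : ℕ) ≤ N}) =>
      MeasurableSpace.comap (e p) inferInstance) ⟨p, hp⟩ h le_rfl
  exact (comap_measurable (e p)).mono h1 le_rfl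

variable [IsProbabilityMeasure P]

lemma SignFamily.condExp_succ (he : SignFamily P e) {N : ℕ} (hN : (N + 1).Prime) :
    P[e (N + 1) | he.filtration N] =ᵐ[P] 0 := by
  have hind : Indep (MeasurableSpace.comap (e (N + 1)) inferInstance) (he.filtration N) P := by
    have h1 := indep_iSup_of_disjoint (m := fun p : Nat.Primes =>
      MeasurableSpace.comap (e p) inferInstance) (fun p => (he.measurable p).comap_le) he.indep
      (S := {p : Nat.Primes | (p : ℕ) = N + 1}) (T := {p : Nat.Primes | (p : ℕ) ≤ N}) (by
        rw [Set.disjoint_left]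
        intro p h1 h2
        have h1' : (p : ℕ) = N + 1 := h1
        have h2' : (p : ℕ) ≤ N := h2
        omega)
    refine indep_of_indep_of_le_left h1 ?_
    exact le_iSup₂_of_le (f := fun (p : Nat.Primes) (_ : p ∈ {p : Nat.Primes | (p : ℕ) = N + 1}) =>
      MeasurableSpace.comap (e p) inferInstance) ⟨N + 1, hN⟩ rfl le_rfl
  refine (condExp_indep_eq (he.measurable (N + 1)).comap_le (he.filtration.le N)
    (comap_measurable (e (N + 1))).stronglyMeasurable hind).trans ?_
  rw [he.mean_zero _ hN]
  rfl

/-- Convergence of bounded transforms of the signs that are bounded in `L²`. -/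
lemma SignFamily.ae_exists_tendsto (he : SignFamily P e) {X Y : ℕ → Ω → ℝ}
    (hX : ∀ N, Measurable[he.filtration N] (X N)) (hY : ∀ N, Measurable[he.filtration N] (Y N))
    (hXb : ∀ N, ∃ C, ∀ ω, |X N ω| ≤ C) (hYb : ∀ N, ∃ C, ∀ ω, |Y N ω| ≤ C)
    (hrec : ∀ N ω, X (N + 1) ω = X N ω + if (N + 1).Prime then Y N ω * e (N + 1) ω else 0)
    {C : ℝ} (hC : ∀ N, ∫ ω, X N ω ^ 2 ∂P ≤ C ^ 2) (hC0 : 0 ≤ C) :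
    ∀ᵐ ω ∂P, ∃ x, Tendsto (fun N => X N ω) atTop (𝓝 x) := by
  have hXm : ∀ N, MemLp (X N) 2 P := fun N => by
    obtain ⟨B, hB⟩ := hXb N
    exact MemLp.of_bound ((hX N).mono (he.filtration.le N) le_rfl).aestronglyMeasurable B
      (ae_of_all _ hB)
  have hXi : ∀ N, Integrable (X N) P := fun N => (hXm N).integrable (by norm_num)
  -- The increment is a coefficient known at time `N` times a centred sign independent of the past.
  -- At composite indices the process stands still.
  have hmart : Martingale X he.filtration P := by
    refine martingale_nat (fun N => (hX N).stronglyMeasurable) hXi fun N => ?_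
    have hself : P[X N | he.filtration N] = X N :=
      condExp_of_stronglyMeasurable (he.filtration.le N) (hX N).stronglyMeasurable (hXi N)
    by_cases hp : (N + 1).Prime
    · have hei : Integrable (e (N + 1)) P :=
        Integrable.of_bound (he.measurable _).aestronglyMeasurable 1
          (ae_of_all _ fun ω => by rw [Real.norm_eq_abs, he.abs_eq_one])
      have hYe : Integrable (Y N * e (N + 1)) P := by
        obtain ⟨B, hB⟩ := hYb N
        exact hei.bdd_mul ((hY N).mono (he.filtration.le N) le_rfl).aestronglyMeasurable
          (ae_of_all _ hB)
      have e1 : X (N + 1) = X N + Y N * e (N + 1) := by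
        funext ω; rw [hrec, if_pos hp]; rfl
      rw [e1]
      filter_upwards [condExp_add (hXi N) hYe (he.filtration N),
        condExp_mul_of_stronglyMeasurable_left (hY N).stronglyMeasurable hYe hei,
        he.condExp_succ hp] with ω h1 h2 h3
      rw [h1, Pi.add_apply, h2, Pi.mul_apply, h3, hself]
      simp
    · have e1 : X (N + 1) = X N := by
        funext ω; rw [hrec, if_neg hp, add_zero]
      rw [e1, hself]
  refine hmart.submartingale.exists_ae_tendsto_of_bdd (R := C.toNNReal) fun N => ?_
  exact (eLpNorm_le_eLpNorm_of_exponent_le (by norm_num) (hXm N).1).trans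
    (eLpNorm_two_le hC0 (hXm N) (hC N))

/-! ### Euler products: modulus, normalisation and almost sure convergence -/

/-- The normalisation `E|A_S(z)|²` on the line `Re z = (1+δ)/2`. -/
def normalizer (f : ℕ → ℝ) (δ : ℝ) (S : Finset ℕ) : ℝ := ∏ p ∈ S, (1 + amp f δ p ^ 2)

lemma normalizer_pos (f : ℕ → ℝ) (δ : ℝ) (S : Finset ℕ) : 0 < normalizer f δ S :=
  Finset.prod_pos fun p _ => by positivity

lemma ofReal_div_natCast_cpow (x δ s : ℝ) {p : ℕ} (hp : p.Prime) :
    (x : ℂ) / (p : ℂ) ^ vert ((1 + δ) / 2) s =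
      ((x * Real.exp (-((1 + δ) / 2) * Real.log p) : ℝ) : ℂ) *
        Complex.exp ((-(s * Real.log p) : ℝ) * Complex.I) := by
  have hp0 : (p : ℂ) ≠ 0 := by exact_mod_cast hp.ne_zero
  rw [Complex.cpow_def_of_ne_zero hp0, div_eq_mul_inv, ← Complex.exp_neg, Complex.ofReal_mul,
    mul_assoc, Complex.ofReal_exp, ← Complex.exp_add, ← Complex.natCast_log, vert]
  congr 2
  push_cast; ring

lemma norm_sq_one_add_mul_exp (r φ : ℝ) :
    ‖1 + (r : ℂ) * Complex.exp ((φ : ℝ) * Complex.I)‖ ^ 2 = 1 + r ^ 2 + 2 * r * Real.cos φ := by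
  rw [Complex.sq_norm, Complex.normSq_apply, Complex.exp_mul_I, ← Complex.ofReal_cos,
    ← Complex.ofReal_sin]
  simp only [Complex.add_re, Complex.add_im, Complex.mul_re, Complex.mul_im, Complex.ofReal_re,
    Complex.ofReal_im, Complex.one_re, Complex.one_im, Complex.I_re, Complex.I_im]
  linear_combination r ^ 2 * Real.sin_sq_add_cos_sq φ

omit [IsProbabilityMeasure P] in
-- Since the sign squares to 1, each factor has squared modulus `1 + a² + 2 a e cos(s log p) = (1 +
-- a²)(1 + c e cos(s log p))`. The identity holds for every `ω`, because the signs are `±1`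
-- everywhere.
lemma norm_eulerProd_sq (he : SignFamily P e) (f : ℕ → ℝ) (δ y : ℝ) (ω : Ω) (s : ℝ) :
    ‖eulerProd f e y ω (vert ((1 + δ) / 2) s)‖ ^ 2 =
      normalizer f δ (primesIoc 0 ⌊y⌋₊) * dens (coef f δ) e (primesIoc 0 ⌊y⌋₊) s ω := by
  rw [eulerProd, primesLE_eq_primesIoc, norm_prod, ← Finset.prod_pow, normalizer, dens,
    ← Finset.prod_mul_distrib]
  refine Finset.prod_congr rfl fun p hp => ?_
  rw [ofReal_div_natCast_cpow _ _ _ (prime_of_mem_primesIoc p hp), norm_sq_one_add_mul_exp,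
    Real.cos_neg, coef]
  have h1 : e p ω * f p * Real.exp (-((1 + δ) / 2) * Real.log p) = e p ω * amp f δ p := by
    rw [amp]; ring
  have h2 : e p ω ^ 2 = 1 := by rw [← sq_abs, he.abs_eq_one, one_pow]
  rw [h1, mul_pow, h2]
  have : 0 < 1 + amp f δ p ^ 2 := by positivity
  field_simp

lemma integral_norm_eulerProd_sq (he : SignFamily P e) (f : ℕ → ℝ) (δ y s : ℝ) :
    ∫ ω, ‖eulerProd f e y ω (vert ((1 + δ) / 2) s)‖ ^ 2 ∂P =
      normalizer f δ (primesIoc 0 ⌊y⌋₊) := by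
  simp_rw [norm_eulerProd_sq he]
  rw [integral_const_mul, integral_dens he _ prime_of_mem_primesIoc, mul_one]

lemma measY_eq_densMeasure (he : SignFamily P e) (f : ℕ → ℝ) (y : ℝ) (ω : Ω) :
    measY P f e y ω = densMeasure (coef f 0) e (primesIoc 0 ⌊y⌋₊) ω := by
  have h0 : (1 / 2 : ℝ) = (1 + 0) / 2 := by norm_num
  rw [measY, normSqMeasure, densMeasure, h0]
  congr 1
  funext s
  rw [integral_norm_eulerProd_sq he, norm_eulerProd_sq he,
    mul_div_cancel_left₀ _ (normalizer_pos _ _ _).ne']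

omit [MeasurableSpace Ω] in
lemma eulerProd_succ (f : ℕ → ℝ) (e : ℕ → Ω → ℝ) (N : ℕ) (ω : Ω) (z : ℂ) :
    eulerProd f e (N + 1 : ℕ) ω z = eulerProd f e N ω z * (if (N + 1).Prime then
      1 + ((e (N + 1) ω * f (N + 1) : ℝ) : ℂ) / ((N + 1 : ℕ) : ℂ) ^ z else 1) := by
  simp only [eulerProd, Nat.floor_natCast, primesLE_eq_primesIoc, primesIoc, Finset.prod_filter]
  rw [Finset.prod_Ioc_succ_top (Nat.zero_le N)]

lemma IsAdmissible.summable_amp_sq {θ : ℝ} {f : ℕ → ℝ} (h : IsAdmissible θ f) {δ : ℝ}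
    (hδ : 0 < δ) : Summable fun n : ℕ => if n.Prime then amp f δ n ^ 2 else 0 := by
  refine (h.classP.summable_exp_mul (fun n => sq_nonneg (f n)) h.pos hδ).congr fun n => ?_
  split_ifs
  · rw [amp_sq, mul_comm]
  · rw [mul_zero]

/-- The total variance `∑ f(p)² p^{-1-δ}`. -/
def ampTotal (f : ℕ → ℝ) (δ : ℝ) : ℝ := ∑' n : ℕ, if n.Prime then amp f δ n ^ 2 else 0

lemma ite_amp_nonneg (f : ℕ → ℝ) (δ : ℝ) (n : ℕ) :
    0 ≤ if n.Prime then amp f δ n ^ 2 else 0 := by positivity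

lemma IsAdmissible.sum_amp_sq_le {θ : ℝ} {f : ℕ → ℝ} (h : IsAdmissible θ f) {δ : ℝ}
    (hδ : 0 < δ) (L M : ℕ) : ∑ p ∈ primesIoc L M, amp f δ p ^ 2 ≤ ampTotal f δ := by
  rw [primesIoc, Finset.sum_filter]
  exact (h.summable_amp_sq hδ).sum_le_tsum _ fun n _ => ite_amp_nonneg f δ n

lemma IsAdmissible.eventually_sum_amp_sq_le {θ : ℝ} {f : ℕ → ℝ} (h : IsAdmissible θ f) {δ : ℝ}
    (hδ : 0 < δ) {ε : ℝ} (hε : 0 < ε) :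
    ∀ᶠ N in atTop, ∀ M, ∑ p ∈ primesIoc N M, amp f δ p ^ 2 ≤ ε := by
  obtain ⟨s, hs⟩ := summable_iff_vanishing_norm.1 (h.summable_amp_sq hδ) ε hε
  filter_upwards [eventually_ge_atTop (s.sup id)] with N hN M
  have := hs (Finset.Ioc N M) ?_
  · rw [primesIoc, Finset.sum_filter]
    exact (Real.le_norm_self _).trans this.le
  · rw [Finset.disjoint_left]
    intro a ha has
    have h1 := (Finset.mem_Ioc.1 ha).1
    have h2 : a ≤ s.sup id := Finset.le_sup (f := id) has
    omega

lemma IsAdmissible.normalizer_le {θ : ℝ} {f : ℕ → ℝ} (h : IsAdmissible θ f) {δ : ℝ}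
    (hδ : 0 < δ) (N : ℕ) : normalizer f δ (primesIoc 0 N) ≤ Real.exp (ampTotal f δ) := by
  refine le_trans ?_ (Real.exp_le_exp.2 (h.sum_amp_sq_le hδ 0 N))
  rw [normalizer, Real.exp_sum]
  refine Finset.prod_le_prod (fun p _ => by positivity) fun p _ => ?_
  rw [add_comm]; exact Real.add_one_le_exp _

lemma one_le_normalizer (f : ℕ → ℝ) (δ : ℝ) (S : Finset ℕ) : 1 ≤ normalizer f δ S := by
  calc (1 : ℝ) = ∏ _p ∈ S, 1 := Finset.prod_const_one.symm
    _ ≤ _ := Finset.prod_le_prod (fun _ _ => zero_le_one) fun p _ => by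
      linarith [sq_nonneg (amp f δ p)]

lemma normalizer_mono (f : ℕ → ℝ) (δ : ℝ) : Monotone fun N => normalizer f δ (primesIoc 0 N) := by
  intro N M hNM
  have : normalizer f δ (primesIoc 0 N) * normalizer f δ (primesIoc N M) =
      normalizer f δ (primesIoc 0 M) := by
    simp only [normalizer, primesIoc, Finset.prod_filter]
    exact Finset.prod_Ioc_consecutive _ (Nat.zero_le N) hNM
  simp only [← this]
  exact le_mul_of_one_le_right (normalizer_pos _ _ _).le (one_le_normalizer _ _ _)

lemma IsAdmissible.exists_tendsto_normalizer {θ : ℝ} {f : ℕ → ℝ} (h : IsAdmissible θ f) {δ : ℝ}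
    (hδ : 0 < δ) :
    ∃ Q : ℝ, 0 < Q ∧ Tendsto (fun N => normalizer f δ (primesIoc 0 N)) atTop (𝓝 Q) := by
  have hlim := tendsto_atTop_ciSup (normalizer_mono f δ)
    ⟨_, Set.forall_mem_range.2 fun N => h.normalizer_le hδ N⟩
  exact ⟨_, zero_lt_one.trans_le
    (ge_of_tendsto' hlim fun N => one_le_normalizer f δ _), hlim⟩

omit [MeasurableSpace Ω] in
lemma measurable_eulerProd_of_le {m : MeasurableSpace Ω} {N : ℕ}
    (hm : ∀ p : ℕ, p.Prime → p ≤ N → Measurable[m] (e p)) (f : ℕ → ℝ) (z : ℂ) :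
    Measurable[m] fun ω => eulerProd f e N ω z := by
  simp only [eulerProd, Nat.floor_natCast, primesLE_eq_primesIoc]
  refine Finset.measurable_fun_prod _ fun p hp => ?_
  rw [mem_primesIoc] at hp
  have := hm p hp.2 hp.1.2
  fun_prop

/-- For `δ > 0` the second moments `∏ (1 + a²)` stay bounded, so real and imaginary parts are
`L²`-bounded martingales. A general real-linear functional `L` treats both at once. -/
lemma SignFamily.ae_exists_tendsto_map_eulerProd (he : SignFamily P e) {θ : ℝ} {f : ℕ → ℝ}
    (h : IsAdmissible θ f) {δ : ℝ} (hδ : 0 < δ) (s : ℝ) (L : ℂ →L[ℝ] ℝ)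
    (hL : ∀ w, |L w| ≤ ‖w‖) :
    ∀ᵐ ω ∂P, ∃ x, Tendsto (fun N : ℕ => L (eulerProd f e N ω (vert ((1 + δ) / 2) s)))
      atTop (𝓝 x) := by
  set z := vert ((1 + δ) / 2) s with hz
  have hAm : ∀ N : ℕ, Measurable[he.filtration N] fun ω => eulerProd f e N ω z := fun N =>
    measurable_eulerProd_of_le (fun p hp hpN => he.measurable_filtration hp hpN) f z
  have hAb : ∀ N : ℕ, ∃ C, ∀ ω, ‖eulerProd f e N ω z‖ ≤ C := by
    intro N
    -- This uses `x ≤ 1 + x²` and the deterministic bound for `‖A‖²`.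
    refine ⟨1 + normalizer f δ (primesIoc 0 N) * 2 ^ (primesIoc 0 N).card, fun ω => ?_⟩
    have h1 := norm_eulerProd_sq he f δ N ω s
    rw [Nat.floor_natCast] at h1
    have h2 := mul_le_mul_of_nonneg_left
      (dens_le he (abs_coef_le_one f δ) (primesIoc 0 N) s ω) (normalizer_pos f δ (primesIoc 0 N)).le
    nlinarith [sq_nonneg (‖eulerProd f e N ω z‖ - 1)]
  refine he.ae_exists_tendsto (X := fun N ω => L (eulerProd f e N ω z))
    (Y := fun N ω => L (eulerProd f e N ω z * ((f (N + 1) : ℂ) / ((N + 1 : ℕ) : ℂ) ^ z)))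
    (C := Real.sqrt (Real.exp (ampTotal f δ)))
    (fun N => L.continuous.measurable.comp (hAm N))
    (fun N => L.continuous.measurable.comp ((hAm N).mul_const _)) (fun N => ?_) (fun N => ?_)
    (fun N ω => ?_) (fun N => ?_) (Real.sqrt_nonneg _)
  · obtain ⟨C, hC⟩ := hAb N
    exact ⟨C, fun ω => (hL _).trans (hC ω)⟩
  · obtain ⟨C, hC⟩ := hAb N
    refine ⟨C * ‖(f (N + 1) : ℂ) / ((N + 1 : ℕ) : ℂ) ^ z‖, fun ω => (hL _).trans ?_⟩
    rw [norm_mul]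
    exact mul_le_mul_of_nonneg_right (hC ω) (norm_nonneg _)
  · simp only [eulerProd_succ]
    split_ifs
    · rw [mul_add, mul_one, map_add]
      congr 1
      -- The sign is real, so it passes through the real-linear `L` and the increment takes the form
      -- of a martingale transform.
      have : eulerProd f e N ω z * (((e (N + 1) ω * f (N + 1) : ℝ) : ℂ) / ((N + 1 : ℕ) : ℂ) ^ z) =
          e (N + 1) ω • (eulerProd f e N ω z * ((f (N + 1) : ℂ) / ((N + 1 : ℕ) : ℂ) ^ z)) := by
        rw [Complex.real_smul]; push_cast; ring
      rw [this, map_smul, smul_eq_mul, mul_comm]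
    · simp
  · rw [Real.sq_sqrt (Real.exp_pos _).le]
    refine le_trans ?_ (h.normalizer_le hδ N)
    have h1 := integral_norm_eulerProd_sq he f δ N s
    rw [Nat.floor_natCast] at h1
    rw [← h1]
    obtain ⟨C, hC⟩ := hAb N
    have hm := (hAm N).mono (he.filtration.le N) le_rfl
    refine integral_mono_of_nonneg (ae_of_all _ fun ω => sq_nonneg _) ?_ (ae_of_all _ fun ω => ?_)
    · refine Integrable.of_bound (hm.norm.pow_const 2).aestronglyMeasurable (C ^ 2)
        (ae_of_all _ fun ω => ?_)
      rw [Real.norm_eq_abs, abs_of_nonneg (sq_nonneg _)]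
      exact pow_le_pow_left₀ (norm_nonneg _) (hC ω) 2
    · change L _ ^ 2 ≤ ‖_‖ ^ 2
      rw [← sq_abs]
      exact pow_le_pow_left₀ (abs_nonneg _) (hL _) 2

theorem SignFamily.ae_tendsto_eulerProd (he : SignFamily P e) {θ : ℝ} {f : ℕ → ℝ}
    (h : IsAdmissible θ f) {δ : ℝ} (hδ : 0 < δ) (s : ℝ) :
    ∀ᵐ ω ∂P, Tendsto (fun N : ℕ => eulerProd f e N ω (vert ((1 + δ) / 2) s)) atTop
      (𝓝 (eulerProdInf f e ω (vert ((1 + δ) / 2) s))) := by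
  filter_upwards [he.ae_exists_tendsto_map_eulerProd h hδ s Complex.reCLM Complex.abs_re_le_norm,
    he.ae_exists_tendsto_map_eulerProd h hδ s Complex.imCLM Complex.abs_im_le_norm] with ω h1 h2
  obtain ⟨x, hx⟩ := h1
  obtain ⟨y, hy⟩ := h2
  refine tendsto_nhds_limUnder ⟨(x : ℂ) + y * Complex.I, ?_⟩
  have h3 := ((Complex.continuous_ofReal.tendsto x).comp hx).add
    (((Complex.continuous_ofReal.tendsto y).comp hy).mul_const Complex.I)
  refine h3.congr fun N => ?_
  exact Complex.re_add_im _

end RandMult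

/-! ### The full product for `δ > 0` as the limit of truncations -/

namespace RandMult

variable {Ω : Type*} [MeasurableSpace Ω] {P : Measure Ω} [IsProbabilityMeasure P]
  {e : ℕ → Ω → ℝ} {θ δ : ℝ} {f : ℕ → ℝ}

lemma kern_self_le_exp (f : ℕ → ℝ) (δ : ℝ) (S : Finset ℕ) (s : ℝ) :
    kern (coef f δ) S s s ≤ Real.exp (4 * ∑ p ∈ S, amp f δ p ^ 2) := by
  refine (kern_le_exp (coef_sq_le_one f δ) S s s).trans (Real.exp_le_exp.2 ?_)
  rw [Finset.mul_sum]
  exact Finset.sum_le_sum fun p _ => (le_abs_self _).trans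
    ((abs_covTerm_le _ s s p).trans (coef_sq_le f δ p))

/-- For `δ > 0` even the diagonal kernel converges, because `∑ a² < ∞`. The densities are therefore
Cauchy in `L²(P)` at every point, uniformly in `s`. -/
lemma exists_eLpNorm_dens_sub_le (he : SignFamily P e) (h : IsAdmissible θ f) (hδ : 0 < δ)
    {η : ℝ} (hη : 0 < η) :
    ∃ N0 : ℕ, ∀ N M : ℕ, N0 ≤ N → N ≤ M → ∀ s,
      eLpNorm (dens (coef f δ) e (primesIoc 0 M) s - dens (coef f δ) e (primesIoc 0 N) s) 2 P ≤
        ENNReal.ofReal η := by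
  have hc := abs_coef_le_one f δ
  set E := Real.exp (4 * ampTotal f δ) with hE
  have hE0 : 0 < E := Real.exp_pos _
  have hε : 0 < η ^ 2 / E := by positivity
  -- With the tail of `∑ a²` below this, the diagonal kernel over `(N, M]` is at most `exp (4 ∑ a²)
  -- ≤ 1 + η²/E`.
  have hlog : 0 < Real.log (1 + η ^ 2 / E) / 4 :=
    div_pos (Real.log_pos (by linarith)) (by norm_num)
  obtain ⟨N0, hN0⟩ := eventually_atTop.1 (h.eventually_sum_amp_sq_le hδ hlog)
  refine ⟨N0, fun N M hN hM s => ?_⟩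
  refine eLpNorm_two_le hη.le ((memLp_dens he hc _ s 2).sub (memLp_dens he hc _ s 2)) ?_
  have h1 := integral_dens_sub_mul_dens_sub he hc prime_of_mem_primesIoc
    (primesIoc_subset (L := 0) hM) s s
  have h2 : ∫ ω, (dens (coef f δ) e (primesIoc 0 M) s - dens (coef f δ) e (primesIoc 0 N) s) ω ^ 2 ∂P
      = kern (coef f δ) (primesIoc 0 M) s s - kern (coef f δ) (primesIoc 0 N) s s := by
    rw [← h1]
    exact integral_congr_ae (ae_of_all _ fun ω => by simp only [Pi.sub_apply]; ring)
  rw [h2, kern_primesIoc_mul _ (Nat.zero_le N) hM]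
  have h3 : kern (coef f δ) (primesIoc 0 N) s s ≤ E :=
    (kern_self_le_exp f δ _ s).trans (Real.exp_le_exp.2 (by linarith [h.sum_amp_sq_le hδ 0 N]))
  have h4 : kern (coef f δ) (primesIoc N M) s s ≤ 1 + η ^ 2 / E := by
    refine (kern_self_le_exp f δ _ s).trans ?_
    rw [← Real.le_log_iff_exp_le (by positivity)]
    linarith [hN0 N hN M]
  have h5 := kern_nonneg (coef_sq_le_one f δ) (primesIoc 0 N) s s
  calc _ = kern (coef f δ) (primesIoc 0 N) s s * (kern (coef f δ) (primesIoc N M) s s - 1) := by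
        ring
    _ ≤ kern (coef f δ) (primesIoc 0 N) s s * (η ^ 2 / E) :=
        mul_le_mul_of_nonneg_left (by linarith) h5
    _ ≤ E * (η ^ 2 / E) := mul_le_mul_of_nonneg_right h3 hε.le
    _ = η ^ 2 := by field_simp

omit [IsProbabilityMeasure P] in
lemma measurable_of_joint_left {E : Type*} [MeasurableSpace E] (F : ℝ → Ω → E)
    (hF : Measurable fun z : ℝ × Ω => F z.1 z.2) (s : ℝ) : Measurable (F s) :=
  hF.comp measurable_prodMk_left

omit [IsProbabilityMeasure P] in
lemma measurable_of_joint_right {E : Type*} [MeasurableSpace E] (F : ℝ → Ω → E)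
    (hF : Measurable fun z : ℝ × Ω => F z.1 z.2) (ω : Ω) : Measurable fun s => F s ω :=
  hF.comp measurable_prodMk_right

omit [IsProbabilityMeasure P] in
lemma measurable_of_joint_swap {E : Type*} [MeasurableSpace E] (F : ℝ → Ω → E)
    (hF : Measurable fun z : ℝ × Ω => F z.1 z.2) : Measurable fun z : Ω × ℝ => F z.2 z.1 :=
  hF.comp measurable_swap

/-- The normalised density of the full product on the line `Re z = (1+δ)/2`. -/
def densInf (P : Measure Ω) (f : ℕ → ℝ) (δ : ℝ) (e : ℕ → Ω → ℝ) (s : ℝ) (ω : Ω) : ℝ :=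
  ‖eulerProdInf f e ω (vert ((1 + δ) / 2) s)‖ ^ 2 /
    ∫ ω', ‖eulerProdInf f e ω' (vert ((1 + δ) / 2) s)‖ ^ 2 ∂P

omit [IsProbabilityMeasure P] in
lemma measurable_eulerProdInf (he : SignFamily P e) (f : ℕ → ℝ) (δ : ℝ) :
    Measurable fun z : ℝ × Ω => eulerProdInf f e z.2 (vert ((1 + δ) / 2) z.1) := by
  refine (StronglyMeasurable.limUnder (l := atTop) (f := fun (N : ℕ) (z : ℝ × Ω) =>
    eulerProd f e N z.2 (vert ((1 + δ) / 2) z.1)) fun N => ?_).measurable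
  refine Measurable.stronglyMeasurable ?_
  simp only [eulerProd, vert]
  refine Finset.measurable_fun_prod _ fun p _ => ?_
  have := he.measurable p
  have h1 : Measurable fun z : ℝ × Ω => e p z.2 := this.comp measurable_snd
  fun_prop

/-- The full product on the line `Re z = (1+δ)/2` as a random field. -/
def fieldInf (f : ℕ → ℝ) (δ : ℝ) (e : ℕ → Ω → ℝ) (s : ℝ) (ω : Ω) : ℂ :=
  eulerProdInf f e ω (vert ((1 + δ) / 2) s)

omit [IsProbabilityMeasure P] in
lemma measurable_fieldInf (he : SignFamily P e) (f : ℕ → ℝ) (δ s : ℝ) :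
    Measurable (fieldInf f δ e s) :=
  measurable_of_joint_left (fieldInf f δ e) (measurable_eulerProdInf he f δ) s

lemma ae_tendsto_dens (he : SignFamily P e) (h : IsAdmissible θ f) (hδ : 0 < δ) {Q : ℝ}
    (hQ : 0 < Q) (hQlim : Tendsto (fun N => normalizer f δ (primesIoc 0 N)) atTop (𝓝 Q)) (s : ℝ) :
    ∀ᵐ ω ∂P, Tendsto (fun N => dens (coef f δ) e (primesIoc 0 N) s ω) atTop
      (𝓝 (‖fieldInf f δ e s ω‖ ^ 2 / Q)) := by
  filter_upwards [he.ae_tendsto_eulerProd h hδ s] with ω hω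
  refine ((hω.norm.pow 2).div hQlim hQ.ne').congr fun N => ?_
  rw [Pi.div_apply, norm_eulerProd_sq he, Nat.floor_natCast, mul_div_cancel_left₀ _ (normalizer_pos _ _ _).ne']

lemma exists_eLpNorm_limit_sub_dens_le (he : SignFamily P e) (h : IsAdmissible θ f) (hδ : 0 < δ)
    {D : ℝ → Ω → ℝ}
    (hae : ∀ s, ∀ᵐ ω ∂P, Tendsto (fun N => dens (coef f δ) e (primesIoc 0 N) s ω) atTop
      (𝓝 (D s ω))) {η : ℝ} (hη : 0 < η) :
    ∃ N0 : ℕ, ∀ N, N0 ≤ N → ∀ s,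
      eLpNorm (D s - dens (coef f δ) e (primesIoc 0 N) s) 2 P ≤ ENNReal.ofReal η := by
  have hc := abs_coef_le_one f δ
  obtain ⟨N0, hN0⟩ := exists_eLpNorm_dens_sub_le he h hδ hη
  refine ⟨N0, fun N hN s => ?_⟩
  refine Lp.eLpNorm_le_of_ae_tendsto (u := atTop)
    (f := fun M => dens (coef f δ) e (primesIoc 0 M) s - dens (coef f δ) e (primesIoc 0 N) s)
    ?_ (fun M => ((memLp_dens he hc _ s 2).sub (memLp_dens he hc _ s 2)).1) ?_
  · filter_upwards [eventually_ge_atTop N] with M hM using hN0 N M hN hM s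
  · filter_upwards [hae s] with ω hω using hω.sub_const _

lemma integral_eq_one_of_limit (he : SignFamily P e) (hc : ∀ p, |coef f δ p| ≤ 1) {Z : Ω → ℝ}
    (hZ : MemLp Z 2 P) (s : ℝ) (hrate : ∀ η : ℝ, 0 < η → ∃ N : ℕ,
      eLpNorm (Z - dens (coef f δ) e (primesIoc 0 N) s) 2 P ≤ ENNReal.ofReal η) :
    ∫ ω, Z ω ∂P = 1 := by
  have h0 : ∀ η : ℝ, 0 < η → |∫ ω, Z ω ∂P - 1| ≤ η := by
    intro η hη
    obtain ⟨N, hN⟩ := hrate η hη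
    have hi := (memLp_dens he hc (primesIoc 0 N) s 1).integrable le_rfl
    have h2 : MemLp (Z - dens (coef f δ) e (primesIoc 0 N) s) 2 P :=
      hZ.sub (memLp_dens he hc _ s 2)
    rw [← integral_dens he (coef f δ) (prime_of_mem_primesIoc (L := 0) (M := N)) s,
      ← integral_sub (hZ.integrable (by norm_num)) hi, ← Real.norm_eq_abs]
    refine (norm_integral_le_lintegral_norm _).trans (ENNReal.toReal_le_of_le_ofReal hη.le ?_)
    refine le_trans (le_of_eq ?_) ((eLpNorm_le_eLpNorm_of_exponent_le
      (by norm_num : (1 : ℝ≥0∞) ≤ 2) h2.1).trans hN)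
    rw [eLpNorm_one_eq_lintegral_enorm]
    exact lintegral_congr fun ω => ofReal_norm _
  have : |∫ ω, Z ω ∂P - 1| ≤ 0 :=
    le_of_forall_pos_le_add fun η hη => (h0 η hη).trans (zero_add η).ge
  exact sub_eq_zero.1 (abs_nonpos_iff.1 this)

/-- Existence, integrability and mean of the limiting density, with a uniform `L²` rate. -/
lemma exists_densInf_spec (he : SignFamily P e) (h : IsAdmissible θ f) (hδ : 0 < δ) :
    (∀ s, MemLp (fieldInf f δ e s) 2 P) ∧
    (∀ s, Integrable (densInf P f δ e s) P) ∧
    (∀ s, ∫ ω, densInf P f δ e s ω ∂P = 1) ∧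
    ∀ η : ℝ, 0 < η → ∃ N0 : ℕ, ∀ N, N0 ≤ N → ∀ s,
      eLpNorm (densInf P f δ e s - dens (coef f δ) e (primesIoc 0 N) s) 2 P ≤
        ENNReal.ofReal η := by
  have hc := abs_coef_le_one f δ
  obtain ⟨Q, hQ, hQlim⟩ := h.exists_tendsto_normalizer hδ
  obtain ⟨D, hD⟩ : ∃ D : ℝ → Ω → ℝ, ∀ s ω, D s ω = ‖fieldInf f δ e s ω‖ ^ 2 / Q :=
    ⟨fun s ω => ‖fieldInf f δ e s ω‖ ^ 2 / Q, fun _ _ => rfl⟩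
  have hDm : ∀ s, Measurable (D s) := fun s => by
    have : D s = fun ω => ‖fieldInf f δ e s ω‖ ^ 2 / Q := funext (hD s)
    rw [this]
    exact ((measurable_fieldInf he f δ s).norm.pow_const 2).div_const Q
  have hae : ∀ s, ∀ᵐ ω ∂P, Tendsto (fun N => dens (coef f δ) e (primesIoc 0 N) s ω) atTop
      (𝓝 (D s ω)) := fun s => by
    simp only [hD]; exact ae_tendsto_dens he h hδ hQ hQlim s
  have hrate := fun (η : ℝ) (hη : 0 < η) => exists_eLpNorm_limit_sub_dens_le he h hδ hae hη
  have hDL : ∀ s, MemLp (D s) 2 P := by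
    intro s
    obtain ⟨N0, hN0⟩ := hrate 1 one_pos
    exact memLp_of_eLpNorm_sub_lt_top (memLp_dens he hc (primesIoc 0 N0) s 2)
      (hDm s).aestronglyMeasurable ((hN0 N0 le_rfl s).trans_lt ENNReal.ofReal_lt_top)
  have hDi : ∀ s, Integrable (D s) P := fun s => (hDL s).integrable (by norm_num)
  have hD1 : ∀ s, ∫ ω, D s ω ∂P = 1 := fun s =>
    integral_eq_one_of_limit he hc (hDL s) s fun η hη => by
      obtain ⟨N0, hN0⟩ := hrate η hη
      exact ⟨N0, hN0 N0 le_rfl s⟩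
  -- The limit density has mean one, so the second moment of the full product equals the limit of
  -- the normalisers. Dividing by either gives the same density.
  have hAQ : ∀ s, ∫ ω, ‖fieldInf f δ e s ω‖ ^ 2 ∂P = Q := by
    intro s
    have := hD1 s
    simp only [hD] at this
    rwa [integral_div, div_eq_one_iff_eq hQ.ne'] at this
  have hDD : densInf P f δ e = D := by
    funext s ω
    rw [hD, ← hAQ s]; rfl
  rw [hDD]
  refine ⟨fun s => ?_, hDi, hD1, hrate⟩
  refine (memLp_two_iff_integrable_sq_norm (measurable_fieldInf he f δ s).aestronglyMeasurable).2 ?_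
  refine ((hDi s).mul_const Q).congr (ae_of_all _ fun ω => ?_)
  simp only [hD]
  exact div_mul_cancel₀ _ hQ.ne'

lemma measurable_densInf (he : SignFamily P e) (f : ℕ → ℝ) (δ : ℝ) :
    Measurable fun z : ℝ × Ω => densInf P f δ e z.1 z.2 := by
  have h1 := (measurable_eulerProdInf he f δ).norm.pow_const 2
  refine h1.div ?_
  have h2 : Measurable fun z : ℝ × Ω => ‖eulerProdInf f e z.2 (vert ((1 + δ) / 2) z.1)‖ ^ 2 := h1
  exact (h2.stronglyMeasurable.integral_prod_right' (ν := P)).measurable.comp measurable_fst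

/-- The random measure with density `densInf`. -/
def densInfMeasure (P : Measure Ω) (f : ℕ → ℝ) (δ : ℝ) (e : ℕ → Ω → ℝ) (ω : Ω) : Measure ℝ :=
  volume.withDensity fun s => ENNReal.ofReal (densInf P f δ e s ω)

lemma densInf_nonneg (P : Measure Ω) (f : ℕ → ℝ) (δ : ℝ) (e : ℕ → Ω → ℝ) (s : ℝ) (ω : Ω) :
    0 ≤ densInf P f δ e s ω :=
  div_nonneg (sq_nonneg _) (integral_nonneg fun _ => sq_nonneg _)

lemma lebesgueIntensity_densInfMeasure (he : SignFamily P e) (h : IsAdmissible θ f) (hδ : 0 < δ) :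
    LebesgueIntensity P (densInfMeasure P f δ e) :=
  lebesgueIntensity_withDensity (measurable_densInf he f δ) (densInf_nonneg P f δ e)
    (exists_densInf_spec he h hδ).2.1 (exists_densInf_spec he h hδ).2.2.1

lemma integral_densInfMeasure (he : SignFamily P e) (f : ℕ → ℝ) (δ : ℝ) (g : ℝ → ℝ) (ω : Ω) :
    ∫ s, g s ∂(densInfMeasure P f δ e ω) = ∫ s, g s * densInf P f δ e s ω :=
  integral_withDensity_ofReal
    (measurable_of_joint_right (densInf P f δ e) (measurable_densInf he f δ) ω)
    (fun s => densInf_nonneg P f δ e s ω) g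

/-- Pointwise convergence in `L¹(P)` at a rate uniform in `s` integrates against `|g|` by Tonelli.
This identifies the measure of the full product with the limit of truncations on the same line, so
the uniform `L²` rate applies to it. -/
lemma massTendsto_densInfMeasure (he : SignFamily P e) (h : IsAdmissible θ f) (hδ : 0 < δ)
    {g : ℝ → ℝ} (hg : Integrable g) (hgm : Measurable g) :
    MassTendsto P (fun N => densMeasure (coef f δ) e (primesIoc 0 N)) (densInfMeasure P f δ e) g := by
  have hc := abs_coef_le_one f δ
  obtain ⟨-, hDi, hD1, hrate⟩ := exists_densInf_spec he h hδ
  have hDm := measurable_densInf (P := P) he f δ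
  simp only [MassTendsto, integral_densMeasure he hc, integral_densInfMeasure he]
  have hDs := measurable_of_joint_swap (densInf P f δ e) hDm
  have hint : ∀ᵐ ω ∂P, Integrable fun s => g s * densInf P f δ e s ω := by
    have hm : AEStronglyMeasurable (fun z : Ω × ℝ => g z.2 * densInf P f δ e z.2 z.1)
        (P.prod volume) := by
      refine Measurable.aestronglyMeasurable ?_
      exact (hgm.comp measurable_snd).mul hDs
    have hi : Integrable (fun z : Ω × ℝ => g z.2 * densInf P f δ e z.2 z.1) (P.prod volume) := by
      refine (integrable_prod_iff' hm).2 ⟨ae_of_all _ fun s => (hDi s).const_mul (g s), ?_⟩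
      refine hg.norm.congr (ae_of_all _ fun s => ?_)
      simp only [norm_mul]
      rw [integral_const_mul]
      have : ∫ ω, ‖densInf P f δ e s ω‖ ∂P = 1 := by
        rw [← hD1 s]
        exact integral_congr_ae (ae_of_all _ fun ω => by
          simp only [Real.norm_eq_abs, abs_of_nonneg (densInf_nonneg P f δ e s ω)])
      rw [this, mul_one]
    exact hi.prod_right_ae
  have hbound : ∀ η : ℝ, 0 < η → ∀ᶠ N in atTop,
      eLpNorm (fun ω => mass (coef f δ) e (primesIoc 0 N) g ω - ∫ s, g s * densInf P f δ e s ω) 1 P ≤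
        ENNReal.ofReal η * ∫⁻ s, ‖g s‖ₑ := by
    intro η hη
    obtain ⟨N0, hN0⟩ := hrate η hη
    filter_upwards [eventually_ge_atTop N0] with N hN
    have hdm := measurable_dens he (coef f δ) (primesIoc 0 N)
    have hsub := measurable_of_joint_swap
      (fun s ω => densInf P f δ e s ω - dens (coef f δ) e (primesIoc 0 N) s ω) (hDm.sub hdm)
    have hsub' := measurable_of_joint_left
      (fun s ω => densInf P f δ e s ω - dens (coef f δ) e (primesIoc 0 N) s ω) (hDm.sub hdm)
    rw [eLpNorm_one_eq_lintegral_enorm]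
    calc _ ≤ ∫⁻ ω, ∫⁻ s, ‖g s‖ₑ *
          ‖densInf P f δ e s ω - dens (coef f δ) e (primesIoc 0 N) s ω‖ₑ ∂volume ∂P := by
          refine lintegral_mono_ae ?_
          filter_upwards [hint] with ω hω
          rw [mass, ← integral_sub (integrable_mul_dens he hc _ hg ω) hω]
          refine (enorm_integral_le_lintegral_enorm _).trans (lintegral_mono fun s => ?_)
          rw [← mul_sub, enorm_mul, ← enorm_neg (densInf P f δ e s ω - _), neg_sub]
      _ = ∫⁻ s, ‖g s‖ₑ * eLpNorm (densInf P f δ e s - dens (coef f δ) e (primesIoc 0 N) s) 1 P := by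
          rw [lintegral_lintegral_swap]
          · refine lintegral_congr fun s => ?_
            rw [lintegral_const_mul, eLpNorm_one_eq_lintegral_enorm]
            · rfl
            · exact (hsub' s).enorm
          · refine Measurable.aemeasurable ?_
            exact (hgm.comp measurable_snd).enorm.mul hsub.enorm
      _ ≤ ∫⁻ s, ENNReal.ofReal η * ‖g s‖ₑ := by
          refine lintegral_mono fun s => ?_
          rw [mul_comm]
          refine mul_le_mul_left ?_ _
          have h2 : AEStronglyMeasurable
              (densInf P f δ e s - dens (coef f δ) e (primesIoc 0 N) s) P :=
            (hDi s).1.sub (memLp_dens he hc _ s 1).1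
          exact (eLpNorm_le_eLpNorm_of_exponent_le (by norm_num) h2).trans (hN0 N hN s)
      _ = _ := lintegral_const_mul _ hgm.enorm
  have hG : (∫⁻ s, ‖g s‖ₑ) ≠ ∞ := hg.2.ne
  rw [ENNReal.tendsto_nhds_zero]
  intro ε hε
  by_cases hε' : ε = ∞
  · exact Eventually.of_forall fun N => hε' ▸ le_top
  set G := (∫⁻ s, ‖g s‖ₑ).toReal with hGdef
  have hG0 : 0 ≤ G := ENNReal.toReal_nonneg
  have hε0 : 0 < ε.toReal := ENNReal.toReal_pos hε.ne' hε'
  filter_upwards [hbound (ε.toReal / (G + 1)) (by positivity)] with N hN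
  refine hN.trans ?_
  rw [← ENNReal.ofReal_toReal hG, ← ENNReal.ofReal_mul (by positivity), ← hGdef]
  refine (ENNReal.ofReal_le_ofReal ?_).trans (ENNReal.ofReal_toReal hε').le
  rw [div_mul_eq_mul_div, div_le_iff₀ (by positivity)]
  nlinarith

end RandMult

/-! ### Passage to the limit `δ → 0` and the two convergence statements -/

namespace RandMult

variable {Ω : Type*} [MeasurableSpace Ω] {P : Measure Ω} {e : ℕ → Ω → ℝ} {θ δ : ℝ} {f : ℕ → ℝ}

lemma abs_prod_one_add_sub_le (x y : ℕ → ℝ) (S : Finset ℕ) (hx : ∀ p, |x p| ≤ 1)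
    (hy : ∀ p, |y p| ≤ 1) :
    |∏ p ∈ S, (1 + x p) - ∏ p ∈ S, (1 + y p)| ≤ 2 ^ S.card * ∑ p ∈ S, |x p - y p| := by
  induction S using Finset.induction_on with
  | empty => simp
  | insert a S ha ih =>
    rw [Finset.prod_insert ha, Finset.prod_insert ha, Finset.sum_insert ha,
      Finset.card_insert_of_notMem ha, pow_succ]
    have hx' : |∏ p ∈ S, (1 + x p)| ≤ 2 ^ S.card := by
      rw [Finset.abs_prod, ← Finset.prod_const]
      exact Finset.prod_le_prod (fun _ _ => abs_nonneg _) fun p _ =>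
        (abs_add_le _ _).trans (by rw [abs_one]; linarith [hx p])
    have hy' : |1 + y a| ≤ 2 := (abs_add_le _ _).trans (by rw [abs_one]; linarith [hy a])
    calc _ = |(x a - y a) * ∏ p ∈ S, (1 + x p) +
          (1 + y a) * (∏ p ∈ S, (1 + x p) - ∏ p ∈ S, (1 + y p))| := by congr 1; ring
      _ ≤ |x a - y a| * 2 ^ S.card + 2 * (2 ^ S.card * ∑ p ∈ S, |x p - y p|) := by
          refine (abs_add_le _ _).trans ?_
          rw [abs_mul, abs_mul]
          gcongr
      _ ≤ _ := by
          have : 0 ≤ |x a - y a| * 2 ^ S.card := by positivity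
          linarith

lemma abs_dens_sub_le (he : SignFamily P e) {c c' : ℕ → ℝ} (hc : ∀ p, |c p| ≤ 1)
    (hc' : ∀ p, |c' p| ≤ 1) (S : Finset ℕ) (s : ℝ) (ω : Ω) :
    |dens c e S s ω - dens c' e S s ω| ≤ 2 ^ S.card * ∑ p ∈ S, |c p - c' p| := by
  refine (abs_prod_one_add_sub_le _ _ S (fun p => abs_dens_factor he hc p s ω)
    fun p => abs_dens_factor he hc' p s ω).trans ?_
  refine mul_le_mul_of_nonneg_left (Finset.sum_le_sum fun p _ => ?_) (by positivity)
  rw [← sub_mul, ← sub_mul, abs_mul, abs_mul, he.abs_eq_one, mul_one]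
  exact mul_le_of_le_one_right (abs_nonneg _) (Real.abs_cos_le_one _)

lemma abs_mass_sub_le (he : SignFamily P e) {c c' : ℕ → ℝ} (hc : ∀ p, |c p| ≤ 1)
    (hc' : ∀ p, |c' p| ≤ 1) (S : Finset ℕ) {g : ℝ → ℝ} (hg : Integrable g) (ω : Ω) :
    |mass c e S g ω - mass c' e S g ω| ≤ (2 ^ S.card * ∑ p ∈ S, |c p - c' p|) * ∫ s, |g s| := by
  rw [mass, mass, ← integral_sub (integrable_mul_dens he hc S hg ω)
    (integrable_mul_dens he hc' S hg ω), ← integral_const_mul, ← Real.norm_eq_abs]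
  refine norm_integral_le_of_norm_le (hg.abs.const_mul _) (ae_of_all _ fun s => ?_)
  rw [← mul_sub, norm_mul, Real.norm_eq_abs, Real.norm_eq_abs, mul_comm]
  exact mul_le_mul_of_nonneg_right (abs_dens_sub_le he hc hc' S s ω) (abs_nonneg _)

lemma continuous_coef (f : ℕ → ℝ) (p : ℕ) : Continuous fun δ => coef f δ p := by
  unfold coef amp
  refine Continuous.div (by fun_prop) (by fun_prop) fun δ => ?_
  positivity

variable [IsProbabilityMeasure P]

/-- At fixed truncation the density depends continuously on finitely many coefficients, and the
bound is deterministic. -/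
lemma tendsto_eLpNorm_mass_sub (he : SignFamily P e) (f : ℕ → ℝ) (S : Finset ℕ) {g : ℝ → ℝ}
    (hg : Integrable g) :
    Tendsto (fun δ => eLpNorm (mass (coef f δ) e S g - mass (coef f 0) e S g) 2 P) (𝓝 0) (𝓝 0) := by
  have h1 : Continuous fun δ =>
      (2 ^ S.card * ∑ p ∈ S, |coef f δ p - coef f 0 p|) * ∫ s, |g s| := by
    have := continuous_coef f
    fun_prop
  have h2 := ENNReal.tendsto_ofReal (h1.tendsto 0)
  simp only [sub_self, abs_zero, Finset.sum_const_zero, mul_zero, zero_mul,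
    ENNReal.ofReal_zero] at h2
  refine tendsto_of_tendsto_of_tendsto_of_le_of_le tendsto_const_nhds h2 (fun _ => zero_le)
    fun δ => ?_
  refine (eLpNorm_le_of_ae_bound (C := (2 ^ S.card * ∑ p ∈ S, |coef f δ p - coef f 0 p|) *
    ∫ s, |g s|) (ae_of_all _ fun ω => ?_)).trans (le_of_eq ?_)
  · rw [Real.norm_eq_abs]
    exact abs_mass_sub_le he (abs_coef_le_one f δ) (abs_coef_le_one f 0) S hg ω
  · simp

lemma tendsto_zero_of_forall_ofReal {u : ℝ → ℝ≥0∞}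
    (h : ∀ η : ℝ, 0 < η → ∀ᶠ t in atTop, u t ≤ ENNReal.ofReal η) : Tendsto u atTop (𝓝 0) := by
  rw [ENNReal.tendsto_nhds_zero]
  intro ε hε
  by_cases hε' : ε = ∞
  · exact Eventually.of_forall fun t => hε' ▸ le_top
  · filter_upwards [h ε.toReal (ENNReal.toReal_pos hε.ne' hε')] with t ht
    exact ht.trans (ENNReal.ofReal_toReal hε').le

omit [IsProbabilityMeasure P] in
lemma TendstoL2.congr {X X' : ℝ → Ω → ℝ} {Y : Ω → ℝ} (h : TendstoL2 P X Y)
    (hX : ∀ y, X y =ᵐ[P] X' y) : TendstoL2 P X' Y := by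
  refine ⟨h.1.mono fun y hy => (memLp_congr_ae (hX y)).1 hy, h.2.1, h.2.2.congr fun y => ?_⟩
  exact eLpNorm_congr_ae ((hX y).sub (ae_eq_refl Y))

omit [IsProbabilityMeasure P] in
lemma TendstoL2.tendstoInMeasure {X : ℝ → Ω → ℝ} {Y : Ω → ℝ} (h : TendstoL2 P X Y) :
    TendstoInMeasure P X atTop Y := by
  classical
  -- Membership in `L²` is known only for large `y`; replacing the other variables by the limit
  -- makes the whole family measurable.
  set X' : ℝ → Ω → ℝ := fun y => if MemLp (X y) 2 P then X y else Y with hX'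
  have he : ∀ᶠ y in atTop, X' y = X y := h.1.mono fun y hy => if_pos hy
  refine TendstoInMeasure.congr' (f := X') (he.mono fun y hy => by rw [hy]) (ae_eq_refl Y)
    (tendstoInMeasure_of_tendsto_eLpNorm two_ne_zero (fun y => ?_) h.2.1.1
      (h.2.2.congr' (he.mono fun y hy => by simp only [hy])))
  by_cases hy : MemLp (X y) 2 P
  · simp only [hX', if_pos hy]; exact hy.1
  · simp only [hX', if_neg hy]; exact h.2.1.1

variable {R B : ℝ} {g : ℝ → ℝ} {m : Ω → Measure ℝ}

lemma tendstoL2_measY (he : SignFamily P e) (h : IsAdmissible θ f) (hm : LebesgueIntensity P m)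
    (hlim : ∀ g : ℝ → ℝ, Integrable g →
      MassTendsto P (fun N => densMeasure (coef f 0) e (primesIoc 0 N)) m g)
    (hg : TestFun R B g) :
    TendstoL2 P (fun y ω => ∫ s, g s ∂(measY P f e y ω)) fun ω => ∫ s, g s ∂(m ω) := by
  have hc := abs_coef_le_one f 0
  have hY := hm.aestronglyMeasurable_integral hg.integrable
  have hrate := fun (η : ℝ) (hη : 0 < η) => eLpNorm_integral_sub_mass_le he h R B hη
  simp only [measY_eq_densMeasure he, integral_densMeasure he hc]
  refine ⟨Eventually.of_forall fun y => memLp_mass he hc _ hg, ?_, ?_⟩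
  · obtain ⟨N0, hN0⟩ := hrate 1 one_pos
    exact memLp_of_eLpNorm_sub_lt_top (memLp_mass he hc _ hg) hY
      ((hN0 g hg 0 ⟨le_rfl, zero_le_one⟩ m hm (hlim g hg.integrable) N0 le_rfl).trans_lt
        ENNReal.ofReal_lt_top)
  · refine tendsto_zero_of_forall_ofReal fun η hη => ?_
    obtain ⟨N0, hN0⟩ := hrate η hη
    filter_upwards [eventually_ge_atTop (N0 : ℝ)] with y hy
    have := hN0 g hg 0 ⟨le_rfl, zero_le_one⟩ m hm (hlim g hg.integrable) ⌊y⌋₊ (Nat.le_floor hy)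
    rwa [eLpNorm_sub_comm] at this

lemma measT_eq_densInfMeasure (P : Measure Ω) (f : ℕ → ℝ) (e : ℕ → Ω → ℝ) (t : ℝ) (ω : Ω) :
    measT P f e t ω = densInfMeasure P f (1 / Real.log t) e ω := by
  have : sigma t = (1 + 1 / Real.log t) / 2 := by rw [sigma]; ring
  rw [measT, normSqMeasure, this]
  rfl

/-- Exchange of limits: a single truncation `N` is accurate to `η/3` for all `δ ∈ (0, 1]` and for
the limit measure, and at that `N` the masses are continuous at `δ = 0`. -/
lemma tendstoL2_measT (he : SignFamily P e) (h : IsAdmissible θ f) (hm : LebesgueIntensity P m)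
    (hlim : ∀ g : ℝ → ℝ, Integrable g →
      MassTendsto P (fun N => densMeasure (coef f 0) e (primesIoc 0 N)) m g)
    (hg : TestFun R B g) :
    TendstoL2 P (fun t ω => ∫ s, g s ∂(measT P f e t ω)) fun ω => ∫ s, g s ∂(m ω) := by
  have hY := hm.aestronglyMeasurable_integral hg.integrable
  have hM := fun (δ : ℝ) (N : ℕ) =>
    memLp_mass he (abs_coef_le_one f δ) (primesIoc 0 N) hg
  have hX : ∀ δ, 0 < δ → AEStronglyMeasurable (fun ω => ∫ s, g s ∂(densInfMeasure P f δ e ω)) P :=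
    fun δ hδ => (lebesgueIntensity_densInfMeasure he h hδ).aestronglyMeasurable_integral
      hg.integrable
  have hrate : ∀ η : ℝ, 0 < η → ∃ N, (∀ δ ∈ Set.Ioc (0 : ℝ) 1,
      eLpNorm ((fun ω => ∫ s, g s ∂(densInfMeasure P f δ e ω)) -
        mass (coef f δ) e (primesIoc 0 N) g) 2 P ≤ ENNReal.ofReal η) ∧
      eLpNorm ((fun ω => ∫ s, g s ∂(m ω)) - mass (coef f 0) e (primesIoc 0 N) g) 2 P ≤
        ENNReal.ofReal η := by
    intro η hη
    obtain ⟨N0, hN0⟩ := eLpNorm_integral_sub_mass_le he h R B hη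
    exact ⟨N0, fun δ hδ => hN0 g hg δ ⟨hδ.1.le, hδ.2⟩ _ (lebesgueIntensity_densInfMeasure he h hδ.1)
      (massTendsto_densInfMeasure he h hδ.1 hg.integrable hg.measurable) N0 le_rfl,
      hN0 g hg 0 ⟨le_rfl, zero_le_one⟩ m hm (hlim g hg.integrable) N0 le_rfl⟩
  have hδ0 : Tendsto (fun t : ℝ => 1 / Real.log t) atTop (𝓝 0) :=
    tendsto_const_nhds.div_atTop Real.tendsto_log_atTop
  have hδmem : ∀ᶠ t : ℝ in atTop, 1 / Real.log t ∈ Set.Ioc (0 : ℝ) 1 := by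
    filter_upwards [Real.tendsto_log_atTop.eventually_ge_atTop 1] with t ht
    exact ⟨by positivity, (div_le_one (by linarith)).2 ht⟩
  simp only [measT_eq_densInfMeasure]
  refine ⟨?_, ?_, ?_⟩
  · obtain ⟨N, hN, -⟩ := hrate 1 one_pos
    filter_upwards [hδmem] with t ht
    exact memLp_of_eLpNorm_sub_lt_top (hM _ N) (hX _ ht.1)
      ((hN _ ht).trans_lt ENNReal.ofReal_lt_top)
  · obtain ⟨N, -, hN⟩ := hrate 1 one_pos
    exact memLp_of_eLpNorm_sub_lt_top (hM 0 N) hY (hN.trans_lt ENNReal.ofReal_lt_top)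
  · refine tendsto_zero_of_forall_ofReal fun η hη => ?_
    have hη3 : 0 < η / 3 := by positivity
    obtain ⟨N, hN, hN'⟩ := hrate (η / 3) hη3
    have hsmall := ((tendsto_eLpNorm_mass_sub he f (primesIoc 0 N) hg.integrable).comp
      hδ0).eventually (ge_mem_nhds (ENNReal.ofReal_pos.2 hη3))
    filter_upwards [hδmem, hsmall] with t ht hts
    set δ := 1 / Real.log t
    have h1 := hN δ ht
    set X : Ω → ℝ := fun ω => ∫ s, g s ∂(densInfMeasure P f δ e ω)
    set Y : Ω → ℝ := fun ω => ∫ s, g s ∂(m ω)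
    set U := mass (coef f δ) e (primesIoc 0 N) g
    set V := mass (coef f 0) e (primesIoc 0 N) g
    have h2 : eLpNorm (U - V) 2 P ≤ ENNReal.ofReal (η / 3) := hts
    have hU : AEStronglyMeasurable U P := (hM δ N).1
    have hV : AEStronglyMeasurable V P := (hM 0 N).1
    rw [eLpNorm_sub_comm] at hN'
    have e1 : X - Y = ((X - U) + (U - V)) + (V - Y) := by abel
    rw [e1]
    calc _ ≤ (eLpNorm (X - U) 2 P + eLpNorm (U - V) 2 P) + eLpNorm (V - Y) 2 P :=
          (eLpNorm_add_le (((hX δ ht.1).sub hU).add (hU.sub hV)) (hV.sub hY) (by norm_num)).trans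
            (add_le_add_left (eLpNorm_add_le ((hX δ ht.1).sub hU) (hU.sub hV) (by norm_num)) _)
      _ ≤ (ENNReal.ofReal (η / 3) + ENNReal.ofReal (η / 3)) + ENNReal.ofReal (η / 3) := by
          gcongr
      _ = ENNReal.ofReal η := by
          rw [← ENNReal.ofReal_add hη3.le hη3.le, ← ENNReal.ofReal_add (by positivity) hη3.le]
          ring_nf

lemma exists_testFun_indicator {I : Set ℝ} (hI : I.OrdConnected) (hb : Bornology.IsBounded I)
    {k : ℝ → ℝ} (hk : ContinuousOn k I) (hkb : Bornology.IsBounded (k '' I)) :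
    ∃ R B, TestFun R B (I.indicator k) := by
  classical
  obtain ⟨R, hR⟩ := hb.exists_norm_le
  obtain ⟨B, hB⟩ := hkb.exists_norm_le
  -- For empty `I` the bound `B` may be negative, whereas the indicator still takes the value 0.
  refine ⟨R, max B 0, ?_, fun s => ?_, fun s hs => ?_⟩
  · rw [← Set.piecewise_eq_indicator]
    exact hk.measurable_piecewise continuousOn_const hI.measurableSet
  · by_cases hs : s ∈ I
    · rw [Set.indicator_of_mem hs]
      exact (hB _ (Set.mem_image_of_mem k hs)).trans (le_max_left _ _)
    · rw [Set.indicator_of_notMem hs, abs_zero]; exact le_max_right _ _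
  · exact Set.indicator_of_notMem (fun h => hs (abs_le.1 (hR s h))) _

omit [IsProbabilityMeasure P] in
omit [MeasurableSpace Ω] in
lemma eulerProd_congr {β : ℕ → Ω → ℝ} {ω : Ω} (h : ∀ p : ℕ, p.Prime → β p ω = e p ω)
    (f : ℕ → ℝ) (y : ℝ) (z : ℂ) : eulerProd f β y ω z = eulerProd f e y ω z := by
  rw [eulerProd, eulerProd, primesLE_eq_primesIoc]
  exact Finset.prod_congr rfl fun p hp => by rw [h p (prime_of_mem_primesIoc p hp)]

omit [IsProbabilityMeasure P] in
lemma normSqMeasure_congr {A A' : Ω → ℂ → ℂ} (h : ∀ᵐ ω ∂P, A ω = A' ω) (σ : ℝ) :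
    ∀ᵐ ω ∂P, normSqMeasure P A σ ω = normSqMeasure P A' σ ω := by
  filter_upwards [h] with ω hω
  rw [normSqMeasure, normSqMeasure, hω]
  congr 1
  funext s
  rw [integral_congr_ae (g := fun ω' => ‖A' ω' (vert σ s)‖ ^ 2)
    (h.mono fun ω' hω' => by simp only [hω'])]

end RandMult

end

/-! ### The main theorem -/

section

open RandMult

theorem theorem4p7 {Ω : Type*} [MeasurableSpace Ω] (P : Measure Ω) [IsProbabilityMeasure P]
    (β : ℕ → Ω → ℝ) (hβ : RandMult.IsRademacher P β)
    (θ : ℝ) (hθ : θ ∈ Set.Ioo (0 : ℝ) (1 / 2))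
    (f : ℕ → ℝ) (hf : f ∈ RandMult.MultSquarefree)
    (hP : (fun n : ℕ => ((f n ^ 2 : ℝ) : ℂ)) ∈ RandMult.ClassP (θ : ℂ))
    (hsum : Summable fun p : Nat.Primes => |f p| ^ 3 / (p : ℝ) ^ (3 / 2 : ℝ)) :
    -- the full Euler product at `σ_t + is` is well defined and square integrable
    (∀ t : ℝ, 1 < t → ∀ s : ℝ,
      (∀ᵐ ω ∂P, Tendsto (fun N : ℕ => RandMult.eulerProd f β N ω
          (RandMult.vert (RandMult.sigma t) s)) atTop
        (𝓝 (RandMult.eulerProdInf f β ω (RandMult.vert (RandMult.sigma t) s)))) ∧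
      MemLp (fun ω => RandMult.eulerProdInf f β ω (RandMult.vert (RandMult.sigma t) s)) 2 P) ∧
    -- existence of the limiting random Radon measure
    ∃ m : Ω → Measure ℝ,
      Measurable m ∧
      (∀ ω, IsLocallyFiniteMeasure (m ω)) ∧
      (∀ᵐ ω ∂P, m ω ≠ 0) ∧
      (∀ I : Set ℝ, I.OrdConnected → Bornology.IsBounded I →
        ∀ h : ℝ → ℝ, ContinuousOn h I → Bornology.IsBounded (h '' I) →
          RandMult.TendstoL2 P (fun y ω => ∫ s in I, h s ∂(RandMult.measY P f β y ω))
            (fun ω => ∫ s in I, h s ∂(m ω)) ∧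
          RandMult.TendstoL2 P (fun t ω => ∫ s in I, h s ∂(RandMult.measT P f β t ω))
            (fun ω => ∫ s in I, h s ∂(m ω)) ∧
          TendstoInMeasure P (fun y ω => ∫ s in I, h s ∂(RandMult.measY P f β y ω)) atTop
            (fun ω => ∫ s in I, h s ∂(m ω)) ∧
          TendstoInMeasure P (fun t ω => ∫ s in I, h s ∂(RandMult.measT P f β t ω)) atTop
            (fun ω => ∫ s in I, h s ∂(m ω))) ∧
      (∀ᵐ ω ∂P, (m ω).support = Set.univ) := by
  have he := hβ.signFamily
  have hadm := isAdmissible_of hθ hP hsum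
  have hae := hβ.ae_eq_signs
  set e := signs β
  -- The products for `β` and for its signs agree almost surely as functions of the whole complex
  -- variable, hence so do the random measures and their normalisations.
  have haeP : ∀ y, ∀ᵐ ω ∂P, eulerProd f β y ω = eulerProd f e y ω := fun y =>
    hae.mono fun ω hω => funext fun z => eulerProd_congr hω f y z
  have haeI : ∀ᵐ ω ∂P, eulerProdInf f β ω = eulerProdInf f e ω := hae.mono fun ω hω =>
    funext fun z => by simp only [eulerProdInf, eulerProd_congr hω]
  obtain ⟨m, hm, hloc, hlim⟩ := exists_limit_densMeasure he hadm
  have hsupp := ae_support_eq_univ he hadm hm hlim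
  refine ⟨fun t ht s => ?_, m, hm.measurable, hloc, ?_, ?_, hsupp⟩
  · have hσ : sigma t = (1 + 1 / Real.log t) / 2 := by rw [sigma]; ring
    have hδ : 0 < 1 / Real.log t := one_div_pos.2 (Real.log_pos ht)
    rw [hσ]
    refine ⟨?_, ?_⟩
    · filter_upwards [hae, haeI, he.ae_tendsto_eulerProd hadm hδ s] with ω h1 h2 h3
      rw [h2]
      simpa only [eulerProd_congr h1] using h3
    · refine (memLp_congr_ae ?_).2 ((exists_densInf_spec he hadm hδ).1 s)
      filter_upwards [haeI] with ω hω
      rw [hω]; rfl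
  · filter_upwards [hsupp] with ω hω h0
    have : (0 : ℝ) ∈ (m ω).support := hω ▸ Set.mem_univ _
    rw [Measure.mem_support_iff_forall] at this
    exact (this Set.univ univ_mem).ne' (by rw [h0]; rfl)
  · intro I hI hIb h hcont hbdd
    obtain ⟨R, B, hg⟩ := exists_testFun_indicator hI hIb hcont hbdd
    have hint : ∀ μ : Measure ℝ, ∫ s in I, h s ∂μ = ∫ s, I.indicator h s ∂μ := fun μ =>
      (integral_indicator hI.measurableSet).symm
    simp only [hint]
    have h1 : TendstoL2 P (fun y ω => ∫ s, I.indicator h s ∂(measY P f β y ω))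
        fun ω => ∫ s, I.indicator h s ∂(m ω) :=
      (tendstoL2_measY he hadm hm hlim hg).congr fun y => by
        filter_upwards [normSqMeasure_congr (haeP y) (1 / 2)] with ω hω
        rw [measY, measY, hω]
    have h2 : TendstoL2 P (fun t ω => ∫ s, I.indicator h s ∂(measT P f β t ω))
        fun ω => ∫ s, I.indicator h s ∂(m ω) :=
      (tendstoL2_measT he hadm hm hlim hg).congr fun t => by
        filter_upwards [normSqMeasure_congr haeI (sigma t)] with ω hω
        rw [measT, measT, hω]
    exact ⟨h1, h2, h1.tendstoInMeasure, h2.tendstoInMeasure⟩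

end
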